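/- **Conventions.** A *polygon* is a nonempty subset of $\mathbb{R}^2$ that is a finite union of nondegenerate closed triangles (not necessarily convex). Its *vertices* are the boundary points near which the boundary is not a straight line, and it *has denominator $d$* if $d$ is the least positive integer such that $dP$ has integer vertices. Let $\mathcal{L}_d=\frac1d\mathbb{Z}\times\frac1d\mathbb{Z}$. A *$G$-map* is a map $x\mapsto Ux+v$ of $\mathbb{R}^2$ with $U\in GL_2(\mathbb{Z})$, $v\in\mathbb{Z}^2$. A *triangulation* $\mathcal{T}$ of $P$ is a finite collection of open simplices (points, open segments, open triangles) with rational vertices whose disjoint union is $P$; $\mathcal{T}^{\Delta}$ denotes the set of its open triangles (facets). A *facet map* $\mathcal{T}_1^{\Delta}\to\mathcal{T}_2^{\Delta}$ is a bijection between the sets of facets that is given on each facet by some $G$-map (possibly different on different facets). A triangle $T$ is *$d$-minimal* if $T\cap\mathcal{L}_d$ consists exactly of its three vertices; a triangulation is *$d$-minimal* if all closed triangles spanned by its facets are. The weight of an oriented edge from $(\frac wd,\frac xd)$ to $(\frac yd,\frac zd)$ ($w,x,y,z\in\mathbb{Z}$) is $wz-xy \bmod d$. The weight $W_d(T)$ of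 a $d$-minimal triangle is the multiset of the weights of its three edges, oriented counterclockwise. A *pseudo-flip* (at level $d$) transforms a finite multiset $\tau$ of weights of $d$-minimal triangles as follows: if $S_1,S_2$ are $d$-minimal triangles that share an edge and form a parallelogram, and $\tau$ contains $\omega_1=W_d(S_1)$ and $\omega_2=W_d(S_2)$ (with multiplicity two if they are equal), then $\omega_1,\omega_2$ are replaced in $\tau$ by $W_d(S_1'),W_d(S_2')$, where $S_1',S_2'$ are the two triangles into which the other diagonal cuts the parallelogram. Finally, $\mathcal{D}_d(P)$ is the set of all multisets obtainable by finitely many (possibly zero) pseudo-flips from the multiset of weights of the facets of a $d$-minimal triangulation of $P$ (any $d$-minimal triangulation of $P$ may be used as the initial one). **Proposition (existence of a facet map).** Let $P$ and $Q$ be polygons of the same denominator $d$. Then $\mathcal{D}_{d'}(P)=\mathcal{D}_{d'}(Q)$ for some positive integer $d'$ divisible by $d$ if and only if there is a facet map $\mathcal{T}_1^{\Delta}\to\mathcal{T}_2^{\Delta}$ for some triangulation $\mathcal{T}_1$ of $P$ and some triangulation $\mathcal{T}_2$ of $Q$. -/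

import Mathlib

open Set Topology

noncomputable section

namespace FacetMaps

/-- The plane `ℝ²`. Only its vector space structure and its topology are used. -/
abbrev Plane : Type := Fin 2 → ℝ

/-! ### The affine unimodular group -/

/-- An element `U ⋊ v` of the affine unimodular group `G = GL₂(ℤ) ⋊ ℤ²`. -/
structure AffineUnimodular where
  U : GL (Fin 2) ℤ
  v : Fin 2 → ℤ

/-- The `G`-map `x ↦ U x + v` of the plane. -/
def AffineUnimodular.act (g : AffineUnimodular) (x : Plane) : Plane :=
  ((g.U : Matrix (Fin 2) (Fin 2) ℤ).map (fun k : ℤ => (k : ℝ))).mulVec x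
    + fun i => (g.v i : ℝ)

/-! ### Lattices and polygons -/

/-- The lattice `𝓛_d = (1/d)ℤ × (1/d)ℤ` (for `d > 0`). -/
def lattice (d : ℕ) : Set Plane :=
  {x | ∀ i, ∃ k : ℤ, (d : ℝ) * x i = k}

/-- The vertex set of a nondegenerate triangle. -/
def IsTriangle (s : Finset Plane) : Prop :=
  s.card = 3 ∧ AffineIndependent ℝ ((↑) : s → Plane)

/-- A polygon, not necessarily convex: a nonempty union of finitely many nondegenerate
closed triangles. -/
def IsPolygon (P : Set Plane) : Prop :=
  ∃ 𝒯 : Finset (Finset Plane), 𝒯.Nonempty ∧ (∀ s ∈ 𝒯, IsTriangle s) ∧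
    P = ⋃ s ∈ 𝒯, convexHull ℝ (s : Set Plane)

/-- The vertices of a polygon `P`: the boundary points near which the boundary of `P` is
not a straight line. -/
def vertices (P : Set Plane) : Set Plane :=
  {p | p ∈ frontier P ∧
    ¬ ∃ u : Plane, u ≠ 0 ∧ ∀ᶠ x in 𝓝 p, (x ∈ frontier P ↔ ∃ t : ℝ, x = p + t • u)}

/-- `d` is the least positive integer such that `dP` has integer vertices. -/
def HasDenominator (P : Set Plane) (d : ℕ) : Prop :=
  IsLeast {n : ℕ | 0 < n ∧ ∀ p ∈ vertices P, p ∈ lattice n} d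

/-! ### Triangulations -/

/-- The open simplex (point, open segment or open triangle) with vertex set `s`. -/
def openSimplex (s : Finset Plane) : Set Plane :=
  {x | ∃ w : Plane → ℝ, (∀ p ∈ s, 0 < w p) ∧ ∑ p ∈ s, w p = 1 ∧ ∑ p ∈ s, w p • p = x}

/-- A triangulation of `P`: a finite collection of open simplices with rational vertices,
of which `P` is the disjoint union. A simplex is recorded by its set of vertices. -/
structure Triangulation (P : Set Plane) where
  simplices : Finset (Finset Plane)
  nonempty : ∀ s ∈ simplices, s.Nonempty
  affineIndependent : ∀ s ∈ simplices, AffineIndependent ℝ ((↑) : s → Plane)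
  rational : ∀ s ∈ simplices, ∀ p ∈ s, ∀ i, ∃ q : ℚ, p i = q
  disjoint : ∀ s ∈ simplices, ∀ t ∈ simplices, s ≠ t →
    Disjoint (openSimplex s) (openSimplex t)
  iUnion_eq : ⋃ s ∈ simplices, openSimplex s = P

/-- The facets (two-dimensional simplices) of a triangulation. -/
def Triangulation.facets {P : Set Plane} (T : Triangulation P) : Finset (Finset Plane) :=
  T.simplices.filter fun s => s.card = 3

/-- A facet map: a bijection between the sets of open facets of two triangulations which is
given by a `G`-map on every facet. -/
structure FacetMap {P Q : Set Plane} (T₁ : Triangulation P) (T₂ : Triangulation Q) where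
  toEquiv : T₁.facets ≃ T₂.facets
  gmap : T₁.facets → AffineUnimodular
  image_eq : ∀ F : T₁.facets,
    (gmap F).act '' openSimplex (F : Finset Plane) = openSimplex (toEquiv F : Finset Plane)

/-! ### Minimal triangles and their weights -/

/-- The triangle with vertex set `s` is `d`-minimal: it meets `𝓛_d` exactly in its vertices. -/
def IsMinimalTriangle (d : ℕ) (s : Finset Plane) : Prop :=
  IsTriangle s ∧ convexHull ℝ (s : Set Plane) ∩ lattice d = (s : Set Plane)

/-- A `d`-minimal triangulation: all facets are `d`-minimal triangles. -/
def Triangulation.IsMinimal {P : Set Plane} (T : Triangulation P) (d : ℕ) : Prop :=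
  ∀ s ∈ T.facets, IsMinimalTriangle d s

/-- The weight of the oriented edge from `p = (w/d, x/d)` to `q = (y/d, z/d)`, where
`w, x, y, z` are integers: the residue of `wz - xy` modulo `d`. The floors are exact, since
`p` and `q` lie in `𝓛_d`. -/
def edgeWeight (d : ℕ) (p q : Plane) : ZMod d :=
  ((⌊(d : ℝ) * p 0⌋ * ⌊(d : ℝ) * q 1⌋ - ⌊(d : ℝ) * p 1⌋ * ⌊(d : ℝ) * q 0⌋ : ℤ) : ZMod d)

/-- `det (q - p, r - p)`; it is positive iff `p, q, r` are in counterclockwise order. -/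
def orient (p q r : Plane) : ℝ :=
  (q 0 - p 0) * (r 1 - p 1) - (q 1 - p 1) * (r 0 - p 0)

/-- The edges `(p, q)` of the triangle with vertex set `s`, oriented counterclockwise:
the third vertex lies to the left of the edge from `p` to `q`. -/
def ccwEdges (s : Finset Plane) : Finset (Plane × Plane) :=
  s.offDiag.filter fun e => ∃ r ∈ s, 0 < orient e.1 e.2 r

/-- The weight of a `d`-minimal triangle: the multiset of the weights of its three edges,
oriented counterclockwise. -/
def weight (d : ℕ) (s : Finset Plane) : Multiset (ZMod d) :=
  (ccwEdges s).val.map fun e => edgeWeight d e.1 e.2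

/-- The multiset of the weights of the facets of a triangulation. -/
def Triangulation.weights {P : Set Plane} (T : Triangulation P) (d : ℕ) :
    Multiset (Multiset (ZMod d)) :=
  T.facets.val.map (weight d)

/-! ### Pseudo-flips -/

/-- There are adjacent `d`-minimal triangles `S₁ = abc` and `S₂ = bce` of weights `ω₁` and
`ω₂`, forming a parallelogram with diagonal `bc`, such that exchanging this diagonal for the
diagonal `ae` gives the triangles `abe` and `ace` of weights `ω₁'` and `ω₂'`. -/
def WeightFlip (d : ℕ) (ω₁ ω₂ ω₁' ω₂' : Multiset (ZMod d)) : Prop :=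
  ∃ a b c e : Plane, IsMinimalTriangle d {a, b, c} ∧ IsMinimalTriangle d {b, c, e} ∧
    a + e = b + c ∧
    ω₁ = weight d {a, b, c} ∧ ω₂ = weight d {b, c, e} ∧
    ω₁' = weight d {a, b, e} ∧ ω₂' = weight d {a, c, e}

/-- `τ'` arises from the multiset `τ` of weights by one pseudo-flip: two members of `τ`
are replaced by the weights obtained by exchanging a diagonal. -/
def PseudoFlip (d : ℕ) (τ τ' : Multiset (Multiset (ZMod d))) : Prop :=
  ∃ (ρ : Multiset (Multiset (ZMod d))) (ω₁ ω₂ ω₁' ω₂' : Multiset (ZMod d)),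
    WeightFlip d ω₁ ω₂ ω₁' ω₂' ∧ τ = {ω₁, ω₂} + ρ ∧ τ' = {ω₁', ω₂'} + ρ

/-- `𝓓_d(P)`: all multisets of weights that can be obtained by finitely many pseudo-flips
from the multiset of weights of a `d`-minimal triangulation of `P`. -/
def pseudoTriangulations (d : ℕ) (P : Set Plane) : Set (Multiset (Multiset (ZMod d))) :=
  {τ | ∃ T₀ : Triangulation P, T₀.IsMinimal d ∧
    Relation.ReflTransGen (PseudoFlip d) (T₀.weights d) τ}

end FacetMaps

end

/-!
The proof rests on two facts about tilings by `d`-minimal triangles (`IsTiling`).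

**Flip connectivity.** Any two `d`-minimal tilings of the same set are connected by flips of
parallelograms (`IsTiling.flip_connected`). A primitive lattice segment `e` inside the set can be made
an edge by flips: among the triangles that meet `e` and have vertices on both sides of it, take one
that extends farthest across the line of `e`. Together with its neighbour across the edge from its
highest to its lowest vertex it forms a parallelogram, and the flip lowers the sum over all triangles
of their extent across the line (`IsTiling.exists_flip`). Edges that do not cross `e` survive, so all
edges of a second tiling can be inserted, and then the two tilings agree. Hence the multisets reachable
by pseudo-flips do not depend on the tiling with which one starts.

**Weights.** Two `d`-minimal triangles have the same weight iff a `G`-map takes one to the other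
(`weight_image`, `exists_image_eq_of_weight_eq`).

*A facet map gives equal sets of pseudo-triangulations* (`exists_pseudoTriangulations_eq`). For a
multiple `d'` of `d` such that the vertices of the facets lie in `𝓛_{d'}`, every facet has a
`d'`-minimal tiling (`IsPolygon.exists_tiling`). These tilings, and their images under the facet map,
are tilings of `P` and `Q` with the same weights, and flip connectivity does the rest.

*Equal sets give a facet map* (`exists_facetMap`). The weights of a minimal triangulation of `Q` are
reached by pseudo-flips from those of a minimal triangulation of `P`. Each pseudo-flip, and each choice
of other triangles with the same weights, is an equidecomposition of families of triangles by `G`-maps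
up to nowhere dense sets (`Equidecomposable`), and equidecomposability is transitive by taking common
refinements of the pieces. So `P` and `Q` are cut into open pieces matched by `G`-maps. The pieces are
semilinear, that is, cut out by the signs of rational affine functionals, so they can be triangulated
(`exists_triangulation_of_isSemilinear`). The facets of their triangulations are the facets of
triangulations of `P` and `Q`, as the rest is semilinear too (`exists_triangulation_facets_eq`).
-/

noncomputable section

namespace FacetMaps

/-! ### Open and closed triangles -/

lemma affineIndependent_finset_iff (s : Finset Plane) :
    AffineIndependent ℝ ((↑) : s → Plane) ↔
      ∀ w : Plane → ℝ, ∑ p ∈ s, w p = 0 → ∑ p ∈ s, w p • p = 0 → ∀ p ∈ s, w p = 0 := by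
  classical
  rw [affineIndependent_iff]
  constructor
  · intro h w h0 h1 p hp
    refine h Finset.univ (fun q : s => w q) ?_ ?_ ⟨p, hp⟩ (Finset.mem_univ _)
    · rw [← h0, ← Finset.sum_coe_sort s w]
    · rw [← h1, ← Finset.sum_coe_sort s (fun p => w p • p)]
  · intro h t w h0 h1 e he
    let w' : Plane → ℝ := fun p => if hp : p ∈ s then (if (⟨p, hp⟩ : s) ∈ t then w ⟨p, hp⟩ else 0)
        else 0
    have key : ∀ e : s, w' e = if e ∈ t then w e else 0 := by
      intro e
      simp [w']
    have h2 := h w' ?_ ?_ e e.2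
    · rw [key, if_pos he] at h2
      exact h2
    · rw [← Finset.sum_coe_sort s w']
      simp only [key]
      rw [Finset.sum_ite_mem, Finset.univ_inter, h0]
    · rw [← Finset.sum_coe_sort s (fun p => w' p • p)]
      simp only [key, ite_smul, zero_smul]
      rw [Finset.sum_ite_mem, Finset.univ_inter, h1]

lemma plane_ext {x y : Plane} (h0 : x 0 = y 0) (h1 : x 1 = y 1) : x = y := by
  ext i
  fin_cases i
  · exact h0
  · exact h1

lemma orient_rotate (p q r : Plane) : orient q r p = orient p q r := by
  simp only [orient]; ring

lemma orient_swap (p q r : Plane) : orient p r q = -orient p q r := by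
  simp only [orient]; ring

lemma orient_swap' (p q r : Plane) : orient q p r = -orient p q r := by
  simp only [orient]; ring

@[simp] lemma orient_self_left (p q : Plane) : orient p q p = 0 := by
  simp only [orient]; ring

@[simp] lemma orient_self_right (p q : Plane) : orient p q q = 0 := by
  simp only [orient]; ring

@[simp] lemma orient_self_eq (p q : Plane) : orient p p q = 0 := by
  simp only [orient]; ring

lemma orient_sum (p q r x : Plane) :
    orient q r x + orient r p x + orient p q x = orient p q r := by
  simp only [orient]; ring

/-- `orient v w` is affine: its value at a barycentric combination. -/
lemma orient_combo (v w p q r : Plane) {α β γ : ℝ} (h : α + β + γ = 1) :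
    orient v w (α • p + β • q + γ • r)
      = α * orient v w p + β * orient v w q + γ * orient v w r := by
  obtain rfl : α = 1 - β - γ := by linarith
  simp only [orient, Pi.add_apply, Pi.smul_apply, smul_eq_mul]; ring

lemma orient_combo_pair (v w p q : Plane) (t : ℝ) :
    orient v w ((1 - t) • p + t • q) = (1 - t) * orient v w p + t * orient v w q := by
  simp only [orient, Pi.add_apply, Pi.smul_apply, smul_eq_mul]; ring

lemma ne_of_orient {p q r : Plane} (h : orient p q r ≠ 0) : p ≠ q ∧ p ≠ r ∧ q ≠ r := by
  refine ⟨?_, ?_, ?_⟩ <;> rintro rfl <;> simp at h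

lemma continuous_orient (p q : Plane) : Continuous (orient p q) := by
  unfold orient; fun_prop

/-- Cramer's rule: the barycentric coordinates of `x` in the triangle `pqr`. -/
lemma barycentric_eq {p q r : Plane} (h : orient p q r ≠ 0) (x : Plane) :
    (orient q r x / orient p q r) • p + (orient r p x / orient p q r) • q
      + (orient p q x / orient p q r) • r = x := by
  refine plane_ext ?_ ?_ <;>
  · simp only [Pi.add_apply, Pi.smul_apply, smul_eq_mul]
    field_simp
    simp only [orient]; ring

lemma openSimplex_triple_iff {p q r : Plane} (h : orient p q r ≠ 0) (x : Plane) :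
    x ∈ openSimplex {p, q, r} ↔
      ∃ α β γ : ℝ, 0 < α ∧ 0 < β ∧ 0 < γ ∧ α + β + γ = 1 ∧ α • p + β • q + γ • r = x := by
  classical
  obtain ⟨hpq, hpr, hqr⟩ := ne_of_orient h
  constructor
  · rintro ⟨w, h0, h1, h2⟩
    rw [Finset.sum_insert (by simp [hpq, hpr]), Finset.sum_pair hqr] at h1 h2
    exact ⟨w p, w q, w r, h0 _ (by simp), h0 _ (by simp), h0 _ (by simp), by linarith,
        by rw [← h2]; abel⟩
  · rintro ⟨α, β, γ, hα, hβ, hγ, h1, h2⟩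
    refine ⟨fun z => if z = p then α else if z = q then β else γ, ?_, ?_, ?_⟩
    · intro z _
      dsimp only
      split_ifs <;> assumption
    · rw [Finset.sum_insert (by simp [hpq, hpr]), Finset.sum_pair hqr]
      simp [hpq.symm, hpr.symm, hqr.symm]; linarith
    · rw [Finset.sum_insert (by simp [hpq, hpr]), Finset.sum_pair hqr]
      simp [hpq.symm, hpr.symm, hqr.symm]; rw [← h2]; abel

lemma convexHull_triple_iff {p q r : Plane} (h : orient p q r ≠ 0) (x : Plane) :
    x ∈ convexHull ℝ (({p, q, r} : Finset Plane) : Set Plane) ↔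
      ∃ α β γ : ℝ, 0 ≤ α ∧ 0 ≤ β ∧ 0 ≤ γ ∧ α + β + γ = 1 ∧ α • p + β • q + γ • r = x := by
  classical
  obtain ⟨hpq, hpr, hqr⟩ := ne_of_orient h
  rw [Finset.mem_convexHull']
  constructor
  · rintro ⟨w, h0, h1, h2⟩
    rw [Finset.sum_insert (by simp [hpq, hpr]), Finset.sum_pair hqr] at h1 h2
    exact ⟨w p, w q, w r, h0 _ (by simp), h0 _ (by simp), h0 _ (by simp), by linarith,
        by rw [← h2]; abel⟩
  · rintro ⟨α, β, γ, hα, hβ, hγ, h1, h2⟩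
    refine ⟨fun z => if z = p then α else if z = q then β else γ, ?_, ?_, ?_⟩
    · intro z _
      dsimp only
      split_ifs <;> assumption
    · rw [Finset.sum_insert (by simp [hpq, hpr]), Finset.sum_pair hqr]
      simp [hpq.symm, hpr.symm, hqr.symm]; linarith
    · rw [Finset.sum_insert (by simp [hpq, hpr]), Finset.sum_pair hqr]
      simp [hpq.symm, hpr.symm, hqr.symm]; rw [← h2]; abel

lemma mem_openSimplex_iff {p q r : Plane} (h : 0 < orient p q r) (x : Plane) :
    x ∈ openSimplex {p, q, r} ↔ 0 < orient q r x ∧ 0 < orient r p x ∧ 0 < orient p q x := by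
  rw [openSimplex_triple_iff h.ne']
  constructor
  · rintro ⟨α, β, γ, hα, hβ, hγ, h1, rfl⟩
    simp only [orient_combo _ _ _ _ _ h1, orient_self_left, orient_self_right]
    rw [orient_rotate p q r, ← orient_rotate r p q]
    refine ⟨?_, ?_, ?_⟩ <;> simp <;> positivity
  · rintro ⟨h1, h2, h3⟩
    refine ⟨_, _, _, div_pos h1 h, div_pos h2 h, div_pos h3 h, ?_, barycentric_eq h.ne' x⟩
    rw [← add_div, ← add_div, orient_sum, div_self h.ne']

lemma mem_convexHull_iff_orient {p q r : Plane} (h : 0 < orient p q r) (x : Plane) :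
    x ∈ convexHull ℝ (({p, q, r} : Finset Plane) : Set Plane) ↔
      0 ≤ orient q r x ∧ 0 ≤ orient r p x ∧ 0 ≤ orient p q x := by
  rw [convexHull_triple_iff h.ne']
  constructor
  · rintro ⟨α, β, γ, hα, hβ, hγ, h1, rfl⟩
    simp only [orient_combo _ _ _ _ _ h1, orient_self_left, orient_self_right]
    rw [orient_rotate p q r, ← orient_rotate r p q]
    refine ⟨?_, ?_, ?_⟩ <;> simp <;> positivity
  · rintro ⟨h1, h2, h3⟩
    refine ⟨_, _, _, div_nonneg h1 h.le, div_nonneg h2 h.le, div_nonneg h3 h.le, ?_,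
      barycentric_eq h.ne' x⟩
    rw [← add_div, ← add_div, orient_sum, div_self h.ne']

lemma isTriangle_triple_iff (p q r : Plane) : IsTriangle {p, q, r} ↔ orient p q r ≠ 0 := by
  classical
  rw [IsTriangle, affineIndependent_finset_iff]
  constructor
  · rintro ⟨hc, h⟩ h0
    have hne : p ≠ q ∧ p ≠ r ∧ q ≠ r := by
      have h2 := fun a b : Plane => Finset.card_le_two (a := a) (b := b)
      refine ⟨?_, ?_, ?_⟩ <;> rintro rfl
      · have := h2 p r
        simp at hc; omega
      · have := h2 q p
        simp at hc; omega
      · have := h2 p q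
        simp at hc; omega
    obtain ⟨hpq, hpr, hqr⟩ := hne
    -- the coefficients of an affine relation along each coordinate
    have key : ∀ i, p i = q i ∧ p i = r i := by
      intro i
      have := h (fun z => if z = p then r i - q i else if z = q then p i - r i else q i - p i) ?_ ?_
      · have h1 := this p (by simp)
        have h2 := this q (by simp)
        simp [hpq.symm] at h1 h2
        constructor <;> linarith
      · rw [Finset.sum_insert (by simp [hpq, hpr]), Finset.sum_pair hqr]
        simp [hpq.symm, hpr.symm, hqr.symm]
      · rw [Finset.sum_insert (by simp [hpq, hpr]), Finset.sum_pair hqr]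
        simp only [if_true, hpq.symm, hpr.symm, hqr.symm, if_false]
        simp only [orient] at h0
        refine plane_ext ?_ ?_ <;> fin_cases i <;>
          simp only [Pi.add_apply, Pi.smul_apply, smul_eq_mul, Pi.zero_apply, Fin.zero_eta,
              Fin.mk_one, Fin.isValue] <;>
          linarith
    exact hpq (plane_ext (key 0).1 (key 1).1)
  · intro h
    obtain ⟨hpq, hpr, hqr⟩ := ne_of_orient h
    refine ⟨Finset.card_eq_three.2 ⟨p, q, r, hpq, hpr, hqr, rfl⟩, ?_⟩
    intro w h0 h1
    rw [Finset.sum_insert (by simp [hpq, hpr]), Finset.sum_pair hqr] at h0 h1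
    have e0 := congrFun h1 0
    have e1 := congrFun h1 1
    simp only [Pi.add_apply, Pi.smul_apply, smul_eq_mul, Pi.zero_apply] at e0 e1
    have hp : w p = -w q - w r := by linarith
    rw [hp] at e0 e1
    have hq : w q * orient p q r = 0 := by
      simp only [orient]; linear_combination (r 1 - p 1) * e0 - (r 0 - p 0) * e1
    have hr : w r * orient p q r = 0 := by
      simp only [orient]; linear_combination (q 0 - p 0) * e1 - (q 1 - p 1) * e0
    have hq' := (mul_eq_zero.1 hq).resolve_right h
    have hr' := (mul_eq_zero.1 hr).resolve_right h
    intro z hz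
    simp only [Finset.mem_insert, Finset.mem_singleton] at hz
    rcases hz with rfl | rfl | rfl
    · rw [hp, hq', hr']; simp
    · exact hq'
    · exact hr'

lemma IsTriangle.exists_ccw {s : Finset Plane} (h : IsTriangle s) :
    ∃ p q r, s = {p, q, r} ∧ 0 < orient p q r := by
  classical
  obtain ⟨p, q, r, -, -, -, rfl⟩ := Finset.card_eq_three.1 h.1
  rcases lt_or_gt_of_ne ((isTriangle_triple_iff p q r).1 h) with h1 | h1
  · refine ⟨p, r, q, ?_, ?_⟩
    · ext; simp; tauto
    · rw [orient_swap]; linarith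
  · exact ⟨p, q, r, rfl, h1⟩

/-- A triangle with two of its vertices singled out. -/
lemma IsTriangle.exists_third {s : Finset Plane} (h : IsTriangle s) {p q : Plane}
    (hp : p ∈ s) (hq : q ∈ s) (hpq : p ≠ q) : ∃ r, s = {p, q, r} ∧ orient p q r ≠ 0 := by
  classical
  have hc : (s \ {p, q}).card = 1 := by
    rw [Finset.card_sdiff_of_subset (by simp [Finset.insert_subset_iff, hp, hq]), h.1,
      Finset.card_pair hpq]
  obtain ⟨r, hr⟩ := Finset.card_eq_one.1 hc
  have hs : s = {p, q, r} := by
    ext z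
    have := Finset.ext_iff.1 hr z
    simp only [Finset.mem_sdiff, Finset.mem_insert, Finset.mem_singleton] at this ⊢
    by_cases h1 : z = p
    · simp [h1, hp]
    · by_cases h2 : z = q
      · simp [h2, hq]
      · simp only [h1, h2, or_self, not_false_eq_true, and_true, false_or] at this ⊢
        exact this
  refine ⟨r, hs, ?_⟩
  rw [hs] at h
  exact (isTriangle_triple_iff _ _ _).1 h

lemma openSimplex_subset_convexHull (s : Finset Plane) :
    openSimplex s ⊆ convexHull ℝ (s : Set Plane) := by
  rintro x ⟨w, h0, h1, h2⟩
  exact Finset.mem_convexHull'.2 ⟨w, fun p hp => (h0 p hp).le, h1, h2⟩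

lemma IsTriangle.isOpen {s : Finset Plane} (h : IsTriangle s) : IsOpen (openSimplex s) := by
  obtain ⟨p, q, r, rfl, hD⟩ := h.exists_ccw
  have : openSimplex {p, q, r} =
      {x | 0 < orient q r x} ∩ ({x | 0 < orient r p x} ∩ {x | 0 < orient p q x}) := by
    ext x; exact mem_openSimplex_iff hD x
  rw [this]
  exact (isOpen_lt continuous_const (continuous_orient _ _)).inter
    ((isOpen_lt continuous_const (continuous_orient _ _)).inter
      (isOpen_lt continuous_const (continuous_orient _ _)))

lemma isClosed_hull (s : Finset Plane) : IsClosed (convexHull ℝ (s : Set Plane)) :=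
  s.finite_toSet.isClosed_convexHull ℝ

lemma isCompact_hull (s : Finset Plane) : IsCompact (convexHull ℝ (s : Set Plane)) :=
  s.finite_toSet.isCompact_convexHull ℝ

lemma openSimplex_nonempty {s : Finset Plane} (h : s.Nonempty) : (openSimplex s).Nonempty := by
  have hc : (0 : ℝ) < s.card := by exact_mod_cast h.card_pos
  refine ⟨_, fun _ => (s.card : ℝ)⁻¹, fun p _ => by positivity, ?_, rfl⟩
  simp [hc.ne']

lemma convex_openSimplex (s : Finset Plane) : Convex ℝ (openSimplex s) := by
  rintro x ⟨w, h0, h1, h2⟩ y ⟨w', h0', h1', h2'⟩ a b ha hb hab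
  refine ⟨fun p => a * w p + b * w' p, ?_, ?_, ?_⟩
  · intro p hp
    have := h0 p hp
    have := h0' p hp
    rcases ha.lt_or_eq with h | h
    · positivity
    · have : 0 < b := by linarith
      positivity
  · rw [Finset.sum_add_distrib, ← Finset.mul_sum, ← Finset.mul_sum, h1, h1']; linarith
  · simp only [add_smul, mul_smul]
    rw [Finset.sum_add_distrib, ← Finset.smul_sum, ← Finset.smul_sum, h2, h2']

/-- The half-open segment from a point of the closed simplex to a point of the open simplex
lies in the open simplex. -/
lemma combo_mem_openSimplex {s : Finset Plane} {x y : Plane}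
    (hx : x ∈ convexHull ℝ (s : Set Plane)) (hy : y ∈ openSimplex s) {t : ℝ} (h0 : 0 < t)
    (h1 : t ≤ 1) : (1 - t) • x + t • y ∈ openSimplex s := by
  obtain ⟨w, a0, a1, a2⟩ := Finset.mem_convexHull'.1 hx
  obtain ⟨w', b0, b1, b2⟩ := hy
  refine ⟨fun p => (1 - t) * w p + t * w' p, ?_, ?_, ?_⟩
  · intro p hp
    have := a0 p hp
    have := b0 p hp
    have : 0 ≤ 1 - t := by linarith
    positivity
  · rw [Finset.sum_add_distrib, ← Finset.mul_sum, ← Finset.mul_sum, a1, b1]; linarith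
  · simp only [add_smul, mul_smul]
    rw [Finset.sum_add_distrib, ← Finset.smul_sum, ← Finset.smul_sum, a2, b2]

lemma tendsto_combo (x y : Plane) :
    Filter.Tendsto (fun t : ℝ => (1 - t) • x + t • y) (𝓝[>] 0) (𝓝 x) := by
  have : Continuous (fun t : ℝ => (1 - t) • x + t • y) := by fun_prop
  have h := this.tendsto 0
  simp only [sub_zero, one_smul, zero_smul, add_zero] at h
  exact h.mono_left nhdsWithin_le_nhds

lemma hull_subset_closure (s : Finset Plane) :
    convexHull ℝ (s : Set Plane) ⊆ closure (openSimplex s) := by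
  intro x hx
  obtain ⟨y, hy⟩ : (openSimplex s).Nonempty := by
    apply openSimplex_nonempty
    by_contra h
    rw [Finset.not_nonempty_iff_eq_empty] at h
    simp [h] at hx
  refine mem_closure_of_tendsto (tendsto_combo x y) ?_
  filter_upwards [Ioo_mem_nhdsGT (show (0 : ℝ) < 1 by norm_num)] with t ht
  exact combo_mem_openSimplex hx hy ht.1 ht.2.le

lemma closure_openSimplex (s : Finset Plane) :
    closure (openSimplex s) = convexHull ℝ (s : Set Plane) :=
  (closure_minimal (openSimplex_subset_convexHull s) (isClosed_hull s)).antisymm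
    (hull_subset_closure s)

lemma disjoint_hull_of_disjoint {s t : Finset Plane} (ht : IsTriangle t)
    (h : Disjoint (openSimplex s) (openSimplex t)) :
    Disjoint (convexHull ℝ (s : Set Plane)) (openSimplex t) :=
  (h.closure_left ht.isOpen).mono_left (hull_subset_closure s)

lemma subset_hull {s : Finset Plane} {p : Plane} (hp : p ∈ s) :
    p ∈ convexHull ℝ (s : Set Plane) := subset_convexHull ℝ _ hp

lemma hull_segment {s : Finset Plane} {x y : Plane} (hx : x ∈ convexHull ℝ (s : Set Plane))
    (hy : y ∈ convexHull ℝ (s : Set Plane)) {t : ℝ} (h0 : 0 ≤ t) (h1 : t ≤ 1) :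
    (1 - t) • x + t • y ∈ convexHull ℝ (s : Set Plane) :=
  convex_convexHull ℝ _ hx hy (by linarith) h0 (by ring)

section

/-! ### Lattice points and minimal triangles -/

variable {d : ℕ}

lemma lattice_add {x y : Plane} (hx : x ∈ lattice d) (hy : y ∈ lattice d) : x + y ∈ lattice d := by
  intro i
  obtain ⟨k, hk⟩ := hx i
  obtain ⟨l, hl⟩ := hy i
  exact ⟨k + l, by simp only [Pi.add_apply]; push_cast; linarith⟩

lemma lattice_sub {x y : Plane} (hx : x ∈ lattice d) (hy : y ∈ lattice d) : x - y ∈ lattice d := by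
  intro i
  obtain ⟨k, hk⟩ := hx i
  obtain ⟨l, hl⟩ := hy i
  exact ⟨k - l, by simp only [Pi.sub_apply]; push_cast; linarith⟩

lemma orient_lattice {p q r : Plane} (hp : p ∈ lattice d) (hq : q ∈ lattice d)
    (hr : r ∈ lattice d) : ∃ k : ℤ, (d : ℝ) ^ 2 * orient p q r = k := by
  obtain ⟨p0, h1⟩ := hp 0
  obtain ⟨p1, h2⟩ := hp 1
  obtain ⟨q0, h3⟩ := hq 0
  obtain ⟨q1, h4⟩ := hq 1
  obtain ⟨r0, h5⟩ := hr 0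
  obtain ⟨r1, h6⟩ := hr 1
  refine ⟨(q0 - p0) * (r1 - p1) - (q1 - p1) * (r0 - p0), ?_⟩
  push_cast
  rw [← h1, ← h2, ← h3, ← h4, ← h5, ← h6, orient]; ring

/-- A lattice triangle of the least possible area is minimal: the barycentric coordinates of
lattice points are integers. -/
lemma minimal_of_orient {p q r : Plane} (hd : 0 < d) (hp : p ∈ lattice d) (hq : q ∈ lattice d)
    (hr : r ∈ lattice d) (h : (d : ℝ) ^ 2 * orient p q r = 1) :
    IsMinimalTriangle d {p, q, r} := by
  have hd' : (0 : ℝ) < (d : ℝ) ^ 2 := by positivity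
  have hpos : 0 < orient p q r := by
    by_contra h'
    nlinarith [mul_nonneg hd'.le (by linarith : (0:ℝ) ≤ -orient p q r)]
  refine ⟨(isTriangle_triple_iff _ _ _).2 hpos.ne', ?_⟩
  ext x
  constructor
  · rintro ⟨hx, hxl⟩
    rw [mem_convexHull_iff_orient hpos] at hx
    obtain ⟨h1, h2, h3⟩ := hx
    have hs := orient_sum p q r x
    have hb := barycentric_eq hpos.ne' x
    obtain ⟨k1, e1⟩ := orient_lattice hq hr hxl
    obtain ⟨k2, e2⟩ := orient_lattice hr hp hxl
    obtain ⟨k3, e3⟩ := orient_lattice hp hq hxl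
    have c1 : 0 ≤ k1 := by exact_mod_cast e1 ▸ mul_nonneg hd'.le h1
    have c2 : 0 ≤ k2 := by exact_mod_cast e2 ▸ mul_nonneg hd'.le h2
    have c3 : 0 ≤ k3 := by exact_mod_cast e3 ▸ mul_nonneg hd'.le h3
    have cs : k1 + k2 + k3 = 1 := by
      have : (k1 : ℝ) + k2 + k3 = 1 := by rw [← e1, ← e2, ← e3, ← h, ← hs]; ring
      exact_mod_cast this
    have zero : ∀ y : ℝ, (d : ℝ) ^ 2 * y = ((0 : ℤ) : ℝ) → y = 0 := by
      intro y hy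
      simpa [hd.ne'] using hy
    have one : ∀ y : ℝ, (d : ℝ) ^ 2 * y = ((1 : ℤ) : ℝ) → y / orient p q r = 1 := by
      intro y hy
      rw [Int.cast_one, ← h] at hy
      rw [mul_left_cancel₀ hd'.ne' hy, div_self hpos.ne']
    simp only [Finset.coe_insert, Finset.coe_singleton, mem_insert_iff, mem_singleton_iff]
    obtain ⟨a, b, c⟩ | ⟨a, b, c⟩ | ⟨a, b, c⟩ :
        (k1 = 1 ∧ k2 = 0 ∧ k3 = 0) ∨ (k1 = 0 ∧ k2 = 1 ∧ k3 = 0) ∨ (k1 = 0 ∧ k2 = 0 ∧ k3 = 1) := by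
      omega
    · subst a b c
      rw [one _ e1, zero _ e2, zero _ e3] at hb
      left; rw [← hb]; simp
    · subst a b c
      rw [zero _ e1, one _ e2, zero _ e3] at hb
      right; left; rw [← hb]; simp
    · subst a b c
      rw [zero _ e1, zero _ e2, one _ e3] at hb
      right; right; rw [← hb]; simp
  · intro hx
    refine ⟨subset_convexHull ℝ _ hx, ?_⟩
    simp only [Finset.coe_insert, Finset.coe_singleton, mem_insert_iff, mem_singleton_iff] at hx
    rcases hx with rfl | rfl | rfl <;> assumption

lemma IsMinimalTriangle.mem_lattice {s : Finset Plane} (h : IsMinimalTriangle d s) {p : Plane}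
    (hp : p ∈ s) : p ∈ lattice d := by
  have : p ∈ (s : Set Plane) := hp
  rw [← h.2] at this
  exact this.2

lemma IsMinimalTriangle.mem_of_lattice {s : Finset Plane} (h : IsMinimalTriangle d s) {p : Plane}
    (hp : p ∈ convexHull ℝ (s : Set Plane)) (hl : p ∈ lattice d) : p ∈ s := by
  have : p ∈ (s : Set Plane) := h.2 ▸ ⟨hp, hl⟩
  exact this

/-- A triangle without further lattice points has the least possible area: otherwise its edge
vectors do not span the lattice, and reducing a lattice vector modulo them gives a lattice point
of the parallelogram they span, which can be reflected into the triangle. -/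
lemma IsMinimalTriangle.orient_eq {p q r : Plane} (hd : 0 < d)
    (h : IsMinimalTriangle d {p, q, r}) (hpos : 0 < orient p q r) :
    (d : ℝ) ^ 2 * orient p q r = 1 := by
  have hd' : (0 : ℝ) < d := by exact_mod_cast hd
  have hp := h.mem_lattice (p := p) (by simp)
  have hq := h.mem_lattice (p := q) (by simp)
  have hr := h.mem_lattice (p := r) (by simp)
  obtain ⟨u0, hu0⟩ := lattice_sub hq hp 0
  obtain ⟨u1, hu1⟩ := lattice_sub hq hp 1
  obtain ⟨v0, hv0⟩ := lattice_sub hr hp 0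
  obtain ⟨v1, hv1⟩ := lattice_sub hr hp 1
  simp only [Pi.sub_apply] at hu0 hu1 hv0 hv1
  obtain ⟨D, hD⟩ : ∃ D : ℤ, D = u0 * v1 - u1 * v0 := ⟨_, rfl⟩
  have hDo : (d : ℝ) ^ 2 * orient p q r = D := by
    rw [hD]; push_cast; rw [← hu0, ← hu1, ← hv0, ← hv1, orient]; ring
  have hDpos : 0 < D := by
    have : (0 : ℝ) < D := by rw [← hDo]; positivity
    exact_mod_cast this
  have hDR : (0 : ℝ) < D := by exact_mod_cast hDpos
  -- the point with barycentric coordinates `i / D` and `j / D` at `q` and `r`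
  have vertex : ∀ i j : ℤ, 0 ≤ i → 0 ≤ j → i + j ≤ D →
      p + ((i : ℝ) / D) • (q - p) + ((j : ℝ) / D) • (r - p) ∈ lattice d →
      (i = 0 ∨ i = D) ∧ (j = 0 ∨ j = D) := by
    intro i j hi hj hij hl
    set z := p + ((i : ℝ) / D) • (q - p) + ((j : ℝ) / D) • (r - p) with hz
    have hiR : (0 : ℝ) ≤ i := by exact_mod_cast hi
    have hjR : (0 : ℝ) ≤ j := by exact_mod_cast hj
    have hijR : (i : ℝ) + j ≤ D := by exact_mod_cast hij
    have hzc : (1 - (i : ℝ) / D - (j : ℝ) / D) • p + ((i : ℝ) / D) • q + ((j : ℝ) / D) • r = z := by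
      rw [hz]; module
    have hs : (1 - (i : ℝ) / D - (j : ℝ) / D) + ((i : ℝ) / D) + ((j : ℝ) / D) = 1 := by ring
    have hzs := h.mem_of_lattice (p :=
        z) ((convexHull_triple_iff hpos.ne' z).2 ⟨1 - (i : ℝ) / D - (j : ℝ) / D,
      (i : ℝ) / D, (j : ℝ) / D, ?_, by positivity, by positivity, hs, hzc⟩) hl
    · have o1 : orient r p z = (i : ℝ) / D * orient p q r := by
        rw [← hzc, orient_combo _ _ _ _ _ hs]
        rw [← orient_rotate r p q]; simp
      have o2 : orient p q z = (j : ℝ) / D * orient p q r := by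
        rw [← hzc, orient_combo _ _ _ _ _ hs]
        simp
      have fin : ∀ (k : ℤ) (o : ℝ), o = (k : ℝ) / D * orient p q r →
          (o = 0 ∨ o = orient p q r) → k = 0 ∨ k = D := by
        intro k o ho hor
        rcases hor with rfl | rfl
        · left
          have := ho.symm
          simp [hpos.ne', hDpos.ne'] at this
          exact this
        · right
          have : (k : ℝ) / D = 1 := by
            have h3 : ((k : ℝ) / D - 1) * orient p q r = 0 := by linarith
            have := (mul_eq_zero.1 h3).resolve_right hpos.ne'
            linarith
          rw [div_eq_one_iff_eq hDR.ne'] at this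
          exact_mod_cast this
      simp only [Finset.mem_insert, Finset.mem_singleton] at hzs
      refine ⟨fin i _ o1 ?_, fin j _ o2 ?_⟩
      · rcases hzs with h1 | h1 | h1 <;> rw [h1]
        · left; simp
        · right; rw [orient_rotate r p q]
        · left; simp
      · rcases hzs with h1 | h1 | h1 <;> rw [h1]
        · left; simp
        · left; simp
        · right; rfl
    · rw [sub_sub, ← add_div, sub_nonneg, div_le_one hDR]; exact hijR
  -- every integer vector `(m, n)` is an integral combination of the edge vectors
  have dvd : ∀ m n : ℤ, D ∣ m * v1 - n * v0 ∧ D ∣ u0 * n - u1 * m := by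
    intro m n
    set A := m * v1 - n * v0 with hA
    set B := u0 * n - u1 * m with hB
    have hiA := Int.emod_add_mul_ediv A D
    have hjB := Int.emod_add_mul_ediv B D
    have ha0 := Int.emod_nonneg A hDpos.ne'
    have hb0 := Int.emod_nonneg B hDpos.ne'
    have ha1 := Int.emod_lt_of_pos A hDpos
    have hb1 := Int.emod_lt_of_pos B hDpos
    set i := A % D
    set j := B % D
    set k := A / D
    set l := B / D
    have cr0 : A * u0 + B * v0 = D * m := by rw [hA, hB, hD]; ring
    have cr1 : A * u1 + B * v1 = D * n := by rw [hA, hB, hD]; ring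
    have e0 : i * u0 + j * v0 = D * (m - k * u0 - l * v0) := by
      linear_combination cr0 + u0 * hiA + v0 * hjB
    have e1 : i * u1 + j * v1 = D * (n - k * u1 - l * v1) := by
      linear_combination cr1 + u1 * hiA + v1 * hjB
    have e0R : (i : ℝ) / D * u0 + j / D * v0 = (m - k * u0 - l * v0 : ℤ) := by
      have : (i : ℝ) * u0 + j * v0 = D * (m - k * u0 - l * v0 : ℤ) := by exact_mod_cast e0
      field_simp; linarith
    have e1R : (i : ℝ) / D * u1 + j / D * v1 = (n - k * u1 - l * v1 : ℤ) := by
      have : (i : ℝ) * u1 + j * v1 = D * (n - k * u1 - l * v1 : ℤ) := by exact_mod_cast e1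
      field_simp; linarith
    have f0 : (i : ℝ) / D * (d * (q 0 - p 0)) + j / D * (d * (r 0 - p 0)) =
        (m - k * u0 - l * v0 : ℤ) := by
      rw [hu0, hv0]; exact e0R
    have f1 : (i : ℝ) / D * (d * (q 1 - p 1)) + j / D * (d * (r 1 - p 1)) =
        (n - k * u1 - l * v1 : ℤ) := by
      rw [hu1, hv1]; exact e1R
    obtain ⟨P0, hP0⟩ := hp 0
    obtain ⟨P1, hP1⟩ := hp 1
    rcases le_or_gt (i + j) D with hij | hij
    · obtain ⟨h1, h2⟩ := vertex i j ha0 hb0 hij (by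
        intro c
        fin_cases c
        · refine ⟨P0 + (m - k * u0 - l * v0), ?_⟩
          rw [Int.cast_add, ← f0, ← hP0]
          simp only [Pi.add_apply, Pi.smul_apply, Pi.sub_apply, smul_eq_mul, Fin.zero_eta]; ring
        · refine ⟨P1 + (n - k * u1 - l * v1), ?_⟩
          rw [Int.cast_add, ← f1, ← hP1]
          simp only [Pi.add_apply, Pi.smul_apply, Pi.sub_apply, smul_eq_mul, Fin.mk_one]; ring)
      refine ⟨Int.dvd_of_emod_eq_zero ?_, Int.dvd_of_emod_eq_zero ?_⟩
      · exact h1.resolve_right ha1.ne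
      · exact h2.resolve_right hb1.ne
    · obtain ⟨h1, h2⟩ := vertex (D - i) (D - j) (by omega) (by omega) (by omega) (by
        have hDi : ((D - i : ℤ) : ℝ) / D = 1 - i / D := by push_cast; field_simp
        have hDj : ((D - j : ℤ) : ℝ) / D = 1 - j / D := by push_cast; field_simp
        rw [hDi, hDj]
        intro c
        fin_cases c
        · refine ⟨P0 + u0 + v0 - (m - k * u0 - l * v0), ?_⟩
          rw [Int.cast_sub, ← f0]
          simp only [Pi.add_apply, Pi.smul_apply, Pi.sub_apply, smul_eq_mul, Fin.zero_eta]
          push_cast; rw [← hP0, ← hu0, ← hv0]; ring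
        · refine ⟨P1 + u1 + v1 - (n - k * u1 - l * v1), ?_⟩
          rw [Int.cast_sub, ← f1]
          simp only [Pi.add_apply, Pi.smul_apply, Pi.sub_apply, smul_eq_mul, Fin.mk_one]
          push_cast; rw [← hP1, ← hu1, ← hv1]; ring)
      omega
  obtain ⟨a, ha⟩ := (dvd 1 0).1
  obtain ⟨b, hb⟩ := (dvd 1 0).2
  obtain ⟨c, hc⟩ := (dvd 0 1).1
  obtain ⟨e, he⟩ := (dvd 0 1).2
  have h1 : D * 1 = D * (D * (a * e - b * c)) := by
    linear_combination hD + u0 * ha + (D * a) * he + v0 * hb - (D * b) * hc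
  have h2 := mul_left_cancel₀ hDpos.ne' h1
  have h3 : D = 1 := Int.eq_one_of_dvd_one hDpos.le ⟨_, h2⟩
  rw [hDo, h3]; simp

lemma IsMinimalTriangle.exists_ccw {s : Finset Plane} (hd : 0 < d) (h : IsMinimalTriangle d s) :
    ∃ p q r, s = {p, q, r} ∧ p ∈ lattice d ∧ q ∈ lattice d ∧ r ∈ lattice d ∧
      (d : ℝ) ^ 2 * orient p q r = 1 := by
  obtain ⟨p, q, r, rfl, hpos⟩ := h.1.exists_ccw
  exact ⟨p, q, r, rfl, h.mem_lattice (by simp), h.mem_lattice (by simp), h.mem_lattice (by simp),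
    h.orient_eq hd hpos⟩

lemma pos_of_orient {p q r : Plane} (h : (d : ℝ) ^ 2 * orient p q r = 1) : 0 < orient p q r := by
  by_contra h'
  nlinarith [mul_nonneg (sq_nonneg (d : ℝ)) (by linarith : (0:ℝ) ≤ -orient p q r)]

end

section

/-! ### Primitive segments and minimal triangles -/

variable {d : ℕ}

/-- The segment from `v` to `w` joins two different lattice points and contains no lattice point
in between. -/
def IsPrimitive (d : ℕ) (v w : Plane) : Prop :=
  v ∈ lattice d ∧ w ∈ lattice d ∧ v ≠ w ∧ Disjoint (openSegment ℝ v w) (lattice d)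

lemma IsPrimitive.symm {v w : Plane} (h : IsPrimitive d v w) : IsPrimitive d w v :=
  ⟨h.2.1, h.1, h.2.2.1.symm, openSegment_symm ℝ v w ▸ h.2.2.2⟩

lemma mem_openSegment_iff {v w x : Plane} :
    x ∈ openSegment ℝ v w ↔ ∃ t : ℝ, 0 < t ∧ t < 1 ∧ (1 - t) • v + t • w = x := by
  rw [openSegment_eq_image]
  constructor
  · rintro ⟨t, ⟨h0, h1⟩, h⟩
    exact ⟨t, h0, h1, h⟩
  · rintro ⟨t, h0, h1, h⟩
    exact ⟨t, ⟨h0, h1⟩, h⟩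

lemma IsPrimitive.not_mem {v w x : Plane} (h : IsPrimitive d v w) (hx : x ∈ openSegment ℝ v w) :
    x ∉ lattice d := fun hl => Set.disjoint_left.1 h.2.2.2 hx hl

lemma orient_of_mem_openSegment {v w x : Plane} (hx : x ∈ openSegment ℝ v w) :
    orient v w x = 0 := by
  obtain ⟨t, -, -, rfl⟩ := mem_openSegment_iff.1 hx
  rw [orient_combo_pair]; simp

lemma openSegment_subset_hull {s : Finset Plane} {p q : Plane} (hp : p ∈ s) (hq : q ∈ s) :
    openSegment ℝ p q ⊆ convexHull ℝ (s : Set Plane) :=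
  (openSegment_subset_segment ℝ p q).trans
    ((convex_convexHull ℝ _).segment_subset (subset_hull hp) (subset_hull hq))

/-- The points of the line through two different points. -/
lemma exists_eq_of_orient_eq_zero {v w x : Plane} (hvw : v ≠ w) (h : orient v w x = 0) :
    ∃ a : ℝ, x = (1 - a) • v + a • w := by
  have hne : w 0 - v 0 ≠ 0 ∨ w 1 - v 1 ≠ 0 := by
    by_contra! hc
    exact hvw (plane_ext (by linarith) (by linarith))
  simp only [orient] at h
  rcases hne with hne | hne
  · refine ⟨(x 0 - v 0) / (w 0 - v 0), plane_ext ?_ ?_⟩ <;>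
    · simp only [Pi.add_apply, Pi.smul_apply, smul_eq_mul]
      field_simp
      linarith
  · refine ⟨(x 1 - v 1) / (w 1 - v 1), plane_ext ?_ ?_⟩ <;>
    · simp only [Pi.add_apply, Pi.smul_apply, smul_eq_mul]
      field_simp
      linarith

lemma IsMinimalTriangle.isPrimitive {s : Finset Plane} (h : IsMinimalTriangle d s) {p q : Plane}
    (hp : p ∈ s) (hq : q ∈ s) (hpq : p ≠ q) : IsPrimitive d p q := by
  refine ⟨h.mem_lattice hp, h.mem_lattice hq, hpq, Set.disjoint_left.2 fun x hx hl => ?_⟩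
  have hxs := h.mem_of_lattice (openSegment_subset_hull hp hq hx) hl
  obtain ⟨r, rfl, hr⟩ := h.1.exists_third hp hq hpq
  have h0 := orient_of_mem_openSegment hx
  obtain ⟨t, ht0, ht1, hxt⟩ := mem_openSegment_iff.1 hx
  have o1 : orient q r x = (1 - t) * orient p q r := by
    rw [← hxt, orient_combo_pair, orient_rotate p q r]; simp
  have o2 : orient r p x = t * orient p q r := by
    rw [← hxt, orient_combo_pair, ← orient_rotate r p q]; simp
  have n1 : orient q r x ≠ 0 := by rw [o1]; exact mul_ne_zero (by linarith) hr
  have n2 : orient r p x ≠ 0 := by rw [o2]; exact mul_ne_zero ht0.ne' hr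
  simp only [Finset.mem_insert, Finset.mem_singleton] at hxs
  rcases hxs with rfl | rfl | rfl <;> simp at *

lemma combo_lattice_eq {x v w : Plane} {a : ℝ} (hx : x = (1 - a) • v + a • w)
    (h0 : 0 < a) (h1 : a < 1) : x ∈ openSegment ℝ v w :=
  mem_openSegment_iff.2 ⟨a, h0, h1, hx.symm⟩

/-- Overlapping collinear primitive segments coincide. -/
lemma IsPrimitive.eq_of_collinear {p q v w x : Plane} (hpq : IsPrimitive d p q)
    (hvw : IsPrimitive d v w) (hx : x ∈ openSegment ℝ p q) (hx' : x ∈ openSegment ℝ v w)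
    (hp : orient v w p = 0) : (p = v ∧ q = w) ∨ (p = w ∧ q = v) := by
  have hq : orient v w q = 0 := by
    have h0 := orient_of_mem_openSegment hx'
    obtain ⟨t, ht0, ht1, rfl⟩ := mem_openSegment_iff.1 hx
    rw [orient_combo_pair, hp] at h0
    simpa [ht0.ne'] using h0
  obtain ⟨a, ha⟩ := exists_eq_of_orient_eq_zero hvw.2.2.1 hp
  obtain ⟨b, hb⟩ := exists_eq_of_orient_eq_zero hvw.2.2.1 hq
  -- in the affine coordinate with `v` at `0` and `w` at `1`
  have key : ∀ {p q : Plane} {a b : ℝ}, IsPrimitive d p q → x ∈ openSegment ℝ p q →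
      p = (1 - a) • v + a • w → q = (1 - b) • v + b • w → a < b → p = v ∧ q = w := by
    intro p q a b hpq hx ha hb hab
    have na : ¬ (0 < a ∧ a < 1) := fun h => hvw.not_mem (combo_lattice_eq ha h.1 h.2) hpq.1
    have nb : ¬ (0 < b ∧ b < 1) := fun h => hvw.not_mem (combo_lattice_eq hb h.1 h.2) hpq.2.1
    have nv : ¬ (a < 0 ∧ 0 < b) := by
      rintro ⟨h1, h2⟩
      have hba : b - a ≠ 0 := by linarith
      refine hpq.not_mem (combo_lattice_eq (x := v) (a := -a / (b - a)) ?_ ?_ ?_) hvw.1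
      · rw [ha, hb]
        refine plane_ext ?_ ?_ <;> simp only [Pi.add_apply, Pi.smul_apply, smul_eq_mul] <;>
          field_simp <;> ring
      · exact div_pos (by linarith) (by linarith)
      · rw [div_lt_one (by linarith)]; linarith
    have nw : ¬ (a < 1 ∧ 1 < b) := by
      rintro ⟨h1, h2⟩
      have hba : b - a ≠ 0 := by linarith
      refine hpq.not_mem (combo_lattice_eq (x := w) (a := (1 - a) / (b - a)) ?_ ?_ ?_) hvw.2.1
      · rw [ha, hb]
        refine plane_ext ?_ ?_ <;> simp only [Pi.add_apply, Pi.smul_apply, smul_eq_mul] <;>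
          field_simp <;> ring
      · exact div_pos (by linarith) (by linarith)
      · rw [div_lt_one (by linarith)]; linarith
    obtain ⟨t, ht0, ht1, hxt⟩ := mem_openSegment_iff.1 hx
    obtain ⟨s, hs0, hs1, hxs⟩ := mem_openSegment_iff.1 hx'
    have hst : s = (1 - t) * a + t * b := by
      have h2 : (s - ((1 - t) * a + t * b)) • (w - v) = 0 := by
        have : (1 - s) • v + s • w = (1 - t) • ((1 - a) • v + a • w) + t • ((1 - b) • v + b • w) :=
            by
          rw [hxs, ← hxt, ha, hb]
        refine plane_ext ?_ ?_
        · have := congrFun this 0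
          simp only [Pi.add_apply, Pi.smul_apply, smul_eq_mul, Pi.sub_apply,
              Pi.zero_apply] at this ⊢
          linarith
        · have := congrFun this 1
          simp only [Pi.add_apply, Pi.smul_apply, smul_eq_mul, Pi.sub_apply,
              Pi.zero_apply] at this ⊢
          linarith
      rcases smul_eq_zero.1 h2 with h | h
      · linarith
      · exact absurd (sub_eq_zero.1 h).symm hvw.2.2.1
    have as : a < s := by rw [hst]; nlinarith
    have sb : s < b := by rw [hst]; nlinarith
    have a0 : a = 0 := by
      by_contra hne
      rcases lt_or_gt_of_ne hne with h | h
      · exact nv ⟨h, by linarith⟩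
      · exact na ⟨h, by linarith⟩
    have b1 : b = 1 := by
      by_contra hne
      rcases lt_or_gt_of_ne hne with h | h
      · exact nb ⟨by linarith, h⟩
      · exact nw ⟨by linarith, h⟩
    rw [ha, hb, a0, b1]
    simp
  rcases lt_trichotomy a b with h | h | h
  · exact Or.inl (key hpq hx ha hb h)
  · exact absurd (by rw [ha, hb, h]) hpq.2.2.1
  · have := key hpq.symm (openSegment_symm ℝ p q ▸ hx) hb ha h
    exact Or.inr ⟨this.2, this.1⟩

/-- A point of a closed triangle is a vertex, in an open edge, or in the open triangle. -/
lemma hull_cases {s : Finset Plane} (h : IsTriangle s) {x : Plane}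
    (hx : x ∈ convexHull ℝ (s : Set Plane)) :
    x ∈ s ∨ (∃ p ∈ s, ∃ q ∈ s, p ≠ q ∧ x ∈ openSegment ℝ p q) ∨ x ∈ openSimplex s := by
  obtain ⟨w, h0, h1, h2⟩ := Finset.mem_convexHull'.1 hx
  by_cases hall : ∀ p ∈ s, w p ≠ 0
  · exact Or.inr (Or.inr ⟨w, fun p hp => lt_of_le_of_ne (h0 p hp) (hall p hp).symm, h1, h2⟩)
  · push Not at hall
    obtain ⟨r, hr, hwr⟩ := hall
    obtain ⟨p, hp⟩ : ∃ p, p ∈ s.erase r := by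
      rw [← Finset.Nonempty, ← Finset.card_pos, Finset.card_erase_of_mem hr, h.1]; norm_num
    have hp' := Finset.mem_erase.1 hp
    obtain ⟨q, rfl, ho⟩ := h.exists_third hr hp'.2 hp'.1.symm
    obtain ⟨n1, n2, n3⟩ := ne_of_orient ho
    rw [Finset.sum_insert (by simp [n1, n2]), Finset.sum_pair n3, hwr] at h1 h2
    rw [zero_smul, zero_add] at h2
    have hp0 := h0 p (by simp)
    have hq0 := h0 q (by simp)
    rcases hp0.eq_or_lt with hp0 | hp0
    · left
      have : w q = 1 := by linarith
      rw [← h2, ← hp0, this]; simp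
    · rcases hq0.eq_or_lt with hq0 | hq0
      · left
        have : w p = 1 := by linarith
        rw [← h2, ← hq0, this]; simp
      · right; left
        refine ⟨p, by simp, q, by simp, n3, mem_openSegment_iff.2 ⟨w q, hq0, by linarith, ?_⟩⟩
        rw [← h2]; congr 2; linarith

/-- A minimal triangle that meets an open primitive segment and lies on one side of its line has
the segment as an edge. -/
lemma mem_of_one_side {s : Finset Plane} (h : IsMinimalTriangle d s) {v w x : Plane}
    (hvw : IsPrimitive d v w) (hx : x ∈ convexHull ℝ (s : Set Plane))
    (hx' : x ∈ openSegment ℝ v w) (hs : ∀ p ∈ s, 0 ≤ orient v w p) : v ∈ s ∧ w ∈ s := by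
  have h0 := orient_of_mem_openSegment hx'
  rcases hull_cases h.1 hx with h1 | ⟨p, hp, q, hq, hpq, h1⟩ | h1
  · exact absurd (h.mem_lattice h1) (hvw.not_mem hx')
  · have hp0 : orient v w p = 0 := by
      obtain ⟨t, ht0, ht1, rfl⟩ := mem_openSegment_iff.1 h1
      rw [orient_combo_pair] at h0
      have a := hs p hp
      have b := mul_nonneg ht0.le (hs q hq)
      have c : (1 - t) * orient v w p = 0 := by
        have := mul_nonneg (by linarith : (0 : ℝ) ≤ 1 - t) a
        linarith
      exact (mul_eq_zero.1 c).resolve_left (by linarith)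
    rcases (h.isPrimitive hp hq hpq).eq_of_collinear hvw h1 hx' hp0 with ⟨rfl, rfl⟩ | ⟨rfl, rfl⟩
    · exact ⟨hp, hq⟩
    · exact ⟨hq, hp⟩
  · exfalso
    obtain ⟨p, q, r, rfl, ho⟩ := h.1.exists_ccw
    obtain ⟨α, β, γ, hα, hβ, hγ, hsum, rfl⟩ := (openSimplex_triple_iff ho.ne' x).1 h1
    rw [orient_combo _ _ _ _ _ hsum] at h0
    have a := mul_nonneg hα.le (hs p (by simp))
    have b := mul_nonneg hβ.le (hs q (by simp))
    have c := mul_nonneg hγ.le (hs r (by simp))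
    have a' := (mul_eq_zero.1 (by linarith : α * orient v w p = 0)).resolve_left hα.ne'
    have b' := (mul_eq_zero.1 (by linarith : β * orient v w q = 0)).resolve_left hβ.ne'
    have c' := (mul_eq_zero.1 (by linarith : γ * orient v w r = 0)).resolve_left hγ.ne'
    obtain ⟨a, rfl⟩ := exists_eq_of_orient_eq_zero hvw.2.2.1 a'
    obtain ⟨b, rfl⟩ := exists_eq_of_orient_eq_zero hvw.2.2.1 b'
    obtain ⟨c, rfl⟩ := exists_eq_of_orient_eq_zero hvw.2.2.1 c'
    apply ho.ne'
    simp only [orient, Pi.add_apply, Pi.smul_apply, smul_eq_mul]; ring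

/-- A minimal triangle that meets an open primitive segment `vw` and has the vertices `p`, `q` on
different sides of its line meets the line beyond neither end of the segment: the end would
be a lattice point of the triangle. -/
lemma crossing_param_lt {s : Finset Plane} (h : IsMinimalTriangle d s) {v w x p q : Plane}
    (hvw : IsPrimitive d v w) (hx : x ∈ convexHull ℝ (s : Set Plane))
    (hx' : x ∈ openSegment ℝ v w) (hp : p ∈ s) (hq : q ∈ s) (hpq : p ≠ q)
    (hp0 : orient v w p ≠ 0) (hq0 : orient v w q ≠ 0)
    {a : ℝ} (ha : (1 - a) • v + a • w ∈ openSegment ℝ p q) : a < 1 := by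
  by_contra! hc
  obtain ⟨b, hb0, hb1, rfl⟩ := mem_openSegment_iff.1 hx'
  set z := (1 - a) • v + a • w with hz
  have hzl : z ∉ lattice d := (h.isPrimitive hp hq hpq).not_mem ha
  have hzh := openSegment_subset_hull hp hq ha
  have ha1 : 1 < a := by
    rcases hc.eq_or_lt with h1 | h1
    · exfalso; apply hzl; rw [hz, ← h1]; simpa using hvw.2.1
    · exact h1
  have hab : a - b ≠ 0 := by linarith
  obtain ⟨c, hc0, hc1, hcw⟩ : ∃ c : ℝ, 0 < c ∧ c < 1 ∧ (1 - c) • ((1 - b) • v + b • w) + c • z =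
      w := by
    refine ⟨(1 - b) / (a - b), div_pos (by linarith) (by linarith), ?_, ?_⟩
    · rw [div_lt_one (by linarith)]; linarith
    · rw [hz]
      refine plane_ext ?_ ?_ <;> simp only [Pi.add_apply, Pi.smul_apply, smul_eq_mul] <;>
        field_simp <;> ring
  have hws : w ∈ s := by
    refine h.mem_of_lattice ?_ hvw.2.1
    rw [← hcw]
    exact hull_segment hx hzh hc0.le hc1.le
  obtain ⟨r, rfl, hr⟩ := h.1.exists_third hp hq hpq
  have hwr : w = r := by
    simp only [Finset.mem_insert, Finset.mem_singleton] at hws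
    rcases hws with rfl | rfl | rfl
    · simp at hp0
    · simp at hq0
    · rfl
  subst hwr
  obtain ⟨α, β, γ, hα, hβ, hγ, hsum, hxe⟩ := (convexHull_triple_iff hr _).1 hx
  have o1 : orient p q w = (1 - c) * (γ * orient p q w) + c * orient p q z := by
    conv_lhs => rw [← hcw, orient_combo_pair, ← hxe, orient_combo _ _ _ _ _ hsum]
    simp
  rw [orient_of_mem_openSegment ha] at o1
  have o2 : (1 - (1 - c) * γ) * orient p q w = 0 := by linarith
  have o3 := (mul_eq_zero.1 o2).resolve_right hr
  nlinarith

/-- If a minimal triangle meets an open primitive segment `vw` and the vertices `p`, `q` lie on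
different sides of its line, then the edge `pq` crosses the open segment. -/
lemma exists_crossing {s : Finset Plane} (h : IsMinimalTriangle d s) {v w x p q : Plane}
    (hvw : IsPrimitive d v w) (hx : x ∈ convexHull ℝ (s : Set Plane))
    (hx' : x ∈ openSegment ℝ v w) (hp : p ∈ s) (hq : q ∈ s)
    (hp0 : 0 < orient v w p) (hq0 : orient v w q < 0) :
    ∃ z, z ∈ openSegment ℝ p q ∧ z ∈ openSegment ℝ v w := by
  have hpq : p ≠ q := by rintro rfl; linarith
  set Y := orient v w p - orient v w q with hY
  have hYpos : 0 < Y := by linarith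
  set t := orient v w p / Y with ht
  have ht0 : 0 < t := div_pos hp0 hYpos
  have ht1 : t < 1 := by rw [ht, div_lt_one hYpos]; linarith
  have hz0 : orient v w ((1 - t) • p + t • q) = 0 := by
    rw [orient_combo_pair, ht]; field_simp; rw [hY]; ring
  have hz : (1 - t) • p + t • q ∈ openSegment ℝ p q := mem_openSegment_iff.2 ⟨t, ht0, ht1, rfl⟩
  obtain ⟨a, ha⟩ := exists_eq_of_orient_eq_zero hvw.2.2.1 hz0
  rw [ha] at hz
  have h1 := crossing_param_lt h hvw hx hx' hp hq hpq hp0.ne' hq0.ne hz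
  have hz' : (1 - (1 - a)) • w + (1 - a) • v ∈ openSegment ℝ p q := by
    convert hz using 1; module
  have h2 := crossing_param_lt h hvw.symm hx (openSegment_symm ℝ v w ▸ hx') hp hq hpq
    (by rw [orient] at hp0 ⊢; intro h'; linarith) (by rw [orient] at hq0 ⊢; intro h'; linarith) hz'
  exact ⟨_, hz, mem_openSegment_iff.2 ⟨a, by linarith, h1, rfl⟩⟩

/-- Near a point of the open edge `pq`, the open triangle `pqr` is an open half plane. -/
lemma eventually_mem_openSimplex {p q r x : Plane} (h : 0 < orient p q r)
    (hx : x ∈ openSegment ℝ p q) :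
    ∀ᶠ z in 𝓝 x, 0 < orient p q z → z ∈ openSimplex {p, q, r} := by
  obtain ⟨t, ht0, ht1, hxt⟩ := mem_openSegment_iff.1 hx
  have o1 : 0 < orient q r x := by
    rw [← hxt, orient_combo_pair, orient_rotate p q r]; simp
    exact mul_pos (by linarith) h
  have o2 : 0 < orient r p x := by
    rw [← hxt, orient_combo_pair, ← orient_rotate r p q]; simp
    exact mul_pos ht0 h
  filter_upwards [(continuous_orient q r).continuousAt.eventually_const_lt o1,
    (continuous_orient r p).continuousAt.eventually_const_lt o2] with z h1 h2 h3
  exact (mem_openSimplex_iff h z).2 ⟨h1, h2, h3⟩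

lemma eventually_mem_hull {p q r x : Plane} (h : 0 < orient p q r)
    (hx : x ∈ openSegment ℝ p q) :
    ∀ᶠ z in 𝓝 x, 0 ≤ orient p q z →
      z ∈ convexHull ℝ (({p, q, r} : Finset Plane) : Set Plane) := by
  obtain ⟨t, ht0, ht1, hxt⟩ := mem_openSegment_iff.1 hx
  have o1 : 0 < orient q r x := by
    rw [← hxt, orient_combo_pair, orient_rotate p q r]; simp
    exact mul_pos (by linarith) h
  have o2 : 0 < orient r p x := by
    rw [← hxt, orient_combo_pair, ← orient_rotate r p q]; simp
    exact mul_pos ht0 h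
  filter_upwards [(continuous_orient q r).continuousAt.eventually_const_lt o1,
    (continuous_orient r p).continuousAt.eventually_const_lt o2] with z h1 h2 h3
  exact (mem_convexHull_iff_orient h z).2 ⟨h1.le, h2.le, h3⟩

/-- Two triangles on different sides of a common edge: the open edge is interior to their union. -/
lemma openSegment_subset_interior {p q r s : Plane} (h : 0 < orient p q r)
    (h' : orient p q s < 0) : openSegment ℝ p q ⊆
      interior (convexHull ℝ (({p, q, r} : Finset Plane) : Set Plane) ∪
        convexHull ℝ (({p, q, s} : Finset Plane) : Set Plane)) := by
  intro x hx
  rw [mem_interior_iff_mem_nhds]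
  have h2 : 0 < orient q p s := by rw [orient_swap']; linarith
  filter_upwards [eventually_mem_hull h hx,
    eventually_mem_hull h2 (openSegment_symm ℝ p q ▸ hx)] with z h3 h4
  rcases le_total 0 (orient p q z) with h5 | h5
  · exact Or.inl (h3 h5)
  · right
    rw [show ({p, q, s} : Finset Plane) = {q, p, s} by ext; simp; tauto]
    apply h4
    rw [orient_swap']; linarith

end

section

/-! ### Tilings by minimal triangles and flips -/

variable {d : ℕ} {P : Set Plane} {T T' T₀ : Finset (Finset Plane)}

/-- `T` is a finite set of `d`-minimal triangles with pairwise disjoint interiors and union `P`. -/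
structure IsTiling (d : ℕ) (P : Set Plane) (T : Finset (Finset Plane)) : Prop where
  minimal : ∀ t ∈ T, IsMinimalTriangle d t
  disjoint : ∀ s ∈ T, ∀ t ∈ T, s ≠ t → Disjoint (openSimplex s) (openSimplex t)
  cover : ⋃ t ∈ T, convexHull ℝ (t : Set Plane) = P

lemma IsTiling.disjoint_hull (hT : IsTiling d P T) {s t : Finset Plane} (hs : s ∈ T) (ht : t ∈ T)
    (hne : s ≠ t) : Disjoint (convexHull ℝ (s : Set Plane)) (openSimplex t) :=
  disjoint_hull_of_disjoint (hT.minimal t ht).1 (hT.disjoint s hs t ht hne)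

lemma IsTiling.hull_subset (hT : IsTiling d P T) {t : Finset Plane} (ht : t ∈ T) :
    convexHull ℝ (t : Set Plane) ⊆ P := by
  rw [← hT.cover]
  exact subset_biUnion_of_mem (u := fun t : Finset Plane => convexHull ℝ (t : Set Plane)) ht

lemma IsTiling.exists_mem (hT : IsTiling d P T) {x : Plane} (hx : x ∈ P) :
    ∃ t ∈ T, x ∈ convexHull ℝ (t : Set Plane) := by
  rw [← hT.cover] at hx
  simpa using hx

lemma not_mem_openSimplex_of_mem {s : Finset Plane} (h : IsTriangle s) {p : Plane} (hp : p ∈ s) :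
    p ∉ openSimplex s := by
  obtain ⟨a, b, c, rfl, ho⟩ := h.exists_ccw
  rw [mem_openSimplex_iff ho]
  simp only [Finset.mem_insert, Finset.mem_singleton] at hp
  rcases hp with rfl | rfl | rfl <;> simp

lemma not_mem_openSimplex_of_edge {s : Finset Plane} (h : IsTriangle s) {p q x : Plane}
    (hp : p ∈ s) (hq : q ∈ s) (hpq : p ≠ q) (hx : x ∈ openSegment ℝ p q) : x ∉ openSimplex s := by
  obtain ⟨r, rfl, ho⟩ := h.exists_third hp hq hpq
  intro hx'
  obtain ⟨α, β, γ, hα, hβ, hγ, hsum, rfl⟩ := (openSimplex_triple_iff ho x).1 hx'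
  have := orient_of_mem_openSegment hx
  rw [orient_combo _ _ _ _ _ hsum] at this
  simp [hγ.ne', ho] at this

/-- `v` and `w` are vertices of a common triangle of `T`. -/
def HasEdge (T : Finset (Finset Plane)) (v w : Plane) : Prop := ∃ t ∈ T, v ∈ t ∧ w ∈ t

lemma HasEdge.symm {v w : Plane} (h : HasEdge T v w) : HasEdge T w v := by
  obtain ⟨t, ht, hv, hw⟩ := h
  exact ⟨t, ht, hw, hv⟩

/-- An edge of one triangle of a tiling bounds every other triangle that meets its interior. -/
lemma IsTiling.one_side (hT : IsTiling d P T) {p q r x : Plane} {t : Finset Plane}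
    (hs : {p, q, r} ∈ T) (ht : t ∈ T) (hne : {p, q, r} ≠ t) (h : 0 < orient p q r)
    (hx : x ∈ openSegment ℝ p q) (hxt : x ∈ convexHull ℝ (t : Set Plane)) {z : Plane}
    (hz : z ∈ convexHull ℝ (t : Set Plane)) : orient p q z ≤ 0 := by
  by_contra! hpos
  have h1 := (tendsto_combo x z).eventually (eventually_mem_openSimplex h hx)
  obtain ⟨ε, h2, h3⟩ := (h1.and (Ioo_mem_nhdsGT (show (0 : ℝ) < 1 by norm_num))).exists
  refine Set.disjoint_left.1 (hT.disjoint_hull ht hs hne.symm)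
    (hull_segment hxt hz h3.1.le h3.2.le) (h2 ?_)
  rw [orient_combo_pair, orient_of_mem_openSegment hx]
  simpa using mul_pos h3.1 hpos

/-- If the tiled set continues beyond an edge, then there is a triangle on the other side. -/
lemma IsTiling.exists_neighbor_of_pos (hT : IsTiling d P T) {p q r x : Plane}
    (hs : {p, q, r} ∈ T) (h : 0 < orient p q r) (hx : x ∈ openSegment ℝ p q)
    (hcl : x ∈ closure (P ∩ {z | orient p q z < 0})) :
    ∃ s, {p, q, s} ∈ T ∧ orient p q s < 0 := by
  classical
  have hpq := (ne_of_orient h.ne').1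
  set A := ⋃ t ∈ T.erase {p, q, r}, convexHull ℝ (t : Set Plane) with hA
  have hAc : IsClosed A := Set.Finite.isClosed_biUnion (Finset.finite_toSet _) fun t _ =>
      isClosed_hull t
  have hsub : P ∩ {z | orient p q z < 0} ⊆ A := by
    rintro z ⟨hzP, hz⟩
    obtain ⟨t, ht, hzt⟩ := hT.exists_mem hzP
    refine mem_biUnion (x := t) (Finset.mem_erase.2 ⟨?_, ht⟩) hzt
    rintro rfl
    rw [mem_convexHull_iff_orient h] at hzt
    exact absurd hzt.2.2 (not_le.2 hz)
  have hxA := closure_minimal hsub hAc hcl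
  simp only [hA, mem_iUnion, Finset.mem_erase] at hxA
  obtain ⟨t, ⟨hne, ht⟩, hxt⟩ := hxA
  have side : ∀ z ∈ t, orient p q z ≤ 0 := fun z hz =>
    hT.one_side hs ht hne.symm h hx hxt (subset_hull hz)
  have hprim := (hT.minimal _ hs).isPrimitive (p := p) (q := q) (by simp) (by simp) hpq
  obtain ⟨hq, hp⟩ := mem_of_one_side (hT.minimal t ht) hprim.symm hxt
    (openSegment_symm ℝ p q ▸ hx) (fun z hz => by rw [orient_swap']; linarith [side z hz])
  obtain ⟨s, rfl, hs'⟩ := (hT.minimal t ht).1.exists_third hp hq hpq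
  exact ⟨s, ht, lt_of_le_of_ne (side s (by simp)) hs'⟩

lemma IsTiling.exists_neighbor (hT : IsTiling d P T) {p q r x : Plane}
    (hs : {p, q, r} ∈ T) (hx : x ∈ openSegment ℝ p q) (hxP : x ∈ interior P) :
    ∃ s, {p, q, s} ∈ T ∧ orient p q r * orient p q s < 0 := by
  have key : ∀ p q : Plane, {p, q, r} ∈ T → x ∈ openSegment ℝ p q → 0 < orient p q r →
      ∃ s, {p, q, s} ∈ T ∧ orient p q s < 0 := by
    intro p q hs hx h
    refine hT.exists_neighbor_of_pos hs h hx ?_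
    have ht : Filter.Tendsto (fun t : ℝ => (1 - t) • x + t • (x + x - r)) (𝓝[>] 0) (𝓝 x) :=
      tendsto_combo x _
    refine mem_closure_of_tendsto ht ?_
    filter_upwards [ht.eventually (mem_interior_iff_mem_nhds.1 hxP), self_mem_nhdsWithin]
      with ε h1 h2
    refine ⟨h1, ?_⟩
    have h0 := orient_of_mem_openSegment hx
    have : orient p q (x + x - r) = - orient p q r := by
      have : orient p q (x + x - r) = 2 * orient p q x - orient p q r := by
        simp only [orient, Pi.add_apply, Pi.sub_apply]; ring
      rw [this, h0]; ring
    change orient p q _ < 0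
    rw [orient_combo_pair, h0, this]
    have := mul_pos h2 h
    linarith
  rcases lt_or_gt_of_ne ((isTriangle_triple_iff p q r).1 (hT.minimal _ hs).1) with h | h
  · have h' : 0 < orient q p r := by rw [orient_swap']; linarith
    obtain ⟨s, h1, h2⟩ := key q p (by rwa [Finset.insert_comm]) (openSegment_symm ℝ p q ▸ hx) h'
    rw [orient_swap'] at h2
    exact ⟨s, by rwa [Finset.insert_comm], mul_neg_of_neg_of_pos h (by linarith)⟩
  · obtain ⟨s, h1, h2⟩ := key p q hs hx h
    exact ⟨s, h1, mul_neg_of_pos_of_neg h h2⟩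

/-- Different edges of a tiling do not cross. -/
lemma IsTiling.edge_unique (hT : IsTiling d P T) {v w v' w' x : Plane} (h : HasEdge T v w)
    (hvw : v ≠ w) (h' : HasEdge T v' w') (hvw' : v' ≠ w') (hx : x ∈ openSegment ℝ v w)
    (hx' : x ∈ openSegment ℝ v' w') : (v' = v ∧ w' = w) ∨ (v' = w ∧ w' = v) := by
  obtain ⟨t, ht, hv, hw⟩ := h
  obtain ⟨t', ht', hv', hw'⟩ := h'
  have hp := (hT.minimal t ht).isPrimitive hv hw hvw
  have hp' := (hT.minimal t' ht').isPrimitive hv' hw' hvw'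
  refine hp'.eq_of_collinear hp hx' hx ?_
  obtain ⟨r, rfl, hr⟩ := (hT.minimal t ht).1.exists_third hv hw hvw
  have hx0 := orient_of_mem_openSegment hx
  obtain ⟨τ, hτ0, hτ1, hxτ⟩ := mem_openSegment_iff.1 hx'
  rw [← hxτ, orient_combo_pair] at hx0
  by_cases hne : {v, w, r} = t'
  · subst hne
    simp only [Finset.mem_insert, Finset.mem_singleton] at hv' hw'
    have n1 : 1 - τ ≠ 0 := by linarith
    rcases hv' with rfl | rfl | rfl
    · simp
    · simp
    · rcases hw' with rfl | rfl | rfl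
      · simp [n1, hr] at hx0
      · simp [n1, hr] at hx0
      · exact absurd rfl hvw'
  · have hxt' : x ∈ convexHull ℝ (t' : Set Plane) := openSegment_subset_hull hv' hw' hx'
    have h1τ : 0 < 1 - τ := by linarith
    rcases lt_or_gt_of_ne hr with h | h
    · have h2 : 0 < orient w v r := by rw [orient_swap']; linarith
      have e : ({v, w, r} : Finset Plane) = {w, v, r} := Finset.insert_comm _ _ _
      have hxs : x ∈ openSegment ℝ w v := openSegment_symm ℝ v w ▸ hx
      have s1 := hT.one_side (e ▸ ht) ht' (e ▸ hne) h2 hxs hxt' (subset_hull hv')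
      have s2 := hT.one_side (e ▸ ht) ht' (e ▸ hne) h2 hxs hxt' (subset_hull hw')
      rw [orient_swap'] at s1 s2
      nlinarith
    · have s1 := hT.one_side ht ht' hne h hx hxt' (subset_hull hv')
      have s2 := hT.one_side ht ht' hne h hx hxt' (subset_hull hw')
      nlinarith

/-- `T'` arises from `T` by exchanging the diagonal `bc` of the parallelogram `abec` for `ae`. -/
def TilingFlip (T T' : Finset (Finset Plane)) : Prop :=
  ∃ (a b c e : Plane) (R : Finset (Finset Plane)), a + e = b + c ∧
    {a, b, c} ∉ insert {b, c, e} R ∧ {b, c, e} ∉ R ∧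
    T = insert {a, b, c} (insert {b, c, e} R) ∧ T' = insert {a, b, e} (insert {a, c, e} R)

lemma parallelogram_hull {a b c e : Plane} (h : a + e = b + c) (ho : 0 < orient a b c) :
    (convexHull ℝ (({a, b, e} : Finset Plane) : Set Plane) ∪
        convexHull ℝ (({a, c, e} : Finset Plane) : Set Plane) =
      convexHull ℝ (({a, b, c} : Finset Plane) : Set Plane) ∪
        convexHull ℝ (({b, c, e} : Finset Plane) : Set Plane)) ∧
    Disjoint (openSimplex {a, b, e}) (openSimplex {a, c, e}) ∧
    orient a b e = orient a b c ∧ orient a e c = orient a b c ∧ orient b e c = orient a b c := by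
  obtain rfl : e = b + c - a := by rw [← h]; abel
  have o1 : orient a b (b + c - a) = orient a b c := by
    simp only [orient, Pi.add_apply, Pi.sub_apply]; ring
  have o2 : orient a (b + c - a) c = orient a b c := by
    simp only [orient, Pi.add_apply, Pi.sub_apply]; ring
  have o3 : orient b (b + c - a) c = orient a b c := by
    simp only [orient, Pi.add_apply, Pi.sub_apply]; ring
  have s1 : ({a, c, b + c - a} : Finset Plane) = {a, b + c - a, c} := by
    ext; simp; tauto
  have s2 : ({b, c, b + c - a} : Finset Plane) = {b, b + c - a, c} := by
    ext; simp; tauto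
  -- in the coordinates `X = orient c a x`, `Y = orient a b x` everything is linear
  have l1 : ∀ x, orient b c x = orient a b c - orient c a x - orient a b x := by
    intro x; simp only [orient]; ring
  have l2 : ∀ x, orient (b + c - a) c x = orient a b c - orient a b x := by
    intro x; simp only [orient, Pi.add_apply, Pi.sub_apply]; ring
  have l3 : ∀ x, orient c b x = - (orient a b c - orient c a x - orient a b x) := by
    intro x; simp only [orient]; ring
  have l4 : ∀ x, orient b (b + c - a) x = orient a b c - orient c a x := by
    intro x; simp only [orient, Pi.add_apply, Pi.sub_apply]; ring
  have l5 : ∀ x, orient (b + c - a) a x = orient c a x - orient a b x := by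
    intro x; simp only [orient, Pi.add_apply, Pi.sub_apply]; ring
  have l6 : ∀ x, orient a (b + c - a) x = orient a b x - orient c a x := by
    intro x; simp only [orient, Pi.add_apply, Pi.sub_apply]; ring
  refine ⟨?_, ?_, o1, o2, o3⟩
  · rw [s1, s2]
    ext x
    rw [mem_union, mem_union, mem_convexHull_iff_orient (o1 ▸ ho),
        mem_convexHull_iff_orient (o2 ▸ ho),
      mem_convexHull_iff_orient ho, mem_convexHull_iff_orient (o3 ▸ ho), l1, l2, l3, l4, l5, l6]
    constructor
    · rintro (⟨h1, h2, h3⟩ | ⟨h1, h2, h3⟩)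
      · rcases le_total 0 (orient a b c - orient c a x - orient a b x) with h4 | h4
        · left; refine ⟨?_, ?_, ?_⟩ <;> linarith
        · right; refine ⟨?_, ?_, ?_⟩ <;> linarith
      · rcases le_total 0 (orient a b c - orient c a x - orient a b x) with h4 | h4
        · left; refine ⟨?_, ?_, ?_⟩ <;> linarith
        · right; refine ⟨?_, ?_, ?_⟩ <;> linarith
    · rintro (⟨h1, h2, h3⟩ | ⟨h1, h2, h3⟩)
      · rcases le_total (orient a b x) (orient c a x) with h4 | h4
        · left; refine ⟨?_, ?_, ?_⟩ <;> linarith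
        · right; refine ⟨?_, ?_, ?_⟩ <;> linarith
      · rcases le_total (orient a b x) (orient c a x) with h4 | h4
        · left; refine ⟨?_, ?_, ?_⟩ <;> linarith
        · right; refine ⟨?_, ?_, ?_⟩ <;> linarith
  · rw [s1, Set.disjoint_left]
    intro x h1 h2
    rw [mem_openSimplex_iff (o1 ▸ ho), l5] at h1
    rw [mem_openSimplex_iff (o2 ▸ ho), l6] at h2
    linarith [h1.2.1, h2.2.2]

/-- If a diagonal cuts a parallelogram into two minimal triangles, so does the other diagonal. -/
lemma parallelogram_flip (hd : 0 < d) {a b c e : Plane} (h : a + e = b + c)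
    (h1 : IsMinimalTriangle d {a, b, c}) (h2 : IsMinimalTriangle d {b, c, e}) :
    (convexHull ℝ (({a, b, e} : Finset Plane) : Set Plane) ∪
        convexHull ℝ (({a, c, e} : Finset Plane) : Set Plane) =
      convexHull ℝ (({a, b, c} : Finset Plane) : Set Plane) ∪
        convexHull ℝ (({b, c, e} : Finset Plane) : Set Plane)) ∧
    Disjoint (openSimplex {a, b, e}) (openSimplex {a, c, e}) ∧
    IsMinimalTriangle d {a, b, e} ∧ IsMinimalTriangle d {a, c, e} ∧ orient a b e ≠ 0 ∧
    orient a c e ≠ 0 := by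
  have key : ∀ b c : Plane, a + e = b + c → 0 < orient a b c → IsMinimalTriangle d {a, b, c} →
      IsMinimalTriangle d {b, c, e} → (convexHull ℝ (({a, b, e} : Finset Plane) : Set Plane) ∪
        convexHull ℝ (({a, c, e} : Finset Plane) : Set Plane) =
      convexHull ℝ (({a, b, c} : Finset Plane) : Set Plane) ∪
        convexHull ℝ (({b, c, e} : Finset Plane) : Set Plane)) ∧
    Disjoint (openSimplex {a, b, e}) (openSimplex {a, c, e}) ∧
    IsMinimalTriangle d {a, b, e} ∧ IsMinimalTriangle d {a, c, e} ∧ orient a b e ≠ 0 ∧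
    orient a c e ≠ 0 := by
    intro b c h ho h1 h2
    obtain ⟨p1, p2, p3, p4, -⟩ := parallelogram_hull h ho
    have ha := h1.mem_lattice (p := a) (by simp)
    have hb := h1.mem_lattice (p := b) (by simp)
    have hc := h1.mem_lattice (p := c) (by simp)
    have he := h2.mem_lattice (p := e) (by simp)
    have hu := h1.orient_eq hd ho
    refine ⟨p1, p2, minimal_of_orient hd ha hb he (by rw [p3, hu]), ?_, by rw [p3]; exact ho.ne',
        ?_⟩
    · rw [show ({a, c, e} : Finset Plane) = {a, e, c} by ext; simp; tauto]
      exact minimal_of_orient hd ha he hc (by rw [p4, hu])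
    · rw [orient_swap, p4]; exact neg_ne_zero.2 ho.ne'
  rcases lt_or_gt_of_ne ((isTriangle_triple_iff a b c).1 h1.1) with ho | ho
  · have := key c b (by rw [h, add_comm]) (by rw [orient_swap]; linarith)
      (by rwa [Finset.pair_comm]) (by rwa [Finset.insert_comm])
    obtain ⟨p1, p2, p3, p4, p5, p6⟩ := this
    refine ⟨?_, p2.symm, p4, p3, p6, p5⟩
    rw [union_comm, p1, Finset.pair_comm c b, Finset.insert_comm c b]
  · exact key b c h ho h1 h2

/-- A flip of a tiling is a tiling, and the two triangles it creates were not in the tiling. -/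
lemma IsTiling.flip_aux (hd : 0 < d) {a b c e : Plane} {R : Finset (Finset Plane)}
    (h : a + e = b + c) (hA : {a, b, c} ∉ insert {b, c, e} R) (hB : {b, c, e} ∉ R)
    (hT : IsTiling d P (insert {a, b, c} (insert {b, c, e} R))) :
    IsTiling d P (insert {a, b, e} (insert {a, c, e} R)) ∧ {a, b, e} ∉ insert {a, c, e} R ∧
      {a, c, e} ∉ R := by
  have mA := hT.minimal {a, b, c} (by simp)
  have mB := hT.minimal {b, c, e} (by simp)
  obtain ⟨p1, p2, p3, p4, p5, p6⟩ := parallelogram_flip hd h mA mB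
  have hdis : ∀ s ∈ R, Disjoint (convexHull ℝ (({a, b, e} : Finset Plane) : Set Plane) ∪
        convexHull ℝ (({a, c, e} : Finset Plane) : Set Plane)) (openSimplex s) := by
    intro s hs
    rw [p1, Set.disjoint_union_left]
    refine ⟨hT.disjoint_hull (by simp) (by simp [hs]) ?_, hT.disjoint_hull (by simp) (by simp [hs])
        ?_⟩
    · rintro rfl; exact hA (by simp [hs])
    · rintro rfl; exact hB hs
  have d1 : ∀ s ∈ R, Disjoint (openSimplex {a, b, e}) (openSimplex s) := fun s hs =>
    (hdis s hs).mono_left ((openSimplex_subset_convexHull _).trans subset_union_left)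
  have d2 : ∀ s ∈ R, Disjoint (openSimplex {a, c, e}) (openSimplex s) := fun s hs =>
    (hdis s hs).mono_left ((openSimplex_subset_convexHull _).trans subset_union_right)
  have n1 : (openSimplex ({a, b, e} : Finset Plane)).Nonempty := openSimplex_nonempty (by simp)
  have n2 : (openSimplex ({a, c, e} : Finset Plane)).Nonempty := openSimplex_nonempty (by simp)
  have i1 : {a, b, e} ∉ R := fun hm => n1.ne_empty (disjoint_self.1 (d1 _ hm))
  have i2 : {a, c, e} ∉ R := fun hm => n2.ne_empty (disjoint_self.1 (d2 _ hm))
  have i3 : ({a, b, e} : Finset Plane) ≠ {a, c, e} := fun he => by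
    rw [he] at p2
    exact n2.ne_empty (disjoint_self.1 p2)
  refine ⟨⟨?_, ?_, ?_⟩, by simp [i1, i3], i2⟩
  · intro t ht
    simp only [Finset.mem_insert] at ht
    rcases ht with rfl | rfl | ht
    · exact p3
    · exact p4
    · exact hT.minimal t (by simp [ht])
  · intro s hs t ht hne
    simp only [Finset.mem_insert] at hs ht
    rcases hs with rfl | rfl | hs <;> rcases ht with rfl | rfl | ht
    · exact absurd rfl hne
    · exact p2
    · exact d1 _ ht
    · exact p2.symm
    · exact absurd rfl hne
    · exact d2 _ ht
    · exact (d1 _ hs).symm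
    · exact (d2 _ hs).symm
    · exact hT.disjoint s (by simp [hs]) t (by simp [ht]) hne
  · rw [← hT.cover]
    rw [Finset.set_biUnion_insert, Finset.set_biUnion_insert, Finset.set_biUnion_insert,
      Finset.set_biUnion_insert, ← union_assoc, ← union_assoc, p1]

lemma TilingFlip.isTiling (hd : 0 < d) (hT : IsTiling d P T) (h : TilingFlip T T') :
    IsTiling d P T' := by
  obtain ⟨a, b, c, e, R, h1, h2, h3, rfl, rfl⟩ := h
  exact (hT.flip_aux hd h1 h2 h3).1

lemma isTiling_of_flips (hd : 0 < d) (hT : IsTiling d P T)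
    (h : Relation.ReflTransGen TilingFlip T T') : IsTiling d P T' := by
  induction h with
  | refl => exact hT
  | tail _ h ih => exact h.isTiling hd ih

/-- The multiset of the weights of the triangles of `T`. -/
def tilingWeights (d : ℕ) (T : Finset (Finset Plane)) : Multiset (Multiset (ZMod d)) :=
  T.val.map (weight d)

lemma TilingFlip.pseudoFlip (hd : 0 < d) (hT : IsTiling d P T) (h : TilingFlip T T') :
    PseudoFlip d (tilingWeights d T) (tilingWeights d T') := by
  obtain ⟨a, b, c, e, R, h1, h2, h3, rfl, rfl⟩ := h
  obtain ⟨-, h4, h5⟩ := hT.flip_aux hd h1 h2 h3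
  refine ⟨R.val.map (weight d), _, _, _, _, ⟨a, b, c, e, hT.minimal _ (by simp),
    hT.minimal _ (by simp), h1, rfl, rfl, rfl, rfl⟩, ?_, ?_⟩
  · simp only [tilingWeights, Finset.insert_val_of_notMem h2, Finset.insert_val_of_notMem h3,
      Multiset.map_cons, Multiset.insert_eq_cons, Multiset.cons_add, Multiset.singleton_add]
  · simp only [tilingWeights, Finset.insert_val_of_notMem h4, Finset.insert_val_of_notMem h5,
      Multiset.map_cons, Multiset.insert_eq_cons, Multiset.cons_add, Multiset.singleton_add]

lemma pseudoFlips_of_flips (hd : 0 < d) (hT : IsTiling d P T)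
    (h : Relation.ReflTransGen TilingFlip T T') :
    Relation.ReflTransGen (PseudoFlip d) (tilingWeights d T) (tilingWeights d T') := by
  induction h with
  | refl => exact .refl
  | tail h1 h2 ih => exact ih.tail (h2.pseudoFlip hd (isTiling_of_flips hd hT h1))

end

section

/-! ### Inserting an edge by flips -/

variable {d : ℕ} {P : Set Plane} {T T' T₀ : Finset (Finset Plane)}

/-- The extent of a triangle across the line `vw` (twice the sum of the differences of the
heights of its vertices). -/
def spread (v w : Plane) (t : Finset Plane) : ℝ :=
  ∑ p ∈ t, ∑ q ∈ t, |orient v w p - orient v w q|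

lemma spread_triple {v w p q r : Plane} (h : orient p q r ≠ 0) :
    spread v w {p, q, r} = 2 * (|orient v w p - orient v w q| + |orient v w p - orient v w r|
      + |orient v w q - orient v w r|) := by
  classical
  obtain ⟨hpq, hpr, hqr⟩ := ne_of_orient h
  have e : ∀ f : Plane → ℝ, ∑ z ∈ ({p, q, r} : Finset Plane), f z = f p + f q + f r := by
    intro f
    rw [Finset.sum_insert (by simp [hpq, hpr]), Finset.sum_pair hqr, add_assoc]
  unfold spread
  rw [e, e, e, e, abs_sub_comm (orient v w q) (orient v w p),
    abs_sub_comm (orient v w r) (orient v w p), abs_sub_comm (orient v w r) (orient v w q)]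
  simp only [sub_self, abs_zero]; ring

lemma spread_integral {v w : Plane} (hv : v ∈ lattice d) (hw : w ∈ lattice d)
    {t : Finset Plane} (ht : ∀ p ∈ t, p ∈ lattice d) :
    ∃ n : ℕ, (d : ℝ) ^ 2 * spread v w t = n := by
  have h1 : ∀ p ∈ t, ∀ q ∈ t, ∃ n : ℕ, (d : ℝ) ^ 2 * |orient v w p - orient v w q| = n := by
    intro p hp q hq
    obtain ⟨k, hk⟩ := orient_lattice hv hw (ht p hp)
    obtain ⟨l, hl⟩ := orient_lattice hv hw (ht q hq)
    refine ⟨(k - l).natAbs, ?_⟩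
    rw [Nat.cast_natAbs, Int.cast_abs, Int.cast_sub, ← hk, ← hl, ← mul_sub, abs_mul,
        abs_of_nonneg (sq_nonneg (d : ℝ))]
  have hsum : ∀ (s : Finset Plane) (f : Plane → ℝ), (∀ p ∈ s, ∃ n : ℕ, (d : ℝ) ^ 2 * f p = n) →
      ∃ n : ℕ, (d : ℝ) ^ 2 * ∑ p ∈ s, f p = n := by
    intro s f hf
    choose! g hg using hf
    exact ⟨∑ p ∈ s, g p, by rw [Finset.mul_sum, Nat.cast_sum]; exact Finset.sum_congr rfl hg⟩
  exact hsum _ _ fun p hp => hsum _ _ fun q hq => h1 p hp q hq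

lemma total_spread_integral (hT : IsTiling d P T) {v w : Plane} (hv : v ∈ lattice d)
    (hw : w ∈ lattice d) : ∃ n : ℕ, (d : ℝ) ^ 2 * ∑ t ∈ T, spread v w t = n := by
  have : ∀ t ∈ T, ∃ n : ℕ, (d : ℝ) ^ 2 * spread v w t = n := fun t ht =>
    spread_integral hv hw fun p hp => (hT.minimal t ht).mem_lattice hp
  choose! g hg using this
  exact ⟨∑ t ∈ T, g t, by rw [Finset.mul_sum, Nat.cast_sum]; exact Finset.sum_congr rfl hg⟩

lemma IsMinimalTriangle.abs_orient {p q r : Plane} (hd : 0 < d)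
    (h : IsMinimalTriangle d {p, q, r}) : (d : ℝ) ^ 2 * |orient p q r| = 1 := by
  rcases lt_or_gt_of_ne ((isTriangle_triple_iff p q r).1 h.1) with ho | ho
  · rw [abs_of_neg ho, ← orient_swap']
    exact (show IsMinimalTriangle d {q, p, r} by rwa [Finset.insert_comm]).orient_eq hd
      (by rw [orient_swap']; linarith)
  · rw [abs_of_pos ho]
    exact h.orient_eq hd ho

/-- A minimal triangle with an edge `pq` across a primitive segment `vw` has no edge parallel to
`vw` at the height of `p`: its area would be too large. -/
lemma height_ne {p q s v w : Plane} (hd : 0 < d) (h : IsMinimalTriangle d {p, q, s})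
    (hvw : IsPrimitive d v w) (hp : 0 < orient v w p) (hq : orient v w q < 0) :
    orient v w s ≠ orient v w p := by
  intro he
  have hpl := h.mem_lattice (p := p) (by simp)
  have hql := h.mem_lattice (p := q) (by simp)
  have hsl := h.mem_lattice (p := s) (by simp)
  have hd' : (0 : ℝ) < (d : ℝ) ^ 2 := by positivity
  obtain ⟨a, ha⟩ := exists_eq_of_orient_eq_zero (x := v + s - p) hvw.2.2.1 (by
    have : orient v w (v + s - p) = orient v w s - orient v w p := by
      simp only [orient, Pi.add_apply, Pi.sub_apply]; ring
    rw [this, he, sub_self])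
  have hs : s = p + a • (w - v) := by
    have : s = (v + s - p) - v + p := by abel
    rw [this, ha]; module
  have harea := h.abs_orient hd
  have ho : orient p q s = a * (orient v w p - orient v w q) := by
    rw [hs]; simp only [orient, Pi.add_apply, Pi.sub_apply, Pi.smul_apply, smul_eq_mul]; ring
  have one_le : ∀ z : Plane, z ∈ lattice d → 0 < orient v w z → 1 ≤ (d : ℝ) ^ 2 * orient v w z := by
    intro z hz hz0
    obtain ⟨k, hk⟩ := orient_lattice hvw.1 hvw.2.1 hz
    have : (0 : ℝ) < k := by rw [← hk]; positivity
    rw [hk]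
    have : 0 < k := by exact_mod_cast this
    exact_mod_cast this
  have h1 := one_le p hpl hp
  have h2 : 1 ≤ (d : ℝ) ^ 2 * -orient v w q := by
    obtain ⟨k, hk⟩ := orient_lattice hvw.1 hvw.2.1 hql
    have : (k : ℝ) < 0 := by rw [← hk]; exact mul_neg_of_pos_of_neg hd' hq
    have : k < 0 := by exact_mod_cast this
    have : (k : ℝ) ≤ -1 := by exact_mod_cast (by omega : k ≤ -1)
    linarith
  have h3 : |a| * ((d : ℝ) ^ 2 * (orient v w p - orient v w q)) = 1 := by
    rw [← harea, ho, abs_mul, abs_of_pos (by linarith : 0 < orient v w p - orient v w q)]; ring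
  have h4 : 2 ≤ (d : ℝ) ^ 2 * (orient v w p - orient v w q) := by linarith
  have h5 : |a| < 1 := by nlinarith [abs_nonneg a]
  have h6 : a ≠ 0 := by rintro rfl; simp at h3
  have hl : v + s - p ∈ lattice d := lattice_sub (lattice_add hvw.1 hsl) hpl
  rcases lt_or_gt_of_ne h6 with h7 | h7
  · have hl' : v + p - s ∈ lattice d := lattice_sub (lattice_add hvw.1 hpl) hsl
    refine hvw.not_mem (mem_openSegment_iff.2 ⟨-a, by linarith, ?_, ?_⟩) hl'
    · rw [abs_of_neg h7] at h5; exact h5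
    · rw [hs]; module
  · refine hvw.not_mem (mem_openSegment_iff.2 ⟨a, h7, ?_, ha.symm⟩) hl
    rw [abs_of_pos h7] at h5; exact h5

/-- Two adjacent minimal triangles form a parallelogram as soon as the third vertices have heights
(over some line) strictly between those of the ends of the common edge. -/
lemma parallelogram_of_heights {p q r s v w : Plane} (hd : 0 < d)
    (h1 : IsMinimalTriangle d {p, q, r}) (h2 : IsMinimalTriangle d {p, q, s})
    (hopp : orient p q r * orient p q s < 0)
    (hr1 : orient v w r < orient v w p) (hr2 : orient v w q < orient v w r)
    (hs1 : orient v w s < orient v w p) (hs2 : orient v w q < orient v w s) : r + s = p + q := by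
  have hd' : (0 : ℝ) < (d : ℝ) ^ 2 := by positivity
  have hpq : p ≠ q := by rintro rfl; linarith
  have hprim := h1.isPrimitive (p := p) (q := q) (by simp) (by simp) hpq
  have hsum : orient p q r + orient p q s = 0 := by
    have a1 := h1.abs_orient hd
    have a2 := h2.abs_orient hd
    have : |orient p q r| = |orient p q s| := mul_left_cancel₀ hd'.ne' (a1.trans a2.symm)
    rcases abs_eq_abs.1 this with h | h
    · rw [h] at hopp; nlinarith [mul_self_nonneg (orient p q s)]
    · rw [h]; ring
  obtain ⟨a, ha⟩ := exists_eq_of_orient_eq_zero (x := r + s - q) hpq (by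
    rw [← hsum]; simp only [orient, Pi.add_apply, Pi.sub_apply]; ring)
  have hy : orient v w r + orient v w s - orient v w q =
      (1 - a) * orient v w p + a * orient v w q := by
    rw [← orient_combo_pair, ← ha]; simp only [orient, Pi.add_apply, Pi.sub_apply]; ring
  have ha1 : a < 1 := by nlinarith
  have ha2 : -1 < a := by nlinarith
  have hl : r + s - q ∈ lattice d :=
    lattice_sub (lattice_add (h1.mem_lattice (by simp)) (h2.mem_lattice (by simp))) hprim.2.1
  rcases lt_trichotomy a 0 with h | h | h
  · -- reflect the lattice point `r + s - q` in `p`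
    have hl' : p + p - (r + s - q) ∈ lattice d := lattice_sub (lattice_add hprim.1 hprim.1) hl
    refine absurd hl' (hprim.not_mem (mem_openSegment_iff.2 ⟨-a, by linarith, by linarith, ?_⟩))
    rw [ha]; module
  · rw [h] at ha
    have : r + s - q = p := by rw [ha]; simp
    rw [← this]; abel
  · exact absurd hl (hprim.not_mem (mem_openSegment_iff.2 ⟨a, h, ha1, ha.symm⟩))

lemma abs_add_abs_of_between {a b x : ℝ} (h1 : b ≤ x) (h2 : x ≤ a) :
    |a - b| + |a - x| + |b - x| = 2 * (a - b) := by
  rw [abs_of_nonneg (by linarith), abs_of_nonneg (by linarith), abs_of_nonpos (by linarith)]; ring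

/-- If a triangle of the tiling meets the open segment `vw` and has vertices on both sides of it,
then flipping the long edge `pq` of such a triangle of greatest spread decreases the total spread
across `vw`. -/
lemma IsTiling.exists_flip (hd : 0 < d) (hT : IsTiling d P T) {v w : Plane}
    (hvw : IsPrimitive d v w) (hint : openSegment ℝ v w ⊆ interior P)
    (hex : ∃ t ∈ T, (∃ x ∈ openSegment ℝ v w, x ∈ convexHull ℝ (t : Set Plane)) ∧
      (∃ p ∈ t, 0 < orient v w p) ∧ ∃ q ∈ t, orient v w q < 0) :
    ∃ T', TilingFlip T T' ∧ ∑ t ∈ T', spread v w t < ∑ t ∈ T, spread v w t ∧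
      ∀ v' w', v' ≠ w' → Disjoint (openSegment ℝ v' w') (openSegment ℝ v w) → HasEdge T v' w' →
        HasEdge T' v' w' := by
  classical
  set S : Finset (Finset Plane) := T.filter fun t : Finset Plane =>
      (∃ x ∈ openSegment ℝ v w, x ∈ convexHull ℝ (t : Set Plane)) ∧
      (∃ p ∈ t, 0 < orient v w p) ∧ ∃ q ∈ t, orient v w q < 0 with hS
  have hSne : S.Nonempty := by
    obtain ⟨t, ht, h⟩ := hex
    exact ⟨t, Finset.mem_filter.2 ⟨ht, h⟩⟩
  obtain ⟨t, htS, hmax⟩ := S.exists_max_image (spread v w) hSne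
  obtain ⟨htT, ⟨x, hxe, hxt⟩, ⟨p', hp', hp'0⟩, ⟨q', hq', hq'0⟩⟩ := Finset.mem_filter.1 htS
  obtain ⟨p, hp, hpmax⟩ := t.exists_max_image (orient v w) ⟨p', hp'⟩
  obtain ⟨q, hq, hqmin⟩ := t.exists_min_image (orient v w) ⟨p', hp'⟩
  have hp0 : 0 < orient v w p := hp'0.trans_le (hpmax _ hp')
  have hq0 : orient v w q < 0 := (hqmin _ hq').trans_lt hq'0
  have hpq : p ≠ q := by rintro rfl; linarith
  have hmin := hT.minimal t htT
  obtain ⟨z, hz1, hz2⟩ := exists_crossing hmin hvw hxt hxe hp hq hp0 hq0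
  obtain ⟨r, rfl, hor⟩ := hmin.1.exists_third hp hq hpq
  obtain ⟨s, hsT, hopp⟩ := hT.exists_neighbor htT hz1 (hint hz2)
  have hmin' := hT.minimal _ hsT
  have hos := (isTriangle_triple_iff _ _ _).1 hmin'.1
  have hsS : {p, q, s} ∈ S := Finset.mem_filter.2 ⟨hsT,
    ⟨z, hz2, openSegment_subset_hull (by simp) (by simp) hz1⟩, ⟨p, by simp, hp0⟩, ⟨q, by simp, hq0⟩⟩
  have hr1 := hpmax r (by simp)
  have hr2 := hqmin r (by simp)
  have hle := hmax _ hsS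
  have hA := spread_triple (v := v) (w := w) hor
  have hB := spread_triple (v := v) (w := w) hos
  rw [abs_add_abs_of_between hr2 hr1] at hA
  rw [hA, hB, abs_of_pos (by linarith : 0 < orient v w p - orient v w q)] at hle
  -- `s` cannot stick out, because the triangle `pqr` has the greatest spread
  have hs1 : orient v w s ≤ orient v w p := by
    by_contra! h
    have := abs_nonneg (orient v w p - orient v w s)
    have a2 : |orient v w q - orient v w s| = orient v w s - orient v w q := by
      rw [abs_of_neg (by linarith)]; ring
    have a3 : |orient v w p - orient v w s| = orient v w s - orient v w p := by
      rw [abs_of_neg (by linarith)]; ring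
    linarith
  have hs2 : orient v w q ≤ orient v w s := by
    by_contra! h
    have a2 : |orient v w q - orient v w s| = orient v w q - orient v w s := by
      rw [abs_of_pos (by linarith)]
    have a3 : |orient v w p - orient v w s| = orient v w p - orient v w s := by
      rw [abs_of_pos (by linarith)]
    linarith
  rw [abs_add_abs_of_between hs2 hs1] at hB
  have swap : ∀ u, IsMinimalTriangle d {p, q, u} → orient v w u ≠ orient v w q := by
    intro u hu he
    refine height_ne hd (p := q) (q := p) (s := u) (by rwa [Finset.insert_comm]) hvw.symm ?_ ?_ ?_
    · simp only [orient] at hq0 ⊢; linarith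
    · simp only [orient] at hp0 ⊢; linarith
    · simp only [orient] at he ⊢; linarith
  have hr1' := lt_of_le_of_ne hr1 (height_ne hd hmin hvw hp0 hq0)
  have hs1' := lt_of_le_of_ne hs1 (height_ne hd hmin' hvw hp0 hq0)
  have hr2' := lt_of_le_of_ne hr2 (swap r hmin).symm
  have hs2' := lt_of_le_of_ne hs2 (swap s hmin').symm
  have hpar := parallelogram_of_heights hd hmin hmin' hopp hr1' hr2' hs1' hs2'
  have eA : ({p, q, r} : Finset Plane) = {r, p, q} := by ext; simp; tauto
  rw [eA] at htT hmin hA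
  have hne : ({r, p, q} : Finset Plane) ≠ {p, q, s} := by
    intro h
    have : r ∈ ({p, q, s} : Finset Plane) := by rw [← h]; simp
    simp only [Finset.mem_insert, Finset.mem_singleton] at this
    rcases this with rfl | rfl | rfl
    · simp at hor
    · simp at hor
    · nlinarith [mul_self_nonneg (orient p q r)]
  set R := (T.erase {r, p, q}).erase {p, q, s} with hR
  have hTR : T = insert {r, p, q} (insert {p, q, s} R) := by
    rw [hR, Finset.insert_erase (Finset.mem_erase.2 ⟨hne.symm, hsT⟩), Finset.insert_erase htT]
  have n1 : {r, p, q} ∉ insert {p, q, s} R := by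
    rw [hR, Finset.insert_erase (Finset.mem_erase.2 ⟨hne.symm, hsT⟩)]
    exact Finset.notMem_erase _ _
  have n2 : {p, q, s} ∉ R := Finset.notMem_erase _ _
  rw [hTR] at hT
  obtain ⟨-, n3, n4⟩ := hT.flip_aux hd hpar n1 n2
  obtain ⟨-, -, -, -, g1, g2⟩ := parallelogram_flip hd hpar hmin hmin'
  refine ⟨insert {r, p, s} (insert {r, q, s} R), ⟨r, p, q, s, R, hpar, n1, n2, hTR, rfl⟩, ?_, ?_⟩
  · rw [hTR, Finset.sum_insert n3, Finset.sum_insert n4, Finset.sum_insert n1, Finset.sum_insert n2,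
      hA, hB, spread_triple g1, spread_triple g2]
    have b1 : |orient v w r - orient v w p| = orient v w p - orient v w r := by
      rw [abs_of_neg (by linarith)]; ring
    have b2 : |orient v w p - orient v w s| = orient v w p - orient v w s := by
      rw [abs_of_pos (by linarith)]
    have b3 : |orient v w r - orient v w q| = orient v w r - orient v w q := by
      rw [abs_of_pos (by linarith)]
    have b4 : |orient v w q - orient v w s| = orient v w s - orient v w q := by
      rw [abs_of_neg (by linarith)]; ring
    have b5 : |orient v w r - orient v w s| < orient v w p - orient v w q := by
      rw [abs_lt]; constructor <;> linarith
    rw [b1, b2, b3, b4]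
    linarith
  · rintro v' w' hne' hdis ⟨u, hu, hv', hw'⟩
    have npq : ¬ (v' = p ∧ w' = q) := by
      rintro ⟨rfl, rfl⟩
      exact Set.disjoint_left.1 hdis hz1 hz2
    have nqp : ¬ (v' = q ∧ w' = p) := by
      rintro ⟨rfl, rfl⟩
      exact Set.disjoint_left.1 hdis (openSegment_symm ℝ w' v' ▸ hz1) hz2
    rw [hTR] at hu
    simp only [Finset.mem_insert] at hu
    have m1 : ({r, p, s} : Finset Plane) ∈ insert {r, p, s} (insert ({r, q, s} : Finset Plane) R)
        := by simp
    have m2 : ({r, q, s} : Finset Plane) ∈ insert {r, p, s} (insert ({r, q, s} : Finset Plane) R)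
        := by simp
    rcases hu with rfl | rfl | hu
    · simp only [Finset.mem_insert, Finset.mem_singleton] at hv' hw'
      rcases hv' with rfl | rfl | rfl <;> rcases hw' with rfl | rfl | rfl <;>
        solve
        | exact absurd rfl hne'
        | exact absurd ⟨rfl, rfl⟩ npq
        | exact absurd ⟨rfl, rfl⟩ nqp
        | refine ⟨_, m1, ?_, ?_⟩ <;> simp
        | refine ⟨_, m2, ?_, ?_⟩ <;> simp
    · simp only [Finset.mem_insert, Finset.mem_singleton] at hv' hw'
      rcases hv' with rfl | rfl | rfl <;> rcases hw' with rfl | rfl | rfl <;>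
        solve
        | exact absurd rfl hne'
        | exact absurd ⟨rfl, rfl⟩ npq
        | exact absurd ⟨rfl, rfl⟩ nqp
        | refine ⟨_, m1, ?_, ?_⟩ <;> simp
        | refine ⟨_, m2, ?_, ?_⟩ <;> simp
    · exact ⟨u, by simp [hu], hv', hw'⟩

/-- A primitive segment in the interior of the tiled set becomes an edge after suitable flips;
the flips keep every edge that does not cross the segment. -/
theorem IsTiling.exists_insert_edge (hd : 0 < d) (hT : IsTiling d P T) {v w : Plane}
    (hvw : IsPrimitive d v w) (hint : openSegment ℝ v w ⊆ interior P) :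
    ∃ T', Relation.ReflTransGen TilingFlip T T' ∧ HasEdge T' v w ∧
      ∀ v' w', v' ≠ w' → Disjoint (openSegment ℝ v' w') (openSegment ℝ v w) → HasEdge T v' w' →
        HasEdge T' v' w' := by
  obtain ⟨n, hn⟩ := total_spread_integral hT hvw.1 hvw.2.1
  induction n using Nat.strong_induction_on generalizing T with
  | _ n ih =>
    by_cases hex : ∃ t ∈ T, (∃ x ∈ openSegment ℝ v w, x ∈ convexHull ℝ (t : Set Plane)) ∧
        (∃ p ∈ t, 0 < orient v w p) ∧ ∃ q ∈ t, orient v w q < 0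
    · obtain ⟨T₁, h1, h2, h3⟩ := hT.exists_flip hd hvw hint hex
      have hT₁ := h1.isTiling hd hT
      obtain ⟨m, hm⟩ := total_spread_integral hT₁ hvw.1 hvw.2.1
      have hlt : m < n := by
        have hd' : (0 : ℝ) < (d : ℝ) ^ 2 := by positivity
        have : (m : ℝ) < n := by rw [← hm, ← hn]; exact mul_lt_mul_of_pos_left h2 hd'
        exact_mod_cast this
      obtain ⟨T', g1, g2, g3⟩ := ih m hlt hT₁ hm
      exact ⟨T', .head h1 g1, g2, fun v' w' a b c => g3 v' w' a b (h3 v' w' a b c)⟩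
    · refine ⟨T, .refl, ?_, fun _ _ _ _ h => h⟩
      obtain ⟨x, hx⟩ : (openSegment ℝ v w).Nonempty :=
        ⟨_, mem_openSegment_iff.2 ⟨1 / 2, by norm_num, by norm_num, rfl⟩⟩
      obtain ⟨t, ht, hxt⟩ := hT.exists_mem (interior_subset (hint hx))
      push Not at hex
      have h1 := hex t ht ⟨x, hx, hxt⟩
      by_cases h2 : ∃ p ∈ t, 0 < orient v w p
      · obtain ⟨p, hp, hp0⟩ := h2
        obtain ⟨a, b⟩ := mem_of_one_side (hT.minimal t ht) hvw hxt hx (h1 ⟨p, hp, hp0⟩)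
        exact ⟨t, ht, a, b⟩
      · push Not at h2
        obtain ⟨a, b⟩ := mem_of_one_side (hT.minimal t ht) hvw.symm hxt
          (openSegment_symm ℝ v w ▸ hx) (fun p hp => by
            have := h2 p hp
            simp only [orient] at this ⊢; linarith)
        exact ⟨t, ht, b, a⟩

end

section

/-! ### Any two tilings are connected by flips -/

variable {d : ℕ} {P : Set Plane} {T T' T₀ : Finset (Finset Plane)}

/-- An edge of one tiling that is not an edge of another one lies in the interior. -/
lemma IsTiling.edge_interior (hT : IsTiling d P T) (hT₀ : IsTiling d P T₀) {v w : Plane}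
    (hvw : v ≠ w) (h₀ : HasEdge T₀ v w) (h : ¬ HasEdge T v w) :
    openSegment ℝ v w ⊆ interior P := by
  have key : ∀ {v w u : Plane}, v ≠ w → {v, w, u} ∈ T₀ → 0 < orient v w u → ¬ HasEdge T v w →
      openSegment ℝ v w ⊆ interior P := by
    intro v w u hvw ht₀ ho h
    have hprim := (hT₀.minimal _ ht₀).isPrimitive (p := v) (q := w) (by simp) (by simp) hvw
    obtain ⟨x, hx⟩ : (openSegment ℝ v w).Nonempty :=
      ⟨_, mem_openSegment_iff.2 ⟨1 / 2, by norm_num, by norm_num, rfl⟩⟩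
    have hxP : x ∈ P := hT₀.hull_subset ht₀ (openSegment_subset_hull (by simp) (by simp) hx)
    obtain ⟨t, ht, hxt⟩ := hT.exists_mem hxP
    have hneg : ∃ q ∈ t, orient v w q < 0 := by
      by_contra! hc
      obtain ⟨a, b⟩ := mem_of_one_side (hT.minimal t ht) hprim hxt hx hc
      exact h ⟨t, ht, a, b⟩
    obtain ⟨q, hq, hq0⟩ := hneg
    obtain ⟨s, hs, hs0⟩ := hT₀.exists_neighbor_of_pos ht₀ ho hx (by
      refine mem_closure_of_tendsto (tendsto_combo x q) ?_
      filter_upwards [Ioo_mem_nhdsGT (show (0 : ℝ) < 1 by norm_num)] with ε hε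
      refine ⟨hT.hull_subset ht (hull_segment hxt (subset_hull hq) hε.1.le hε.2.le), ?_⟩
      change orient v w _ < 0
      rw [orient_combo_pair, orient_of_mem_openSegment hx, mul_zero, zero_add]
      exact mul_neg_of_pos_of_neg hε.1 hq0)
    exact (openSegment_subset_interior ho hs0).trans (interior_mono
      (union_subset (hT₀.hull_subset ht₀) (hT₀.hull_subset hs)))
  obtain ⟨t, ht, hv, hw⟩ := h₀
  obtain ⟨u, rfl, ho⟩ := (hT₀.minimal t ht).1.exists_third hv hw hvw
  rcases lt_or_gt_of_ne ho with ho | ho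
  · rw [openSegment_symm]
    exact key hvw.symm (by rwa [Finset.insert_comm]) (by rw [orient_swap']; linarith)
      (fun hc => h hc.symm)
  · exact key hvw ht ho h

/-- The open edges of a tiling are disjoint from its open triangles. -/
lemma IsTiling.disjoint_edge (hT : IsTiling d P T) {t : Finset Plane} (ht : t ∈ T) {p q : Plane}
    (hpq : p ≠ q) (h : HasEdge T p q) : Disjoint (openSegment ℝ p q) (openSimplex t) := by
  obtain ⟨s, hs, hp, hq⟩ := h
  by_cases hst : s = t
  · subst hst
    exact Set.disjoint_left.2 fun x hx =>
        not_mem_openSimplex_of_edge (hT.minimal s hs).1 hp hq hpq hx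
  · exact (hT.disjoint_hull hs ht hst).mono_left (openSegment_subset_hull hp hq)

lemma IsMinimalTriangle.not_mem_lattice {t : Finset Plane} (h : IsMinimalTriangle d t) {x : Plane}
    (hx : x ∈ openSimplex t) : x ∉ lattice d := fun hl =>
  not_mem_openSimplex_of_mem h.1 (h.mem_of_lattice (openSimplex_subset_convexHull t hx) hl) hx

lemma openSimplex_subset_of_frontier {t : Finset Plane} {U : Set Plane}
    (hdis : Disjoint (openSimplex t) (frontier U)) (hmeet : (openSimplex t ∩ U).Nonempty) :
    openSimplex t ⊆ U := by
  have hnf : ∀ z ∈ openSimplex t, z ∈ closure U → z ∈ interior U := fun z hz hc => by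
    by_contra hi
    exact Set.disjoint_left.1 hdis hz ⟨hc, hi⟩
  intro x hx
  by_contra hxU
  obtain ⟨y, hy, hyU⟩ := hmeet
  obtain ⟨z, -, hz1, hz2⟩ := (convex_openSimplex t).isPreconnected (interior U) (closure U)ᶜ
    isOpen_interior isClosed_closure.isOpen_compl
    (fun z hz => by
      by_cases h : z ∈ closure U
      · exact Or.inl (hnf z hz h)
      · exact Or.inr h)
    ⟨y, hy, hnf y hy (subset_closure hyU)⟩
    ⟨x, hx, fun h => hxU (interior_subset (hnf x hx h))⟩
  exact hz2 (subset_closure (interior_subset hz1))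

lemma frontier_openSimplex_cases {s : Finset Plane} (h : IsTriangle s) {x : Plane}
    (hx : x ∈ frontier (openSimplex s)) :
    x ∈ s ∨ (∃ p ∈ s, ∃ q ∈ s, p ≠ q ∧ x ∈ openSegment ℝ p q) := by
  rw [h.isOpen.frontier_eq, closure_openSimplex] at hx
  rcases hull_cases h hx.1 with h1 | h1 | h1
  · exact Or.inl h1
  · exact Or.inr h1
  · exact absurd h1 hx.2

lemma IsTiling.exists_open_inter (hT : IsTiling d P T) {U : Set Plane} (hU : IsOpen U)
    (h : (U ∩ P).Nonempty) : ∃ t ∈ T, (openSimplex t ∩ U).Nonempty := by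
  obtain ⟨x, hxU, hxP⟩ := h
  obtain ⟨t, ht, hxt⟩ := hT.exists_mem hxP
  obtain ⟨y, hyU, hyt⟩ := mem_closure_iff.1 (hull_subset_closure t hxt) U hU hxU
  exact ⟨t, ht, y, hyt, hyU⟩

/-- A tiling is determined by its edges. -/
lemma IsTiling.eq_of_edges (hT : IsTiling d P T) (hT₀ : IsTiling d P T₀)
    (h : ∀ v w, v ≠ w → HasEdge T₀ v w → HasEdge T v w) : T = T₀ := by
  have key : ∀ t₀ ∈ T₀, t₀ ∈ T := by
    intro t₀ ht₀
    have hmin₀ := hT₀.minimal t₀ ht₀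
    have hne : t₀.Nonempty := by rw [← Finset.card_pos, hmin₀.1.1]; norm_num
    obtain ⟨x, hx⟩ := openSimplex_nonempty hne
    obtain ⟨t, ht, hmeet⟩ := hT.exists_open_inter hmin₀.1.isOpen
      ⟨x, hx, hT₀.hull_subset ht₀ (openSimplex_subset_convexHull _ hx)⟩
    have hmin := hT.minimal t ht
    have hsub : openSimplex t ⊆ openSimplex t₀ := by
      refine openSimplex_subset_of_frontier (Set.disjoint_left.2 fun z hz hzf => ?_) hmeet
      rcases frontier_openSimplex_cases hmin₀.1 hzf with h1 | ⟨p, hp, q, hq, hpq, h1⟩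
      · exact hmin.not_mem_lattice hz (hmin₀.mem_lattice h1)
      · exact Set.disjoint_left.1 (hT.disjoint_edge ht hpq (h p q hpq ⟨t₀, ht₀, hp, hq⟩)) h1 hz
    have hsub' : t ⊆ t₀ := by
      intro p hp
      refine hmin₀.mem_of_lattice ?_ (hmin.mem_lattice hp)
      rw [← closure_openSimplex]
      exact closure_mono hsub (hull_subset_closure t (subset_hull hp))
    have : t = t₀ := Finset.eq_of_subset_of_card_le hsub' (by rw [hmin.1.1, hmin₀.1.1])
    rwa [← this]
  refine Finset.Subset.antisymm (fun t ht => ?_) key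
  have hmin := hT.minimal t ht
  have hne : t.Nonempty := by rw [← Finset.card_pos, hmin.1.1]; norm_num
  obtain ⟨x, hx⟩ := openSimplex_nonempty hne
  obtain ⟨t₀, ht₀, hx₀⟩ := hT₀.exists_mem (hT.hull_subset ht (openSimplex_subset_convexHull _ hx))
  by_contra hc
  exact Set.disjoint_left.1 (hT.disjoint_hull (key t₀ ht₀) ht (fun he => hc (he ▸ ht₀))) hx₀ hx

/-- Insert pairwise non-crossing primitive segments into a tiling by flips. -/
lemma IsTiling.exists_insert_edges (hd : 0 < d) (hT : IsTiling d P T) (E : Finset (Plane × Plane))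
    (hE : ∀ e ∈ E, IsPrimitive d e.1 e.2)
    (hint : ∀ T', IsTiling d P T' → ∀ e ∈ E,
        HasEdge T' e.1 e.2 ∨ openSegment ℝ e.1 e.2 ⊆ interior P)
    (hcross : ∀ e ∈ E, ∀ f ∈ E, e = f ∨ e = f.swap ∨
      Disjoint (openSegment ℝ e.1 e.2) (openSegment ℝ f.1 f.2)) :
    ∃ T', Relation.ReflTransGen TilingFlip T T' ∧ ∀ e ∈ E, HasEdge T' e.1 e.2 := by
  classical
  induction E using Finset.induction_on with
  | empty => exact ⟨T, .refl, by simp⟩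
  | insert e E he ih =>
    obtain ⟨T₁, h1, h2⟩ := ih (fun f hf => hE f (by simp [hf])) (fun T' hT' f hf =>
        hint T' hT' f (by simp [hf]))
      (fun f hf g hg => hcross f (by simp [hf]) g (by simp [hg]))
    have hT₁ := isTiling_of_flips hd hT h1
    rcases hint T₁ hT₁ e (by simp) with h3 | h3
    · refine ⟨T₁, h1, ?_⟩
      intro f hf
      rcases Finset.mem_insert.1 hf with rfl | hf
      · exact h3
      · exact h2 f hf
    · obtain ⟨T₂, g1, g2, g3⟩ := hT₁.exists_insert_edge hd (hE e (by simp)) h3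
      refine ⟨T₂, h1.trans g1, ?_⟩
      intro f hf
      rcases Finset.mem_insert.1 hf with rfl | hf
      · exact g2
      · rcases hcross f (by simp [hf]) e (by simp) with rfl | rfl | h4
        · exact g2
        · exact g2.symm
        · exact g3 _ _ (hE f (by simp [hf])).2.2.1 h4 (h2 f hf)

/-- Any two tilings of a set by `d`-minimal triangles are connected by flips. -/
theorem IsTiling.flip_connected (hd : 0 < d) (hT : IsTiling d P T) (hT₀ : IsTiling d P T₀) :
    Relation.ReflTransGen TilingFlip T T₀ := by
  classical
  obtain ⟨T', h1, h2⟩ := hT.exists_insert_edges hd (T₀.biUnion Finset.offDiag) (by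
      intro e he
      obtain ⟨t, ht, he⟩ := Finset.mem_biUnion.1 he
      obtain ⟨h1, h2, h3⟩ := Finset.mem_offDiag.1 he
      exact (hT₀.minimal t ht).isPrimitive h1 h2 h3) (by
      intro T' hT' e he
      obtain ⟨t, ht, he⟩ := Finset.mem_biUnion.1 he
      obtain ⟨h1, h2, h3⟩ := Finset.mem_offDiag.1 he
      by_cases h : HasEdge T' e.1 e.2
      · exact Or.inl h
      · exact Or.inr (hT'.edge_interior hT₀ h3 ⟨t, ht, h1, h2⟩ h)) (by
      intro e he f hf
      obtain ⟨t, ht, he⟩ := Finset.mem_biUnion.1 he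
      obtain ⟨h1, h2, h3⟩ := Finset.mem_offDiag.1 he
      obtain ⟨s, hs, hf⟩ := Finset.mem_biUnion.1 hf
      obtain ⟨g1, g2, g3⟩ := Finset.mem_offDiag.1 hf
      by_cases hdis : Disjoint (openSegment ℝ e.1 e.2) (openSegment ℝ f.1 f.2)
      · exact Or.inr (Or.inr hdis)
      · obtain ⟨x, hx, hx'⟩ := Set.not_disjoint_iff.1 hdis
        rcases hT₀.edge_unique ⟨s, hs, g1, g2⟩ g3 ⟨t, ht, h1, h2⟩ h3 hx' hx with h | h
        · exact Or.inl (Prod.ext h.1 h.2)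
        · exact Or.inr (Or.inl (Prod.ext h.1 h.2)))
  have hT' := isTiling_of_flips hd hT h1
  rwa [← hT'.eq_of_edges hT₀ (by
    rintro v w hvw ⟨t, ht, hv, hw⟩
    exact h2 (v, w) (Finset.mem_biUnion.2 ⟨t, ht, Finset.mem_offDiag.2 ⟨hv, hw, hvw⟩⟩))]

end

section

/-! ### Existence of minimal tilings -/

variable {d : ℕ} {P : Set Plane} {T T' T₀ : Finset (Finset Plane)}

/-- The lattice point with integer coordinates `i`, `j` at scale `d`. -/
def gridPoint (d : ℕ) (i j : ℤ) : Plane := ![i / d, j / d]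

@[simp] lemma gridPoint_zero (i j : ℤ) : gridPoint d i j 0 = i / d := rfl

@[simp] lemma gridPoint_one (i j : ℤ) : gridPoint d i j 1 = j / d := rfl

lemma gridPoint_mem (hd : 0 < d) (i j : ℤ) : gridPoint d i j ∈ lattice d := by
  have hd' : (d : ℝ) ≠ 0 := by exact_mod_cast hd.ne'
  intro c
  fin_cases c
  · exact ⟨i, by simp; field_simp⟩
  · exact ⟨j, by simp; field_simp⟩

/-- The lower left (`b = false`) or upper right half of a unit square of the lattice. -/
def gridTriangle (d : ℕ) (c : ℤ × ℤ × Bool) : Finset Plane :=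
  bif c.2.2 then {gridPoint d (c.1 + 1) (c.2.1 + 1), gridPoint d c.1 (c.2.1 + 1),
      gridPoint d (c.1 + 1) c.2.1}
  else {gridPoint d c.1 c.2.1, gridPoint d (c.1 + 1) c.2.1, gridPoint d c.1 (c.2.1 + 1)}

lemma gridTriangle_minimal (hd : 0 < d) (c : ℤ × ℤ × Bool) :
    IsMinimalTriangle d (gridTriangle d c) := by
  have hd' : (d : ℝ) ≠ 0 := by exact_mod_cast hd.ne'
  obtain ⟨i, j, b⟩ := c
  cases b
  · refine minimal_of_orient hd (gridPoint_mem hd _ _) (gridPoint_mem hd _ _)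
        (gridPoint_mem hd _ _) ?_
    simp only [orient, gridPoint_zero, gridPoint_one]; push_cast; field_simp; ring
  · refine minimal_of_orient hd (gridPoint_mem hd _ _) (gridPoint_mem hd _ _)
        (gridPoint_mem hd _ _) ?_
    simp only [orient, gridPoint_zero, gridPoint_one]; push_cast; field_simp; ring

lemma mem_gridTriangle_false (hd : 0 < d) (i j : ℤ) (x : Plane) :
    (x ∈ openSimplex (gridTriangle d (i, j, false)) ↔
      i < d * x 0 ∧ j < d * x 1 ∧ d * x 0 + d * x 1 < i + j + 1) ∧
    (x ∈ convexHull ℝ (gridTriangle d (i, j, false) : Set Plane) ↔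
      i ≤ d * x 0 ∧ j ≤ d * x 1 ∧ d * x 0 + d * x 1 ≤ i + j + 1) := by
  have hd' : (0 : ℝ) < d := by exact_mod_cast hd
  have ho : orient (gridPoint d i j) (gridPoint d (i + 1) j) (gridPoint d i (j + 1)) = 1 / d ^ 2 :=
      by
    simp only [orient, gridPoint_zero, gridPoint_one]; push_cast; field_simp; ring
  have hpos : 0 < orient (gridPoint d i j) (gridPoint d (i + 1) j) (gridPoint d i (j + 1)) := by
    rw [ho]; positivity
  have e1 : orient (gridPoint d (i + 1) j) (gridPoint d i (j + 1)) x =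
      (i + j + 1 - (d * x 0 + d * x 1)) / d ^ 2 := by
    simp only [orient, gridPoint_zero, gridPoint_one]; push_cast; field_simp; ring
  have e2 : orient (gridPoint d i (j + 1)) (gridPoint d i j) x = (d * x 0 - i) / d ^ 2 := by
    simp only [orient, gridPoint_zero, gridPoint_one]; push_cast; field_simp; ring
  have e3 : orient (gridPoint d i j) (gridPoint d (i + 1) j) x = (d * x 1 - j) / d ^ 2 := by
    simp only [orient, gridPoint_zero, gridPoint_one]; push_cast; field_simp; ring
  have hd2 : (0 : ℝ) < d ^ 2 := by positivity
  constructor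
  · change x ∈ openSimplex {gridPoint d i j, gridPoint d (i + 1) j, gridPoint d i (j + 1)} ↔ _
    rw [mem_openSimplex_iff hpos, e1, e2, e3, div_pos_iff_of_pos_right hd2,
      div_pos_iff_of_pos_right hd2, div_pos_iff_of_pos_right hd2]
    constructor <;> rintro ⟨h1, h2, h3⟩ <;> refine ⟨?_, ?_, ?_⟩ <;> linarith
  · change x ∈ convexHull ℝ
      (({gridPoint d i j, gridPoint d (i + 1) j, gridPoint d i (j + 1)} : Finset Plane) :
          Set Plane) ↔ _
    rw [mem_convexHull_iff_orient hpos, e1, e2, e3, le_div_iff₀ hd2,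
      le_div_iff₀ hd2, le_div_iff₀ hd2, zero_mul]
    constructor <;> rintro ⟨h1, h2, h3⟩ <;> refine ⟨?_, ?_, ?_⟩ <;> linarith

lemma mem_gridTriangle_true (hd : 0 < d) (i j : ℤ) (x : Plane) :
    (x ∈ openSimplex (gridTriangle d (i, j, true)) ↔
      d * x 0 < i + 1 ∧ d * x 1 < j + 1 ∧ i + j + 1 < d * x 0 + d * x 1) ∧
    (x ∈ convexHull ℝ (gridTriangle d (i, j, true) : Set Plane) ↔
      d * x 0 ≤ i + 1 ∧ d * x 1 ≤ j + 1 ∧ i + j + 1 ≤ d * x 0 + d * x 1) := by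
  have hd' : (0 : ℝ) < d := by exact_mod_cast hd
  have ho : orient (gridPoint d (i + 1) (j + 1)) (gridPoint d i (j + 1)) (gridPoint d (i + 1) j)
      = 1 / d ^ 2 := by
    simp only [orient, gridPoint_zero, gridPoint_one]; push_cast; field_simp; ring
  have hpos : 0 < orient (gridPoint d (i + 1) (j + 1)) (gridPoint d i (j + 1))
      (gridPoint d (i + 1) j) := by
    rw [ho]; positivity
  have e1 : orient (gridPoint d i (j + 1)) (gridPoint d (i + 1) j) x =
      ((d * x 0 + d * x 1) - (i + j + 1)) / d ^ 2 := by
    simp only [orient, gridPoint_zero, gridPoint_one]; push_cast; field_simp; ring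
  have e2 : orient (gridPoint d (i + 1) j) (gridPoint d (i + 1) (j + 1)) x =
      (i + 1 - d * x 0) / d ^ 2 := by
    simp only [orient, gridPoint_zero, gridPoint_one]; push_cast; field_simp; ring
  have e3 : orient (gridPoint d (i + 1) (j + 1)) (gridPoint d i (j + 1)) x =
      (j + 1 - d * x 1) / d ^ 2 := by
    simp only [orient, gridPoint_zero, gridPoint_one]; push_cast; field_simp; ring
  have hd2 : (0 : ℝ) < d ^ 2 := by positivity
  constructor
  · change x ∈ openSimplex {gridPoint d (i + 1) (j + 1), gridPoint d i (j + 1),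
        gridPoint d (i + 1) j} ↔ _
    rw [mem_openSimplex_iff hpos, e1, e2, e3, div_pos_iff_of_pos_right hd2,
      div_pos_iff_of_pos_right hd2, div_pos_iff_of_pos_right hd2]
    constructor <;> rintro ⟨h1, h2, h3⟩ <;> refine ⟨?_, ?_, ?_⟩ <;> linarith
  · change x ∈ convexHull ℝ (({gridPoint d (i + 1) (j + 1), gridPoint d i (j + 1),
      gridPoint d (i + 1) j} : Finset Plane) : Set Plane) ↔ _
    rw [mem_convexHull_iff_orient hpos, e1, e2, e3, le_div_iff₀ hd2,
      le_div_iff₀ hd2, le_div_iff₀ hd2, zero_mul]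
    constructor <;> rintro ⟨h1, h2, h3⟩ <;> refine ⟨?_, ?_, ?_⟩ <;> linarith

/-- A point determines the open triangle of the grid that contains it. -/
lemma eq_of_mem_gridTriangle (hd : 0 < d) {c : ℤ × ℤ × Bool} {x : Plane}
    (h : x ∈ openSimplex (gridTriangle d c)) :
    c.1 = ⌊(d : ℝ) * x 0⌋ ∧ c.2.1 = ⌊(d : ℝ) * x 1⌋ ∧
      (c.2.2 = true ↔ (c.1 : ℝ) + c.2.1 + 1 < d * x 0 + d * x 1) := by
  obtain ⟨i, j, b⟩ := c
  cases b
  · obtain ⟨h1, h2, h3⟩ := (mem_gridTriangle_false hd i j x).1.1 h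
    refine ⟨(Int.floor_eq_iff.2 ⟨?_, ?_⟩).symm, (Int.floor_eq_iff.2 ⟨?_, ?_⟩).symm, ?_⟩
    iterate 4 (dsimp only; linarith)
    simp only [Bool.false_eq_true, false_iff, not_lt]; linarith
  · obtain ⟨h1, h2, h3⟩ := (mem_gridTriangle_true hd i j x).1.1 h
    refine ⟨(Int.floor_eq_iff.2 ⟨?_, ?_⟩).symm, (Int.floor_eq_iff.2 ⟨?_, ?_⟩).symm, ?_⟩
    iterate 4 (dsimp only; linarith)
    simp only [true_iff]; linarith

lemma exists_abs_lt_of_isBounded {B : Set Plane} (hB : Bornology.IsBounded B) :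
    ∃ M : ℕ, ∀ x ∈ B, ∀ i, |x i| < M := by
  obtain ⟨C, hC⟩ := hB.exists_norm_le
  obtain ⟨M, hM⟩ := exists_nat_gt C
  exact ⟨M, fun x hx i => ((norm_le_pi_norm x i).trans (hC x hx)).trans_lt hM⟩

/-- Grid triangles tile a large square around a bounded set. -/
lemma exists_tiling_superset (hd : 0 < d) {B : Set Plane} (hB : Bornology.IsBounded B) :
    ∃ S T, IsTiling d S T ∧ B ⊆ interior S := by
  classical
  have hd' : (0 : ℝ) < d := by exact_mod_cast hd
  obtain ⟨M, hM⟩ := exists_abs_lt_of_isBounded hB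
  let N : ℤ := d * M
  let I : Finset (ℤ × ℤ × Bool) := Finset.Ico (-N) N ×ˢ (Finset.Ico (-N) N ×ˢ Finset.univ)
  refine ⟨_, I.image (gridTriangle d), ⟨?_, ?_, rfl⟩, ?_⟩
  · intro t ht
    obtain ⟨c, -, rfl⟩ := Finset.mem_image.1 ht
    exact gridTriangle_minimal hd c
  · intro s hs t ht hne
    obtain ⟨c, -, rfl⟩ := Finset.mem_image.1 hs
    obtain ⟨c', -, rfl⟩ := Finset.mem_image.1 ht
    refine Set.disjoint_left.2 fun x hx hx' => hne ?_
    obtain ⟨h1, h2, h3⟩ := eq_of_mem_gridTriangle hd hx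
    obtain ⟨g1, g2, g3⟩ := eq_of_mem_gridTriangle hd hx'
    have e1 : c.1 = c'.1 := h1.trans g1.symm
    have e2 : c.2.1 = c'.2.1 := h2.trans g2.symm
    have e3 : c.2.2 = c'.2.2 := by
      rw [Bool.eq_iff_iff, h3, g3, e1, e2]
    rw [Prod.ext e1 (Prod.ext e2 e3)]
  · have hbox : IsOpen {x : Plane | ∀ i, |x i| < M} := by
      have : {x : Plane | ∀ i, |x i| < M} = ⋂ i, {x : Plane | |x i| < M} := by ext; simp
      rw [this]
      exact isOpen_iInter_of_finite fun i => isOpen_lt (by fun_prop) continuous_const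
    refine Set.Subset.trans (fun x hx => hM x hx) (interior_maximal (t :=
        {x : Plane | ∀ i, |x i| < M}) ?_ hbox)
    intro x hx
    have hfl : ∀ k, ⌊(d : ℝ) * x k⌋ ∈ Finset.Ico (-N) N := by
      intro k
      have h1 := abs_lt.1 (hx k)
      rw [Finset.mem_Ico, Int.le_floor, Int.floor_lt]
      simp only [N]; push_cast
      constructor <;> nlinarith
    have f0 := Int.floor_le ((d : ℝ) * x 0)
    have f1 := Int.floor_le ((d : ℝ) * x 1)
    have l0 := Int.lt_floor_add_one ((d : ℝ) * x 0)
    have l1 := Int.lt_floor_add_one ((d : ℝ) * x 1)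
    rcases le_total ((d : ℝ) * x 0 + d * x 1) (⌊(d : ℝ) * x 0⌋ + ⌊(d : ℝ) * x 1⌋ + 1) with h | h
    · refine mem_biUnion (x := gridTriangle d (⌊(d : ℝ) * x 0⌋, ⌊(d : ℝ) * x 1⌋, false)) ?_ ?_
      · exact Finset.mem_image_of_mem _ (by simp only [I, Finset.mem_product, hfl, Finset.mem_univ,
            and_self])
      · exact (mem_gridTriangle_false hd _ _ x).2.2 ⟨f0, f1, h⟩
    · refine mem_biUnion (x := gridTriangle d (⌊(d : ℝ) * x 0⌋, ⌊(d : ℝ) * x 1⌋, true)) ?_ ?_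
      · exact Finset.mem_image_of_mem _ (by simp only [I, Finset.mem_product, hfl, Finset.mem_univ,
            and_self])
      · exact (mem_gridTriangle_true hd _ _ x).2.2 ⟨l0.le, l1.le, h⟩

lemma finite_lattice_inter (hd : 0 < d) {B : Set Plane} (hB : Bornology.IsBounded B) :
    (lattice d ∩ B).Finite := by
  have hd' : (0 : ℝ) < d := by exact_mod_cast hd
  obtain ⟨M, hM⟩ := exists_abs_lt_of_isBounded hB
  let N : ℤ := d * M
  refine ((Set.finite_Icc (-N) N).prod (Set.finite_Icc (-N) N)).image
    (fun c : ℤ × ℤ => gridPoint d c.1 c.2) |>.subset ?_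
  rintro x ⟨hx, hxB⟩
  obtain ⟨i, hi⟩ := hx 0
  obtain ⟨j, hj⟩ := hx 1
  have hb : ∀ (k : Fin 2) (n : ℤ), (d : ℝ) * x k = n → n ∈ Icc (-N) N := by
    intro k n hn
    have h1 := abs_lt.1 (hM x hxB k)
    have : -((d : ℝ) * M) ≤ n ∧ (n : ℝ) ≤ d * M := by
      rw [← hn]; constructor <;> nlinarith
    refine ⟨?_, ?_⟩
    · have := this.1; simp only [N]; exact_mod_cast this
    · have := this.2; simp only [N]; exact_mod_cast this
  refine ⟨(i, j), ⟨hb 0 i hi, hb 1 j hj⟩, plane_ext ?_ ?_⟩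
  · simp; rw [← hi]; field_simp
  · simp; rw [← hj]; field_simp

lemma isClosed_lattice (d : ℕ) : IsClosed (lattice d) := by
  have : lattice d = ⋂ i, (fun x : Plane => (d : ℝ) * x i) ⁻¹' (Set.range ((↑) : ℤ → ℝ)) := by
    ext x
    simp only [lattice, mem_iInter, mem_preimage, mem_range]
    exact forall_congr' fun i => exists_congr fun k => eq_comm
  rw [this]
  exact isClosed_iInter fun i =>
      Int.isClosedEmbedding_coe_real.isClosed_range.preimage (by fun_prop)

/-- A regular closed set bounded by primitive segments has a minimal tiling: insert the boundary
segments into a tiling of a large square and keep the triangles inside. -/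
lemma exists_tiling_of_frontier (hd : 0 < d) (hc : IsClosed P) (hb : Bornology.IsBounded P)
    (hreg : P ⊆ closure (interior P)) (E : Finset (Plane × Plane))
    (hE : ∀ e ∈ E, IsPrimitive d e.1 e.2) (hEP : ∀ e ∈ E, openSegment ℝ e.1 e.2 ⊆ P)
    (hfr : ∀ x ∈ frontier P, x ∈ lattice d ∨ ∃ e ∈ E, x ∈ openSegment ℝ e.1 e.2)
    (hcross : ∀ e ∈ E, ∀ f ∈ E, e = f ∨ e = f.swap ∨
      Disjoint (openSegment ℝ e.1 e.2) (openSegment ℝ f.1 f.2)) :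
    ∃ T, IsTiling d P T := by
  classical
  obtain ⟨S, T₀, hT₀, hPS⟩ := exists_tiling_superset hd hb
  obtain ⟨T, h1, h2⟩ := hT₀.exists_insert_edges hd E hE
    (fun _ _ e he => Or.inr ((hEP e he).trans hPS)) hcross
  have hT := isTiling_of_flips hd hT₀ h1
  have hsub : ∀ t ∈ T, (openSimplex t ∩ P).Nonempty → openSimplex t ⊆ P := by
    intro t ht hmeet
    refine openSimplex_subset_of_frontier (Set.disjoint_left.2 fun z hz hzf => ?_) hmeet
    rcases hfr z hzf with h3 | ⟨e, he, h3⟩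
    · exact (hT.minimal t ht).not_mem_lattice hz h3
    · exact Set.disjoint_left.1 (hT.disjoint_edge ht (hE e he).2.2.1 (h2 e he)) h3 hz
  let T' : Finset (Finset Plane) := T.filter fun t : Finset Plane => (openSimplex t ∩ P).Nonempty
  refine ⟨T', ⟨fun t ht => hT.minimal t (Finset.mem_filter.1 ht).1,
    fun s hs t ht => hT.disjoint s (Finset.mem_filter.1 hs).1 t (Finset.mem_filter.1 ht).1, ?_⟩⟩
  apply Set.Subset.antisymm
  · refine iUnion₂_subset fun t ht => ?_
    obtain ⟨ht1, ht2⟩ := Finset.mem_filter.1 ht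
    rw [← closure_openSimplex]
    exact closure_minimal (hsub t ht1 ht2) hc
  · have hcl : IsClosed (⋃ t ∈ T', convexHull ℝ (t : Set Plane)) :=
      Set.Finite.isClosed_biUnion (Finset.finite_toSet _) fun t _ => isClosed_hull t
    refine hreg.trans (closure_minimal (fun x hx => ?_) hcl)
    rw [← hcl.closure_eq, mem_closure_iff]
    intro V hV hxV
    obtain ⟨t, ht, y, hyt, hyV, hyP⟩ := hT.exists_open_inter (hV.inter isOpen_interior)
      ⟨x, ⟨hxV, hx⟩, interior_subset (hPS (interior_subset hx))⟩
    exact ⟨y, hyV, mem_biUnion (x := t) (Finset.mem_filter.2 ⟨ht, y, hyt, interior_subset hyP⟩)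
      (openSimplex_subset_convexHull t hyt)⟩

end

section

/-! ### Polygons with lattice vertices -/

variable {d : ℕ} {P : Set Plane} {T T' T₀ : Finset (Finset Plane)}

lemma IsPolygon.isCompact (hP : IsPolygon P) : IsCompact P := by
  obtain ⟨𝒯, -, -, rfl⟩ := hP
  exact 𝒯.finite_toSet.isCompact_biUnion fun s _ => isCompact_hull s

lemma IsPolygon.subset_closure_interior (hP : IsPolygon P) : P ⊆ closure (interior P) := by
  obtain ⟨𝒯, -, h, rfl⟩ := hP
  refine iUnion₂_subset fun s hs => ?_
  refine (hull_subset_closure s).trans (closure_mono (interior_maximal ?_ (h s hs).isOpen))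
  exact (openSimplex_subset_convexHull s).trans
    (subset_biUnion_of_mem (u := fun s : Finset Plane => convexHull ℝ (s : Set Plane)) hs)

lemma smul_eq_of_smul_eq {a b : ℝ} {x y : Plane} (ha : a ≠ 0) (h : a • x = b • y) :
    x = (b / a) • y := by
  rw [div_eq_inv_mul, mul_smul, ← h, smul_smul, inv_mul_cancel₀ ha, one_smul]

/-- Following the boundary from a point that is not a vertex in the direction of the boundary,
one meets a lattice point before leaving the boundary. -/
lemma exists_lattice_on_ray (hb : Bornology.IsBounded P) (hc : IsClosed P)
    (hv : ∀ p ∈ vertices P, p ∈ lattice d) {z u : Plane} (hzl : z ∉ lattice d) (hu : u ≠ 0)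
    (hloc : ∀ᶠ x in 𝓝 z, x ∈ frontier P ↔ ∃ t : ℝ, x = z + t • u) :
    ∃ s : ℝ, 0 < s ∧ z + s • u ∈ lattice d ∧
      ∀ r, 0 ≤ r → r < s → z + r • u ∈ frontier P ∧ z + r • u ∉ lattice d := by
  have hcont : Continuous fun r : ℝ => z + r • u := by fun_prop
  have hfP : frontier P ⊆ P := hc.frontier_subset
  let S : Set ℝ := {r | 0 ≤ r ∧ ¬ (z + r • u ∈ frontier P ∧ z + r • u ∉ lattice d)}
  have hSne : S.Nonempty := by
    obtain ⟨C, hC⟩ := hb.exists_norm_le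
    have hun : 0 < ‖u‖ := norm_pos_iff.2 hu
    refine ⟨(|C| + ‖z‖ + 1) / ‖u‖, by positivity, fun h => ?_⟩
    have h1 := hC _ (hfP h.1)
    have h2 := norm_sub_le (z + ((|C| + ‖z‖ + 1) / ‖u‖) • u) z
    rw [add_sub_cancel_left, norm_smul, Real.norm_of_nonneg (by positivity),
        div_mul_cancel₀ _ hun.ne'] at h2
    linarith [le_abs_self C]
  have hSb : BddBelow S := ⟨0, fun r hr => hr.1⟩
  set s := sInf S with hs
  have hgood : ∀ r, 0 ≤ r → r < s → z + r • u ∈ frontier P ∧ z + r • u ∉ lattice d := by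
    intro r hr0 hrs
    by_contra h
    exact absurd (csInf_le hSb (show r ∈ S from ⟨hr0, h⟩)) (not_le.2 hrs)
  -- around a point of the ray where the boundary is locally the line, the infimum is not attained
  have hgap : ∀ r₀ : ℝ, z + r₀ • u ∉ lattice d →
      (∀ᶠ x in 𝓝 (z + r₀ • u), x ∈ frontier P ↔ ∃ t : ℝ, x = z + r₀ • u + t • u) →
      ∃ δ > 0, ∀ r, r₀ ≤ r → r < r₀ + δ → r ∉ S := by
    intro r₀ hl h
    have h1 : ∀ᶠ r in 𝓝 r₀, z + r • u ∈ frontier P ∧ z + r • u ∉ lattice d := by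
      filter_upwards [hcont.continuousAt.eventually h,
        hcont.continuousAt.eventually ((isClosed_lattice d).isOpen_compl.mem_nhds hl)] with r a b
      exact ⟨a.2 ⟨r - r₀, by module⟩, b⟩
    obtain ⟨δ, hδ, hδ'⟩ := Metric.eventually_nhds_iff.1 h1
    refine ⟨δ, hδ, fun r a b hrS => hrS.2 (hδ' ?_)⟩
    rw [Real.dist_eq, abs_lt]; constructor <;> linarith
  have hspos : 0 < s := by
    obtain ⟨δ, hδ, hδ'⟩ := hgap 0 (by simpa using hzl) (by simpa using hloc)
    refine hδ.trans_le (le_csInf hSne fun r hr => ?_)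
    by_contra! hlt
    exact hδ' r hr.1 (by linarith) hr
  have htend : Filter.Tendsto (fun r : ℝ => z + r • u) (𝓝[<] s) (𝓝 (z + s • u)) :=
    (hcont.tendsto s).mono_left nhdsWithin_le_nhds
  have hev : ∀ᶠ r in 𝓝[<] s, z + r • u ∈ frontier P := by
    filter_upwards [Ioo_mem_nhdsLT hspos] with r hr
    exact (hgood r hr.1.le hr.2).1
  have hsf : z + s • u ∈ frontier P := isClosed_frontier.mem_of_tendsto htend hev
  refine ⟨s, hspos, ?_, hgood⟩
  by_contra hsl
  have hnv : z + s • u ∉ vertices P := fun h => hsl (hv _ h)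
  obtain ⟨u', hu', hloc'⟩ : ∃ u' : Plane, u' ≠ 0 ∧
      ∀ᶠ x in 𝓝 (z + s • u), (x ∈ frontier P ↔ ∃ t : ℝ, x = z + s • u + t • u') := by
    by_contra h
    exact hnv ⟨hsf, h⟩
  obtain ⟨r, ⟨hr1, hr2⟩, hr3⟩ :=
      ((htend.eventually hloc').and hev |>.and self_mem_nhdsWithin).exists
  obtain ⟨t, ht⟩ := hr1.1 hr2
  have hrs : r < s := hr3
  have h1 : (r - s) • u = t • u' := by
    have : z + r • u - (z + s • u) = t • u' := by rw [ht]; abel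
    rw [← this]; module
  have ht0 : t ≠ 0 := by
    rintro rfl
    rw [zero_smul] at h1
    rcases smul_eq_zero.1 h1 with h | h
    · linarith
    · exact hu h
  have hu1 := smul_eq_of_smul_eq ht0 h1.symm
  have hu2 := smul_eq_of_smul_eq (sub_ne_zero.2 hrs.ne) h1
  obtain ⟨δ, hδ, hδ'⟩ := hgap s hsl (by
    filter_upwards [hloc'] with x hx
    rw [hx]
    constructor
    · rintro ⟨a, rfl⟩
      exact ⟨a * ((r - s) / t), by rw [mul_smul, ← hu1]⟩
    · rintro ⟨a, rfl⟩
      exact ⟨a * (t / (r - s)), by rw [mul_smul, ← hu2]⟩)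
  obtain ⟨r', hr'S, hr'⟩ := exists_lt_of_csInf_lt hSne (show sInf S < s + δ by linarith)
  exact hδ' r' (csInf_le hSb hr'S) hr' hr'S

/-- A boundary point of a polygon with lattice vertices is a lattice point or lies on a primitive
segment in the boundary. -/
lemma exists_frontier_segment (hb : Bornology.IsBounded P) (hc : IsClosed P)
    (hv : ∀ p ∈ vertices P, p ∈ lattice d) {z : Plane} (hz : z ∈ frontier P)
    (hzl : z ∉ lattice d) : ∃ v w, IsPrimitive d v w ∧ openSegment ℝ v w ⊆ frontier P ∧
      z ∈ openSegment ℝ v w := by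
  obtain ⟨u, hu, hloc⟩ : ∃ u : Plane, u ≠ 0 ∧
      ∀ᶠ x in 𝓝 z, (x ∈ frontier P ↔ ∃ t : ℝ, x = z + t • u) := by
    by_contra h
    exact hzl (hv _ ⟨hz, h⟩)
  obtain ⟨a, ha, hal, ha'⟩ := exists_lattice_on_ray hb hc hv hzl hu hloc
  obtain ⟨b, hb, hbl, hb'⟩ := exists_lattice_on_ray hb hc hv hzl (neg_ne_zero.2 hu) (by
    filter_upwards [hloc] with x hx
    rw [hx]
    constructor
    · rintro ⟨t, rfl⟩; exact ⟨-t, by simp⟩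
    · rintro ⟨t, rfl⟩; exact ⟨-t, by simp⟩)
  have hab : 0 < a + b := by linarith
  have hon : ∀ x ∈ openSegment ℝ (z + b • -u) (z + a • u), x ∈ frontier P ∧ x ∉ lattice d := by
    intro x hx
    obtain ⟨t, ht0, ht1, rfl⟩ := mem_openSegment_iff.1 hx
    have e : (1 - t) • (z + b • -u) + t • (z + a • u) = z + (t * (a + b) - b) • u := by module
    rcases le_total 0 (t * (a + b) - b) with h | h
    · rw [e]
      exact ha' _ h (by nlinarith)
    · rw [e, show z + (t * (a + b) - b) • u = z + (b - t * (a + b)) • -u by module]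
      exact hb' _ (by linarith) (by nlinarith)
  refine ⟨z + b • -u, z + a • u, ⟨hbl, hal, ?_, Set.disjoint_left.2 fun x hx => (hon x hx).2⟩,
    fun x hx => (hon x hx).1, ?_⟩
  · intro h
    have : (a + b) • u = 0 := by
      have : (a + b) • u = (z + a • u) - (z + b • -u) := by module
      rw [this, h, sub_self]
    rcases smul_eq_zero.1 this with h | h
    · linarith
    · exact hu h
  · refine mem_openSegment_iff.2 ⟨b / (a + b), by positivity, ?_, ?_⟩
    · rw [div_lt_one hab]; linarith
    · have : (1 - b / (a + b)) = a / (a + b) := by field_simp; ring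
      rw [this]
      refine plane_ext ?_ ?_ <;>
        simp only [Pi.add_apply, Pi.smul_apply, smul_eq_mul, Pi.neg_apply] <;> field_simp <;> ring

lemma exists_smul_eq_of_openSegment {F : Set Plane} {v w x u : Plane} (hx : x ∈ openSegment ℝ v w)
    (hsub : openSegment ℝ v w ⊆ F)
    (hloc : ∀ᶠ z in 𝓝 x, z ∈ F ↔ ∃ t : ℝ, z = x + t • u) : ∃ c : ℝ, w - v = c • u := by
  obtain ⟨t, ht0, ht1, rfl⟩ := mem_openSegment_iff.1 hx
  have h1 := (tendsto_combo ((1 - t) • v + t • w) w).eventually hloc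
  obtain ⟨ε, h2, h3⟩ := (h1.and (Ioo_mem_nhdsGT (show (0 : ℝ) < 1 by norm_num))).exists
  obtain ⟨c, hc⟩ := h2.1 (hsub (mem_openSegment_iff.2 ⟨t + ε * (1 - t),
    by nlinarith [h3.1, mul_pos h3.1 (by linarith : 0 < 1 - t)], by nlinarith [h3.2], by module⟩))
  have h4 : (ε * (1 - t)) • (w - v) = c • u := by
    have : (1 - ε) • ((1 - t) • v + t • w) + ε • w - ((1 - t) • v + t • w) = c • u := by
      rw [hc]; abel
    rw [← this]; module
  exact ⟨_, smul_eq_of_smul_eq (mul_pos h3.1 (by linarith)).ne' h4⟩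

/-- A polygon with vertices in `𝓛_d` has a tiling by `d`-minimal triangles. -/
theorem IsPolygon.exists_tiling (hd : 0 < d) (hP : IsPolygon P)
    (hv : ∀ p ∈ vertices P, p ∈ lattice d) : ∃ T, IsTiling d P T := by
  classical
  have hb := hP.isCompact.isBounded
  have hc := hP.isCompact.isClosed
  have hfP : frontier P ⊆ P := hc.frontier_subset
  have hfin : {e : Plane × Plane | IsPrimitive d e.1 e.2 ∧
      openSegment ℝ e.1 e.2 ⊆ frontier P}.Finite := by
    refine ((finite_lattice_inter hd hb).prod (finite_lattice_inter hd hb)).subset ?_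
    rintro ⟨v, w⟩ ⟨h1, h2⟩
    have h3 : segment ℝ v w ⊆ P := by
      rw [← closure_openSegment]
      exact closure_minimal (h2.trans hfP) hc
    exact ⟨⟨h1.1, h3 (left_mem_segment ℝ v w)⟩, ⟨h1.2.1, h3 (right_mem_segment ℝ v w)⟩⟩
  refine exists_tiling_of_frontier hd hc hb hP.subset_closure_interior hfin.toFinset
    (fun e he => (hfin.mem_toFinset.1 he).1)
    (fun e he => (hfin.mem_toFinset.1 he).2.trans hfP) ?_ ?_
  · intro x hx
    by_cases hxl : x ∈ lattice d
    · exact Or.inl hxl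
    · obtain ⟨v, w, h1, h2, h3⟩ := exists_frontier_segment hb hc hv hx hxl
      exact Or.inr ⟨(v, w), hfin.mem_toFinset.2 ⟨h1, h2⟩, h3⟩
  · intro e he f hf
    obtain ⟨e1, e2⟩ := hfin.mem_toFinset.1 he
    obtain ⟨f1, f2⟩ := hfin.mem_toFinset.1 hf
    by_cases hdis : Disjoint (openSegment ℝ e.1 e.2) (openSegment ℝ f.1 f.2)
    · exact Or.inr (Or.inr hdis)
    · obtain ⟨x, hx, hx'⟩ := Set.not_disjoint_iff.1 hdis
      obtain ⟨u, hu, hloc⟩ : ∃ u : Plane, u ≠ 0 ∧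
          ∀ᶠ z in 𝓝 x, (z ∈ frontier P ↔ ∃ t : ℝ, z = x + t • u) := by
        by_contra h
        exact e1.not_mem hx (hv _ ⟨e2 hx, h⟩)
      obtain ⟨a, ha⟩ := exists_smul_eq_of_openSegment hx e2 hloc
      obtain ⟨b, hb⟩ := exists_smul_eq_of_openSegment hx' f2 hloc
      have hcol : orient f.1 f.2 e.1 = 0 := by
        obtain ⟨s, -, -, hs⟩ := mem_openSegment_iff.1 hx
        obtain ⟨t, -, -, ht⟩ := mem_openSegment_iff.1 hx'
        have g1 : f.2 = f.1 + b • u := by rw [← hb]; abel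
        have g2 : e.1 = f.1 + (t * b - s * a) • u := by
          have : e.1 = f.1 + t • (f.2 - f.1) - s • (e.2 - e.1) := by
            have : (1 - s) • e.1 + s • e.2 = (1 - t) • f.1 + t • f.2 := hs.trans ht.symm
            have h5 : e.1 = ((1 - s) • e.1 + s • e.2) - s • (e.2 - e.1) := by module
            conv_lhs => rw [h5, this]
            module
          rw [this, ha, hb]; module
        rw [g2, g1]
        simp only [orient, Pi.add_apply, Pi.smul_apply, smul_eq_mul]; ring
      rcases e1.eq_of_collinear f1 hx hx' hcol with h | h
      · exact Or.inl (Prod.ext h.1 h.2)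
      · exact Or.inr (Or.inl (Prod.ext h.1 h.2))

end

/-! ### Cutting simplices along rational lines -/

/-- A rational affine functional `(a, b, c)`, that is `x ↦ a x₀ + b x₁ + c`. -/
def evalAff (l : ℚ × ℚ × ℚ) (x : Plane) : ℝ := l.1 * x 0 + l.2.1 * x 1 + l.2.2

/-- The point `p` has rational coordinates. -/
def IsRat (p : Plane) : Prop := ∀ i, ∃ q : ℚ, p i = q

lemma evalAff_sum (l : ℚ × ℚ × ℚ) (s : Finset Plane) (w : Plane → ℝ) (h : ∑ p ∈ s, w p = 1) :
    evalAff l (∑ p ∈ s, w p • p) = ∑ p ∈ s, w p * evalAff l p := by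
  have e : ∀ i, (∑ p ∈ s, w p • p) i = ∑ p ∈ s, w p * p i := by
    intro i; rw [Finset.sum_apply]; rfl
  have h2 : ∑ p ∈ s, w p * evalAff l p =
      l.1 * ∑ p ∈ s, w p * p 0 + l.2.1 * ∑ p ∈ s, w p * p 1 + (∑ p ∈ s, w p) * l.2.2 := by
    rw [Finset.mul_sum, Finset.mul_sum, Finset.sum_mul, ← Finset.sum_add_distrib,
      ← Finset.sum_add_distrib]
    exact Finset.sum_congr rfl fun p _ => by unfold evalAff; ring
  rw [h2, h, one_mul, evalAff, e, e]

lemma evalAff_combo (l : ℚ × ℚ × ℚ) (p q : Plane) (t : ℝ) :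
    evalAff l ((1 - t) • p + t • q) = (1 - t) * evalAff l p + t * evalAff l q := by
  simp only [evalAff, Pi.add_apply, Pi.smul_apply, smul_eq_mul]; ring

lemma IsRat.evalAff {p : Plane} (hp : IsRat p) (l : ℚ × ℚ × ℚ) : ∃ q : ℚ, evalAff l p = q := by
  obtain ⟨a, ha⟩ := hp 0
  obtain ⟨b, hb⟩ := hp 1
  exact ⟨l.1 * a + l.2.1 * b + l.2.2, by rw [FacetMaps.evalAff, ha, hb]; push_cast; ring⟩

lemma IsRat.combo {p q : Plane} (hp : IsRat p) (hq : IsRat q) (t : ℚ) :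
    IsRat ((1 - (t : ℝ)) • p + (t : ℝ) • q) := by
  intro i
  obtain ⟨a, ha⟩ := hp i
  obtain ⟨b, hb⟩ := hq i
  exact ⟨(1 - t) * a + t * b, by
    simp only [Pi.add_apply, Pi.smul_apply, smul_eq_mul]
    rw [ha, hb]; push_cast; ring⟩

lemma mem_openSimplex_insert {p : Plane} {R : Finset Plane} (hp : p ∉ R) (y : Plane) :
    y ∈ openSimplex (insert p R) ↔ ∃ (α : ℝ) (w : Plane → ℝ), 0 < α ∧ (∀ r ∈ R, 0 < w r) ∧
      α + ∑ r ∈ R, w r = 1 ∧ α • p + ∑ r ∈ R, w r • r = y := by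
  constructor
  · rintro ⟨w, h0, h1, h2⟩
    rw [Finset.sum_insert hp] at h1 h2
    exact ⟨w p, w, h0 p (by simp), fun r hr => h0 r (by simp [hr]), h1, h2⟩
  · rintro ⟨α, w, hα, h0, h1, h2⟩
    have e : ∀ r ∈ R, Function.update w p α r = w r := fun r hr =>
      Function.update_of_ne (ne_of_mem_of_not_mem hr hp) _ _
    refine ⟨Function.update w p α, ?_, ?_, ?_⟩
    · intro r hr
      rcases Finset.mem_insert.1 hr with rfl | hr
      · simpa using hα
      · rw [e r hr]; exact h0 r hr
    · rw [Finset.sum_insert hp, Function.update_self, Finset.sum_congr rfl e, h1]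
    · rw [Finset.sum_insert hp, Function.update_self,
        Finset.sum_congr rfl (fun r hr => by rw [e r hr]), h2]

lemma mem_openSimplex_insert_insert {p q : Plane} {R : Finset Plane} (hp : p ∉ insert q R)
    (hq : q ∉ R) (y : Plane) :
    y ∈ openSimplex (insert p (insert q R)) ↔ ∃ (α β : ℝ) (w : Plane → ℝ), 0 < α ∧ 0 < β ∧
      (∀ r ∈ R, 0 < w r) ∧ α + β + ∑ r ∈ R, w r = 1 ∧ α • p + β • q + ∑ r ∈ R, w r • r = y := by
  rw [mem_openSimplex_insert hp]
  constructor
  · rintro ⟨α, w, hα, h0, h1, h2⟩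
    rw [Finset.sum_insert hq] at h1 h2
    exact ⟨α, w q, w, hα, h0 q (by simp), fun r hr => h0 r (by simp [hr]), by rw [← h1]; ring,
      by rw [← h2]; abel⟩
  · rintro ⟨α, β, w, hα, hβ, h0, h1, h2⟩
    have e : ∀ r ∈ R, Function.update w q β r = w r := fun r hr =>
      Function.update_of_ne (ne_of_mem_of_not_mem hr hq) _ _
    refine ⟨α, Function.update w q β, hα, ?_, ?_, ?_⟩
    · intro r hr
      rcases Finset.mem_insert.1 hr with rfl | hr
      · simpa using hβ
      · rw [e r hr]; exact h0 r hr
    · rw [Finset.sum_insert hq, Function.update_self, Finset.sum_congr rfl e, ← h1]; ring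
    · rw [Finset.sum_insert hq, Function.update_self,
        Finset.sum_congr rfl (fun r hr => by rw [e r hr]), ← h2]; abel

/-- Affine independence, for a vertex set with two distinguished elements. -/
lemma affineIndependent_insert_insert {p q : Plane} {R : Finset Plane} (hp : p ∉ insert q R)
    (hq : q ∉ R) :
    AffineIndependent ℝ ((↑) : (insert p (insert q R) : Finset Plane) → Plane) ↔
      ∀ (α β : ℝ) (w : Plane → ℝ), α + β + ∑ r ∈ R, w r = 0 →
        α • p + β • q + ∑ r ∈ R, w r • r = 0 → α = 0 ∧ β = 0 ∧ ∀ r ∈ R, w r = 0 := by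
  rw [affineIndependent_finset_iff]
  constructor
  · intro h α β w h0 h1
    let w' : Plane → ℝ := Function.update (Function.update w q β) p α
    have hpq : q ≠ p := fun h => hp (by simp [h])
    have ep : w' p = α := Function.update_self _ _ _
    have eq : w' q = β := by simp [w', Function.update_of_ne hpq]
    have e : ∀ r ∈ R, w' r = w r := fun r hr => by
      simp only [w']
      rw [Function.update_of_ne (ne_of_mem_of_not_mem (Finset.mem_insert_of_mem hr) hp),
        Function.update_of_ne (ne_of_mem_of_not_mem hr hq)]
    have h2 := h w' (by
        rw [Finset.sum_insert hp, Finset.sum_insert hq, ep, eq, Finset.sum_congr rfl e,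
            ← h0]; ring) (by
        rw [Finset.sum_insert hp, Finset.sum_insert hq, ep, eq,
          Finset.sum_congr rfl (fun r hr => by rw [e r hr]), ← h1]; abel)
    exact ⟨ep ▸ h2 p (by simp), eq ▸ h2 q (by simp), fun r hr => e r hr ▸ h2 r (by simp [hr])⟩
  · intro h w h0 h1
    rw [Finset.sum_insert hp, Finset.sum_insert hq] at h0 h1
    obtain ⟨a, b, c⟩ := h (w p) (w q) w (by rw [← h0]; ring) (by rw [← h1]; abel)
    intro r hr
    rcases Finset.mem_insert.1 hr with rfl | hr
    · exact a
    · rcases Finset.mem_insert.1 hr with rfl | hr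
      · exact b
      · exact c r hr

lemma affineIndependent_subset {s t : Finset Plane} (hst : s ⊆ t)
    (h : AffineIndependent ℝ ((↑) : t → Plane)) : AffineIndependent ℝ ((↑) : s → Plane) :=
  h.mono (s := (s : Set Plane)) (t := (t : Set Plane)) hst

/-- A point `x` between two vertices `p`, `q` of a simplex cuts it into the two simplices in which
`q`, respectively `p`, is replaced by `x`, and their common face. -/
lemma bisect {p q x : Plane} {R : Finset Plane} (hp : p ∉ insert q R) (hq : q ∉ R)
    (h : AffineIndependent ℝ ((↑) : (insert p (insert q R) : Finset Plane) → Plane))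
    {t : ℝ} (ht0 : 0 < t) (ht1 : t < 1) (hx : (1 - t) • p + t • q = x) :
    x ∉ insert p (insert q R) ∧
    AffineIndependent ℝ ((↑) : (insert p (insert x R) : Finset Plane) → Plane) ∧
    AffineIndependent ℝ ((↑) : (insert q (insert x R) : Finset Plane) → Plane) ∧
    openSimplex (insert p (insert x R)) ∪ openSimplex (insert q (insert x R)) ∪
      openSimplex (insert x R) = openSimplex (insert p (insert q R)) ∧
    Disjoint (openSimplex (insert p (insert x R))) (openSimplex (insert q (insert x R))) ∧
    Disjoint (openSimplex (insert p (insert x R))) (openSimplex (insert x R)) ∧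
    Disjoint (openSimplex (insert q (insert x R))) (openSimplex (insert x R)) := by
  have hpq : p ≠ q := fun h => hp (by simp [h])
  have hpR : p ∉ R := fun h => hp (by simp [h])
  have h1t : 0 < 1 - t := by linarith
  have hI := (affineIndependent_insert_insert hp hq).1 h
  have hxR : x ∉ R := by
    intro hxR
    have := hI (1 - t) t (fun r => if r = x then -1 else 0) (by
      rw [Finset.sum_ite_eq' R x, if_pos hxR]; ring) (by
      simp only [ite_smul, zero_smul]
      rw [Finset.sum_ite_eq' R x (fun r => (-1 : ℝ) • r), if_pos hxR, hx]; simp)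
    linarith [this.2.1]
  have hxp : x ≠ p := by
    rintro rfl
    have : t • (q - x) = 0 := by
      have : t • (q - x) = (1 - t) • x + t • q - x := by module
      rw [this, hx, sub_self]
    rcases smul_eq_zero.1 this with h | h
    · linarith
    · exact hpq (sub_eq_zero.1 h).symm
  have hxq : x ≠ q := by
    rintro rfl
    have : (1 - t) • (p - x) = 0 := by
      have : (1 - t) • (p - x) = (1 - t) • p + t • x - x := by module
      rw [this, hx, sub_self]
    rcases smul_eq_zero.1 this with h | h
    · linarith
    · exact hpq (sub_eq_zero.1 h)
  have hpx : p ∉ insert x R := by simp [hxp.symm, hpR]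
  have hqx : q ∉ insert x R := by simp [hxq.symm, hq]
  -- barycentric coordinates with respect to the uncut simplex
  have m1 : ∀ y, y ∈ openSimplex (insert p (insert x R)) ↔ ∃ (α β : ℝ) (w : Plane → ℝ), 0 < α ∧
      0 < β ∧ (∀ r ∈ R, 0 < w r) ∧ α + β + ∑ r ∈ R, w r = 1 ∧
      α • p + β • q + ∑ r ∈ R, w r • r = y ∧ β * (1 - t) < α * t := by
    intro y
    rw [mem_openSimplex_insert_insert hpx hxR]
    constructor
    · rintro ⟨α, γ, w, hα, hγ, h0, h1, h2⟩
      refine ⟨α + γ * (1 - t), γ * t, w, by positivity, by positivity, h0, by linarith, ?_, ?_⟩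
      · rw [← h2, ← hx]; module
      · have := mul_pos hα ht0; linarith
    · rintro ⟨α, β, w, hα, hβ, h0, h1, h2, h3⟩
      refine ⟨α - β / t * (1 - t), β / t, w, ?_, by positivity, h0, ?_, ?_⟩
      · rw [div_mul_eq_mul_div, sub_pos, div_lt_iff₀ ht0]; exact h3
      · have : β / t * t = β := by field_simp
        linear_combination h1 + this
      · rw [← h2, ← hx]
        have : β / t * t = β := by field_simp
        have e : (β / t) • ((1 - t) • p + t • q) = (β / t * (1 - t)) • p + β • q := by
          rw [smul_add, smul_smul, smul_smul, this]
        rw [e]; module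
  have m2 : ∀ y, y ∈ openSimplex (insert q (insert x R)) ↔ ∃ (α β : ℝ) (w : Plane → ℝ), 0 < α ∧
      0 < β ∧ (∀ r ∈ R, 0 < w r) ∧ α + β + ∑ r ∈ R, w r = 1 ∧
      α • p + β • q + ∑ r ∈ R, w r • r = y ∧ α * t < β * (1 - t) := by
    intro y
    rw [mem_openSimplex_insert_insert hqx hxR]
    constructor
    · rintro ⟨β, γ, w, hβ, hγ, h0, h1, h2⟩
      refine ⟨γ * (1 - t), β + γ * t, w, by positivity, by positivity, h0, by linarith, ?_, ?_⟩
      · rw [← h2, ← hx]; module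
      · have := mul_pos hβ h1t; linarith
    · rintro ⟨α, β, w, hα, hβ, h0, h1, h2, h3⟩
      refine ⟨β - α / (1 - t) * t, α / (1 - t), w, ?_, by positivity, h0, ?_, ?_⟩
      · rw [div_mul_eq_mul_div, sub_pos, div_lt_iff₀ h1t]; exact h3
      · have : α / (1 - t) * (1 - t) = α := by field_simp
        linear_combination h1 + this
      · rw [← h2, ← hx]
        have : α / (1 - t) * (1 - t) = α := by field_simp
        have e : (α / (1 - t)) • ((1 - t) • p + t • q) = α • p + (α / (1 - t) * t) • q := by
          rw [smul_add, smul_smul, smul_smul, this]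
        rw [e]; module
  have m3 : ∀ y, y ∈ openSimplex (insert x R) ↔ ∃ (α β : ℝ) (w : Plane → ℝ), 0 < α ∧
      0 < β ∧ (∀ r ∈ R, 0 < w r) ∧ α + β + ∑ r ∈ R, w r = 1 ∧
      α • p + β • q + ∑ r ∈ R, w r • r = y ∧ α * t = β * (1 - t) := by
    intro y
    rw [mem_openSimplex_insert hxR]
    constructor
    · rintro ⟨γ, w, hγ, h0, h1, h2⟩
      refine ⟨γ * (1 - t), γ * t, w, by positivity, by positivity, h0, by linarith, ?_, by ring⟩
      rw [← h2, ← hx]; module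
    · rintro ⟨α, β, w, hα, hβ, h0, h1, h2, h3⟩
      refine ⟨α + β, w, by positivity, h0, h1, ?_⟩
      have e1 : (α + β) * (1 - t) = α := by linarith
      have e2 : (α + β) * t = β := by linarith
      rw [← h2, ← hx, smul_add, smul_smul, smul_smul, e1, e2]
  -- uniqueness of barycentric coordinates
  have uniq : ∀ (α β α' β' : ℝ) (w w' : Plane → ℝ), α + β + ∑ r ∈ R, w r = 1 →
      α' + β' + ∑ r ∈ R, w' r = 1 →
      α • p + β • q + ∑ r ∈ R, w r • r = α' • p + β' • q + ∑ r ∈ R, w' r • r →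
      α = α' ∧ β = β' := by
    intro α β α' β' w w' h1 h1' h2
    have := hI (α - α') (β - β') (fun r => w r - w' r) (by
      rw [Finset.sum_sub_distrib]; linarith) (by
      simp only [sub_smul]
      rw [Finset.sum_sub_distrib]
      have : α • p + β • q + ∑ r ∈ R, w r • r - (α' • p + β' • q + ∑ r ∈ R, w' r • r) = 0 := by
        rw [h2, sub_self]
      rw [← this]; abel)
    exact ⟨by linarith [this.1], by linarith [this.2.1]⟩
  refine ⟨by simp [hxp, hxq, hxR], ?_, ?_, ?_, ?_, ?_, ?_⟩
  · rw [affineIndependent_insert_insert hpx hxR]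
    intro α γ w h0 h1
    obtain ⟨a, b, c⟩ := hI (α + γ * (1 - t)) (γ * t) w (by linarith) (by
      rw [← h1, ← hx]; module)
    have hγ := (mul_eq_zero.1 b).resolve_right ht0.ne'
    rw [hγ] at a
    exact ⟨by linarith, hγ, c⟩
  · rw [affineIndependent_insert_insert hqx hxR]
    intro β γ w h0 h1
    obtain ⟨a, b, c⟩ := hI (γ * (1 - t)) (β + γ * t) w (by linarith) (by
      rw [← h1, ← hx]; module)
    have hγ := (mul_eq_zero.1 a).resolve_right h1t.ne'
    rw [hγ] at b
    exact ⟨by linarith, hγ, c⟩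
  · ext y
    rw [mem_union, mem_union, m1, m2, m3, mem_openSimplex_insert_insert hp hq]
    constructor
    · rintro ((⟨α, β, w, a, b, c, e, f, -⟩ | ⟨α, β, w, a, b, c, e, f, -⟩) | ⟨α, β, w, a, b, c, e,
          f, -⟩) <;>
        exact ⟨α, β, w, a, b, c, e, f⟩
    · rintro ⟨α, β, w, a, b, c, e, f⟩
      rcases lt_trichotomy (α * t) (β * (1 - t)) with g | g | g
      · exact Or.inl (Or.inr ⟨α, β, w, a, b, c, e, f, g⟩)
      · exact Or.inr ⟨α, β, w, a, b, c, e, f, g⟩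
      · exact Or.inl (Or.inl ⟨α, β, w, a, b, c, e, f, g⟩)
  · refine Set.disjoint_left.2 fun y hy hy' => ?_
    obtain ⟨α, β, w, -, -, -, e, f, g⟩ := (m1 y).1 hy
    obtain ⟨α', β', w', -, -, -, e', f', g'⟩ := (m2 y).1 hy'
    obtain ⟨rfl, rfl⟩ := uniq α β α' β' w w' e e' (f.trans f'.symm)
    linarith
  · refine Set.disjoint_left.2 fun y hy hy' => ?_
    obtain ⟨α, β, w, -, -, -, e, f, g⟩ := (m1 y).1 hy
    obtain ⟨α', β', w', -, -, -, e', f', g'⟩ := (m3 y).1 hy'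
    obtain ⟨rfl, rfl⟩ := uniq α β α' β' w w' e e' (f.trans f'.symm)
    linarith
  · refine Set.disjoint_left.2 fun y hy hy' => ?_
    obtain ⟨α, β, w, -, -, -, e, f, g⟩ := (m2 y).1 hy
    obtain ⟨α', β', w', -, -, -, e', f', g'⟩ := (m3 y).1 hy'
    obtain ⟨rfl, rfl⟩ := uniq α β α' β' w w' e e' (f.trans f'.symm)
    linarith

section

/-! ### Triangulations of rational semilinear sets -/

variable {S : Set Plane}

lemma Triangulation.subset (T : Triangulation S) {s : Finset Plane} (hs : s ∈ T.simplices) :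
    openSimplex s ⊆ S := by
  conv_rhs => rw [← T.iUnion_eq]
  exact subset_biUnion_of_mem (u := fun s : Finset Plane => openSimplex s) hs

/-- The trivial triangulation of an open rational simplex. -/
def Triangulation.single (s : Finset Plane) (hne : s.Nonempty)
    (hI : AffineIndependent ℝ ((↑) : s → Plane)) (hr : ∀ p ∈ s, IsRat p) :
    Triangulation (openSimplex s) where
  simplices := {s}
  nonempty := by simpa using hne
  affineIndependent := by
    intro t ht
    rw [Finset.mem_singleton] at ht
    subst ht
    exact hI
  rational := by
    intro t ht
    rw [Finset.mem_singleton] at ht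
    subst ht
    exact hr
  disjoint := by
    intro t ht u hu h
    rw [Finset.mem_singleton] at ht hu
    exact absurd (ht.trans hu.symm) h
  iUnion_eq := by simp

/-- Triangulations of pairwise disjoint sets make up a triangulation of their union. -/
lemma exists_triangulation_biUnion {ι : Type*} (I : Finset ι) (A : ι → Set Plane)
    (hA : ∀ i ∈ I, ∀ j ∈ I, i ≠ j → Disjoint (A i) (A j)) (Q : Finset Plane → Prop)
    (h : ∀ i ∈ I, ∃ T : Triangulation (A i), ∀ u ∈ T.simplices, Q u) :
    ∃ T : Triangulation (⋃ i ∈ I, A i), ∀ u ∈ T.simplices, Q u := by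
  classical
  choose f hf using h
  let g : I → Finset (Finset Plane) := fun i => (f i.1 i.2).simplices
  have hmem : ∀ u, u ∈ I.attach.biUnion g ↔ ∃ i, ∃ hi : i ∈ I, u ∈ (f i hi).simplices := by
    intro u
    simp [g]
  refine ⟨⟨I.attach.biUnion g, ?_, ?_, ?_, ?_, ?_⟩, ?_⟩
  · intro s hs
    obtain ⟨i, hi, hs⟩ := (hmem s).1 hs
    exact (f i hi).nonempty s hs
  · intro s hs
    obtain ⟨i, hi, hs⟩ := (hmem s).1 hs
    exact (f i hi).affineIndependent s hs
  · intro s hs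
    obtain ⟨i, hi, hs⟩ := (hmem s).1 hs
    exact (f i hi).rational s hs
  · intro s hs t ht hne
    obtain ⟨i, hi, hs⟩ := (hmem s).1 hs
    obtain ⟨j, hj, ht⟩ := (hmem t).1 ht
    by_cases hij : i = j
    · subst hij
      exact (f i hi).disjoint s hs t ht hne
    · exact (hA i hi j hj hij).mono ((f i hi).subset hs) ((f j hj).subset ht)
  · ext x
    simp only [mem_iUnion]
    constructor
    · rintro ⟨u, hu, hx⟩
      obtain ⟨i, hi, hu⟩ := (hmem u).1 hu
      exact ⟨i, hi, (f i hi).subset hu hx⟩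
    · rintro ⟨i, hi, hx⟩
      rw [← (f i hi).iUnion_eq] at hx
      simp only [mem_iUnion] at hx
      obtain ⟨u, hu, hx⟩ := hx
      exact ⟨u, (hmem u).2 ⟨i, hi, hu⟩, hx⟩
  · intro u hu
    obtain ⟨i, hi, hu⟩ := (hmem u).1 hu
    exact hf i hi u hu

/-- The functional `l` has constant sign on the open simplex. -/
def ConstSign (l : ℚ × ℚ × ℚ) (s : Finset Plane) : Prop :=
  ∃ σ : SignType, ∀ y ∈ openSimplex s, SignType.sign (evalAff l y) = σ

lemma constSign_of_nonneg {l : ℚ × ℚ × ℚ} {s : Finset Plane} (h : ∀ p ∈ s, 0 ≤ evalAff l p) :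
    ConstSign l s := by
  by_cases h0 : ∃ p ∈ s, 0 < evalAff l p
  · refine ⟨1, ?_⟩
    rintro y ⟨w, hw, h1, rfl⟩
    rw [sign_eq_one_iff, evalAff_sum l s w h1]
    obtain ⟨p, hp, hp0⟩ := h0
    exact Finset.sum_pos' (fun r hr => mul_nonneg (hw r hr).le (h r hr)) ⟨p, hp,
        mul_pos (hw p hp) hp0⟩
  · push Not at h0
    refine ⟨0, ?_⟩
    rintro y ⟨w, hw, h1, rfl⟩
    rw [sign_eq_zero_iff, evalAff_sum l s w h1]
    exact Finset.sum_eq_zero fun r hr => by rw [le_antisymm (h0 r hr) (h r hr), mul_zero]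

lemma constSign_of_nonpos {l : ℚ × ℚ × ℚ} {s : Finset Plane} (h : ∀ p ∈ s, evalAff l p ≤ 0) :
    ConstSign l s := by
  by_cases h0 : ∃ p ∈ s, evalAff l p < 0
  · refine ⟨-1, ?_⟩
    rintro y ⟨w, hw, h1, rfl⟩
    rw [sign_eq_neg_one_iff, evalAff_sum l s w h1]
    obtain ⟨p, hp, hp0⟩ := h0
    exact Finset.sum_neg' (fun r hr => mul_nonpos_of_nonneg_of_nonpos (hw r hr).le (h r hr))
      ⟨p, hp, mul_neg_of_pos_of_neg (hw p hp) hp0⟩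
  · push Not at h0
    refine ⟨0, ?_⟩
    rintro y ⟨w, hw, h1, rfl⟩
    rw [sign_eq_zero_iff, evalAff_sum l s w h1]
    exact Finset.sum_eq_zero fun r hr => by rw [le_antisymm (h r hr) (h0 r hr), mul_zero]

/-- Cut a simplex along the zero line of a functional: as long as two vertices have opposite
signs, bisect the edge between them at the zero. -/
lemma exists_triangulation_cut (l : ℚ × ℚ × ℚ) (s : Finset Plane) (hne : s.Nonempty)
    (hI : AffineIndependent ℝ ((↑) : s → Plane)) (hr : ∀ p ∈ s, IsRat p) :
    ∃ T : Triangulation (openSimplex s), ∀ u ∈ T.simplices, ConstSign l u := by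
  classical
  obtain ⟨n, hn⟩ : ∃ n : ℕ, (s.filter fun p => evalAff l p ≠ 0).card = n := ⟨_, rfl⟩
  induction n using Nat.strong_induction_on generalizing s with
  | _ n ih =>
    by_cases hpos : ∃ p ∈ s, 0 < evalAff l p
    · by_cases hneg : ∃ q ∈ s, evalAff l q < 0
      · obtain ⟨p, hp, hp0⟩ := hpos
        obtain ⟨q, hq, hq0⟩ := hneg
        have hpq : p ≠ q := by rintro rfl; linarith
        obtain ⟨a, ha⟩ := (hr p hp).evalAff l
        obtain ⟨b, hb⟩ := (hr q hq).evalAff l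
        set R := (s.erase p).erase q with hR
        have hqR : q ∉ R := Finset.notMem_erase _ _
        have hs' : insert q R = s.erase p := Finset.insert_erase (Finset.mem_erase.2 ⟨hpq.symm, hq⟩)
        have hpR : p ∉ insert q R := by rw [hs']; exact Finset.notMem_erase _ _
        have hs : s = insert p (insert q R) := by rw [hs', Finset.insert_erase hp]
        have hRs : R ⊆ s := (Finset.erase_subset _ _).trans (Finset.erase_subset _ _)
        set t : ℚ := a / (a - b) with ht
        have htR : (t : ℝ) = evalAff l p / (evalAff l p - evalAff l q) := by
          rw [ha, hb, ht]; push_cast; rfl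
        have hden : 0 < evalAff l p - evalAff l q := by linarith
        have ht0 : (0 : ℝ) < t := by rw [htR]; positivity
        have ht1 : (t : ℝ) < 1 := by rw [htR, div_lt_one hden]; linarith
        obtain ⟨x, hx⟩ : ∃ x : Plane, (1 - (t : ℝ)) • p + (t : ℝ) • q = x := ⟨_, rfl⟩
        have hxr : IsRat x := hx ▸ (hr p hp).combo (hr q hq) t
        have hx0 : evalAff l x = 0 := by
          rw [← hx, evalAff_combo, htR]; field_simp; ring
        rw [hs] at hI
        obtain ⟨b0, b1, b2, b3, b4, b5, b6⟩ := bisect hpR hqR hI ht0 ht1 hx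
        rw [← hs] at b0 b3 hI
        have hratR : ∀ r ∈ R, IsRat r := fun r hr' => hr r (hRs hr')
        -- each piece has fewer vertices off the zero line
        have hlt : ∀ (z : Plane) (A : Finset Plane), z ∈ s → evalAff l z ≠ 0 →
            A ⊆ insert x (s.erase z) →
            (A.filter fun p => evalAff l p ≠ 0).card < n := by
          intro z A hz hz0 hA
          rw [← hn]
          refine Finset.card_lt_card (Finset.ssubset_iff_subset_ne.2 ⟨?_, ?_⟩)
          · intro y hy
            obtain ⟨hy1, hy2⟩ := Finset.mem_filter.1 hy
            rcases Finset.mem_insert.1 (hA hy1) with rfl | hy3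
            · exact absurd hx0 hy2
            · exact Finset.mem_filter.2 ⟨(Finset.mem_erase.1 hy3).2, hy2⟩
          · intro he
            have : z ∈ A.filter fun p => evalAff l p ≠ 0 := by
              rw [he]; exact Finset.mem_filter.2 ⟨hz, hz0⟩
            rcases Finset.mem_insert.1 (hA (Finset.mem_filter.1 this).1) with rfl | h
            · exact hz0 hx0
            · exact (Finset.mem_erase.1 h).1 rfl
        have hRq : ∀ r ∈ R, r ≠ q ∧ r ≠ p := fun r hr' =>
          ⟨(Finset.mem_erase.1 hr').1, (Finset.mem_erase.1 (Finset.mem_erase.1 hr').2).1⟩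
        have t1 := ih _ (hlt q (insert p (insert x R)) hq hq0.ne (by
            intro y hy
            simp only [Finset.mem_insert, Finset.mem_erase] at hy ⊢
            rcases hy with rfl | rfl | hy
            · exact Or.inr ⟨hpq, hp⟩
            · exact Or.inl rfl
            · exact Or.inr ⟨(hRq y hy).1, hRs hy⟩))
          (insert p (insert x R)) (by simp) b1 (by
            intro y hy
            simp only [Finset.mem_insert] at hy
            rcases hy with rfl | rfl | hy
            · exact hr _ hp
            · exact hxr
            · exact hratR _ hy) rfl
        have t2 := ih _ (hlt p (insert q (insert x R)) hp hp0.ne' (by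
            intro y hy
            simp only [Finset.mem_insert, Finset.mem_erase] at hy ⊢
            rcases hy with rfl | rfl | hy
            · exact Or.inr ⟨hpq.symm, hq⟩
            · exact Or.inl rfl
            · exact Or.inr ⟨(hRq y hy).2, hRs hy⟩))
          (insert q (insert x R)) (by simp) b2 (by
            intro y hy
            simp only [Finset.mem_insert] at hy
            rcases hy with rfl | rfl | hy
            · exact hr _ hq
            · exact hxr
            · exact hratR _ hy) rfl
        have t3 := ih _ (hlt q (insert x R) hq hq0.ne (by
            intro y hy
            simp only [Finset.mem_insert, Finset.mem_erase] at hy ⊢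
            rcases hy with rfl | hy
            · exact Or.inl rfl
            · exact Or.inr ⟨(hRq y hy).1, hRs hy⟩))
          (insert x R) (by simp) (affineIndependent_subset (Finset.subset_insert _ _) b1) (by
            intro y hy
            simp only [Finset.mem_insert] at hy
            rcases hy with rfl | hy
            · exact hxr
            · exact hratR _ hy) rfl
        have := exists_triangulation_biUnion (Finset.univ : Finset (Fin 3))
          ![openSimplex (insert p (insert x R)), openSimplex (insert q (insert x R)),
            openSimplex (insert x R)] (by
            intro i _ j _ hij
            fin_cases i <;> fin_cases j
            · exact absurd rfl hij
            · exact b4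
            · exact b5
            · exact b4.symm
            · exact absurd rfl hij
            · exact b6
            · exact b5.symm
            · exact b6.symm
            · exact absurd rfl hij) (ConstSign l) (by
            intro i _
            fin_cases i
            · exact t1
            · exact t2
            · exact t3)
        have hU : (⋃ i ∈ (Finset.univ : Finset (Fin 3)),
            ![openSimplex (insert p (insert x R)), openSimplex (insert q (insert x R)),
            openSimplex (insert x R)] i) = openSimplex s := by
          rw [← b3]
          ext y
          simp [Fin.exists_fin_succ, or_assoc]
        rwa [hU] at this
      · push Not at hneg
        exact ⟨.single s hne hI hr, fun u hu => by
          rw [Finset.mem_singleton.1 hu]; exact constSign_of_nonneg hneg⟩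
    · push Not at hpos
      exact ⟨.single s hne hI hr, fun u hu => by
        rw [Finset.mem_singleton.1 hu]; exact constSign_of_nonpos hpos⟩

lemma ConstSign.mono {l : ℚ × ℚ × ℚ} {s t : Finset Plane} (h : ConstSign l t)
    (hst : openSimplex s ⊆ openSimplex t) : ConstSign l s := by
  obtain ⟨σ, hσ⟩ := h
  exact ⟨σ, fun y hy => hσ y (hst hy)⟩

/-- A triangulation can be refined along finitely many rational lines. -/
lemma Triangulation.exists_refinement (T : Triangulation S) (L : Finset (ℚ × ℚ × ℚ)) :
    ∃ T' : Triangulation S, ∀ u ∈ T'.simplices, ∀ l ∈ L, ConstSign l u := by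
  classical
  induction L using Finset.induction_on with
  | empty => exact ⟨T, by simp⟩
  | insert l L hl ih =>
    obtain ⟨T₁, h1⟩ := ih
    have := exists_triangulation_biUnion T₁.simplices openSimplex T₁.disjoint
      (fun u => ∀ l' ∈ insert l L, ConstSign l' u) (by
        intro s hs
        obtain ⟨T₂, h2⟩ := exists_triangulation_cut l s (T₁.nonempty s hs)
          (T₁.affineIndependent s hs) (T₁.rational s hs)
        refine ⟨T₂, fun u hu l' hl' => ?_⟩
        rcases Finset.mem_insert.1 hl' with rfl | hl'
        · exact h2 u hu
        · exact (h1 s hs l' hl').mono (T₂.subset hu))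
    rwa [T₁.iUnion_eq] at this

/-- A set is rational semilinear if membership depends only on the signs of finitely many rational
affine functionals. -/
def IsSemilinear (S : Set Plane) : Prop :=
  ∃ L : Finset (ℚ × ℚ × ℚ), ∀ x y, (∀ l ∈ L, SignType.sign (evalAff l x) =
      SignType.sign (evalAff l y)) →
    (x ∈ S ↔ y ∈ S)

/-- A bounded semilinear set has a triangulation: cut a large triangle. -/
theorem exists_triangulation_of_isSemilinear (hS : IsSemilinear S) (hb : Bornology.IsBounded S) :
    Nonempty (Triangulation S) := by
  classical
  obtain ⟨L, hL⟩ := hS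
  obtain ⟨M, hM⟩ := exists_abs_lt_of_isBounded hb
  let N : ℚ := M + 1
  have hN : (0 : ℝ) < N := by simp only [N]; push_cast; positivity
  let p : Plane := ![-N, -N]
  let q : Plane := ![3 * N, -N]
  let r : Plane := ![-N, 3 * N]
  have ho : 0 < orient p q r := by
    simp only [orient, p, q, r]; simp; nlinarith
  have hr : ∀ z ∈ ({p, q, r} : Finset Plane), IsRat z := by
    intro z hz
    simp only [Finset.mem_insert, Finset.mem_singleton] at hz
    rcases hz with rfl | rfl | rfl <;> intro i <;> fin_cases i
    · exact ⟨-N, by simp [p]⟩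
    · exact ⟨-N, by simp [p]⟩
    · exact ⟨3 * N, by simp [q]⟩
    · exact ⟨-N, by simp [q]⟩
    · exact ⟨-N, by simp [r]⟩
    · exact ⟨3 * N, by simp [r]⟩
  have hSsub : S ⊆ openSimplex {p, q, r} := by
    intro x hx
    have h0 := abs_lt.1 (hM x hx 0)
    have h1 := abs_lt.1 (hM x hx 1)
    have hNM : (N : ℝ) = M + 1 := by simp only [N]; push_cast; rfl
    rw [mem_openSimplex_iff ho]
    refine ⟨?_, ?_, ?_⟩ <;> simp only [orient, p, q, r] <;> simp <;> nlinarith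
  obtain ⟨T, hT⟩ := (Triangulation.single {p, q, r} (by simp)
    ((isTriangle_triple_iff p q r).2 ho.ne').2 hr).exists_refinement L
  refine ⟨⟨T.simplices.filter fun s : Finset Plane => (openSimplex s ∩ S).Nonempty,
    fun s hs => T.nonempty s (Finset.mem_filter.1 hs).1,
    fun s hs => T.affineIndependent s (Finset.mem_filter.1 hs).1,
    fun s hs => T.rational s (Finset.mem_filter.1 hs).1,
    fun s hs t ht => T.disjoint s (Finset.mem_filter.1 hs).1 t (Finset.mem_filter.1 ht).1, ?_⟩⟩
  apply Set.Subset.antisymm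
  · refine iUnion₂_subset fun s hs x hx => ?_
    obtain ⟨hs1, y, hy, hyS⟩ := Finset.mem_filter.1 hs
    refine (hL x y fun l hl => ?_).2 hyS
    obtain ⟨σ, hσ⟩ := hT s hs1 l hl
    rw [hσ x hx, hσ y hy]
  · intro x hx
    have h1 := hSsub hx
    rw [← T.iUnion_eq] at h1
    simp only [mem_iUnion] at h1 ⊢
    obtain ⟨s, hs, hxs⟩ := h1
    exact ⟨s, Finset.mem_filter.2 ⟨hs, x, hxs, hx⟩, hxs⟩

end

section

/-! ### Completing a set of facets to a triangulation -/

variable {S P : Set Plane}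

lemma IsSemilinear.compl (h : IsSemilinear S) : IsSemilinear Sᶜ := by
  obtain ⟨L, hL⟩ := h
  exact ⟨L, fun x y hxy => not_congr (hL x y hxy)⟩

lemma IsSemilinear.inter {A B : Set Plane} (hA : IsSemilinear A) (hB : IsSemilinear B) :
    IsSemilinear (A ∩ B) := by
  classical
  obtain ⟨L, hL⟩ := hA
  obtain ⟨M, hM⟩ := hB
  exact ⟨L ∪ M, fun x y hxy => and_congr (hL x y fun l hl => hxy l (Finset.mem_union_left _ hl))
    (hM x y fun l hl => hxy l (Finset.mem_union_right _ hl))⟩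

lemma IsSemilinear.union {A B : Set Plane} (hA : IsSemilinear A) (hB : IsSemilinear B) :
    IsSemilinear (A ∪ B) := by
  have := (hA.compl.inter hB.compl).compl
  rwa [← compl_union, compl_compl] at this

lemma IsSemilinear.diff {A B : Set Plane} (hA : IsSemilinear A) (hB : IsSemilinear B) :
    IsSemilinear (A \ B) := hA.inter hB.compl

lemma isSemilinear_biUnion {ι : Type*} (I : Finset ι) (A : ι → Set Plane)
    (h : ∀ i ∈ I, IsSemilinear (A i)) : IsSemilinear (⋃ i ∈ I, A i) := by
  classical
  induction I using Finset.induction_on with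
  | empty => exact ⟨∅, by simp⟩
  | insert i I hi ih =>
    rw [Finset.set_biUnion_insert]
    exact (h i (by simp)).union (ih fun j hj => h j (by simp [hj]))

lemma exists_evalAff_eq_orient {p q : Plane} (hp : IsRat p) (hq : IsRat q) :
    ∃ l, ∀ x, evalAff l x = orient p q x := by
  obtain ⟨p0, h0⟩ := hp 0
  obtain ⟨p1, h1⟩ := hp 1
  obtain ⟨q0, h2⟩ := hq 0
  obtain ⟨q1, h3⟩ := hq 1
  refine ⟨(-(q1 - p1), q0 - p0, -(q0 - p0) * p1 + (q1 - p1) * p0), fun x => ?_⟩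
  simp only [evalAff, orient, h0, h1, h2, h3]
  push_cast; ring

lemma isSemilinear_orient_pos {p q : Plane} (hp : IsRat p) (hq : IsRat q) :
    IsSemilinear {x | 0 < orient p q x} := by
  obtain ⟨l, hl⟩ := exists_evalAff_eq_orient hp hq
  refine ⟨{l}, fun x y h => ?_⟩
  have h1 := h l (by simp)
  change 0 < orient p q x ↔ 0 < orient p q y
  rw [← hl, ← hl, ← sign_eq_one_iff, h1, sign_eq_one_iff]

lemma isSemilinear_orient_nonneg {p q : Plane} (hp : IsRat p) (hq : IsRat q) :
    IsSemilinear {x | 0 ≤ orient p q x} := by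
  have : {x | 0 ≤ orient p q x} = {x | 0 < orient q p x}ᶜ := by
    ext x
    change 0 ≤ orient p q x ↔ ¬ (0 < orient q p x)
    rw [orient_swap', not_lt]
    constructor <;> intro h <;> linarith
  rw [this]
  exact (isSemilinear_orient_pos hq hp).compl

lemma isSemilinear_triangle {t : Finset Plane} (ht : IsTriangle t) (hr : ∀ p ∈ t, IsRat p) :
    IsSemilinear (openSimplex t) ∧ IsSemilinear (convexHull ℝ (t : Set Plane)) := by
  obtain ⟨p, q, r, rfl, ho⟩ := ht.exists_ccw
  have hp := hr p (by simp)
  have hq := hr q (by simp)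
  have hr' := hr r (by simp)
  constructor
  · have : openSimplex {p, q, r} =
        {x | 0 < orient q r x} ∩ ({x | 0 < orient r p x} ∩ {x | 0 < orient p q x}) := by
      ext x; exact mem_openSimplex_iff ho x
    rw [this]
    exact (isSemilinear_orient_pos hq hr').inter
      ((isSemilinear_orient_pos hr' hp).inter (isSemilinear_orient_pos hp hq))
  · have : convexHull ℝ (({p, q, r} : Finset Plane) : Set Plane) =
        {x | 0 ≤ orient q r x} ∩ ({x | 0 ≤ orient r p x} ∩ {x | 0 ≤ orient p q x}) := by
      ext x; exact mem_convexHull_iff_orient ho x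
    rw [this]
    exact (isSemilinear_orient_nonneg hq hr').inter
      ((isSemilinear_orient_nonneg hr' hp).inter (isSemilinear_orient_nonneg hp hq))

lemma isTriangle_of_mem_facets {T : Triangulation S} {s : Finset Plane} (hs : s ∈ T.facets) :
    IsTriangle s := by
  obtain ⟨h1, h2⟩ := Finset.mem_filter.1 hs
  exact ⟨h2, T.affineIndependent s h1⟩

lemma mem_simplices_of_mem_facets {T : Triangulation S} {s : Finset Plane} (hs : s ∈ T.facets) :
    s ∈ T.simplices := (Finset.mem_filter.1 hs).1

lemma isCompact_biUnion_hull (F : Finset (Finset Plane)) :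
    IsCompact (⋃ t ∈ F, convexHull ℝ (t : Set Plane)) :=
  F.finite_toSet.isCompact_biUnion fun s _ => isCompact_hull s

/-- Rational triangles with disjoint interiors that cover `P` are the facets of a triangulation:
what remains is semilinear with empty interior. -/
theorem exists_triangulation_facets_eq {F : Finset (Finset Plane)} (htri : ∀ t ∈ F, IsTriangle t)
    (hrat : ∀ t ∈ F, ∀ p ∈ t, IsRat p)
    (hdis : ∀ s ∈ F, ∀ t ∈ F, s ≠ t → Disjoint (openSimplex s) (openSimplex t))
    (hcov : ⋃ t ∈ F, convexHull ℝ (t : Set Plane) = P) : ∃ T : Triangulation P, T.facets = F := by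
  classical
  set U := ⋃ t ∈ F, openSimplex t with hU
  have hUP : U ⊆ P := by
    rw [← hcov]
    exact iUnion₂_mono fun t _ => openSimplex_subset_convexHull t
  have hR : IsSemilinear (P \ U) := by
    rw [← hcov]
    exact (isSemilinear_biUnion F _ fun t ht =>
        (isSemilinear_triangle (htri t ht) (hrat t ht)).2).diff
      (isSemilinear_biUnion F _ fun t ht => (isSemilinear_triangle (htri t ht) (hrat t ht)).1)
  have hb : Bornology.IsBounded (P \ U) := by
    rw [← hcov]
    exact (isCompact_biUnion_hull F).isBounded.subset sdiff_subset
  obtain ⟨T₀⟩ := exists_triangulation_of_isSemilinear hR hb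
  have hcard : ∀ s ∈ T₀.simplices, s.card ≠ 3 := by
    intro s hs hc
    have hst : IsTriangle s := ⟨hc, T₀.affineIndependent s hs⟩
    obtain ⟨x, hx⟩ := openSimplex_nonempty (T₀.nonempty s hs)
    have hxP := (T₀.subset hs hx).1
    rw [← hcov] at hxP
    simp only [mem_iUnion] at hxP
    obtain ⟨t, ht, hxt⟩ := hxP
    obtain ⟨y, hys, hyt⟩ := mem_closure_iff.1 (hull_subset_closure t hxt) _ hst.isOpen hx
    exact (T₀.subset hs hys).2 (mem_biUnion (x := t) ht hyt)
  refine ⟨⟨F ∪ T₀.simplices, ?_, ?_, ?_, ?_, ?_⟩, ?_⟩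
  · intro s hs
    rcases Finset.mem_union.1 hs with hs | hs
    · rw [← Finset.card_pos, (htri s hs).1]; norm_num
    · exact T₀.nonempty s hs
  · intro s hs
    rcases Finset.mem_union.1 hs with hs | hs
    · exact (htri s hs).2
    · exact T₀.affineIndependent s hs
  · intro s hs
    rcases Finset.mem_union.1 hs with hs | hs
    · exact hrat s hs
    · exact T₀.rational s hs
  · have hmix : ∀ s ∈ F, ∀ t ∈ T₀.simplices, Disjoint (openSimplex s) (openSimplex t) := by
      intro s hs t ht
      refine Set.disjoint_left.2 fun x hx hx' => (T₀.subset ht hx').2 (mem_biUnion (x := s) hs hx)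
    intro s hs t ht hne
    rcases Finset.mem_union.1 hs with hs | hs <;> rcases Finset.mem_union.1 ht with ht | ht
    · exact hdis s hs t ht hne
    · exact hmix s hs t ht
    · exact (hmix t ht s hs).symm
    · exact T₀.disjoint s hs t ht hne
  · rw [Finset.set_biUnion_union, T₀.iUnion_eq]
    exact union_sdiff_cancel hUP
  · ext s
    simp only [Triangulation.facets, Finset.mem_filter, Finset.mem_union]
    constructor
    · rintro ⟨hs | hs, hc⟩
      · exact hs
      · exact absurd hc (hcard s hs)
    · exact fun hs => ⟨Or.inl hs, (htri s hs).1⟩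

/-- The simplices that are not facets are null sets. -/
lemma volume_openSimplex_eq_zero {s : Finset Plane} (hI : AffineIndependent ℝ ((↑) : s → Plane))
    (hs : s.card ≠ 3) : MeasureTheory.volume (openSimplex s) = 0 := by
  refine MeasureTheory.measure_mono_null ((openSimplex_subset_convexHull s).trans
    (convexHull_subset_affineSpan _)) (MeasureTheory.Measure.addHaar_affineSubspace _ _ ?_)
  intro h
  apply hs
  have h1 : affineSpan ℝ (Set.range ((↑) : s → Plane)) = ⊤ := by
    rw [Subtype.range_coe_subtype]; exact h
  have h2 := hI.affineSpan_eq_top_iff_card_eq_finrank_add_one.1 h1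
  rw [Fintype.card_coe, Module.finrank_fin_fun] at h2
  exact h2

/-- The facets are dense in the interior of the triangulated set. -/
lemma Triangulation.subset_closure_facets (T : Triangulation S) {U : Set Plane} (hU : IsOpen U)
    (hUS : U ⊆ S) : U ⊆ closure (⋃ s ∈ T.facets, openSimplex s) := by
  intro x hx
  rw [mem_closure_iff]
  intro V hV hxV
  by_contra hc
  rw [Set.not_nonempty_iff_eq_empty] at hc
  have hnull : MeasureTheory.volume (V ∩ U) = 0 := by
    refine MeasureTheory.measure_mono_null (t := ⋃ s ∈ T.simplices.filter (fun s => s.card ≠ 3),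
        openSimplex s) ?_ ?_
    · rintro y ⟨hyV, hyU⟩
      have hyS := hUS hyU
      rw [← T.iUnion_eq] at hyS
      simp only [mem_iUnion] at hyS
      obtain ⟨s, hs, hys⟩ := hyS
      refine mem_biUnion (x := s) (Finset.mem_filter.2 ⟨hs, fun h3 => ?_⟩) hys
      have : y ∈ V ∩ ⋃ s ∈ T.facets, openSimplex s :=
        ⟨hyV, mem_biUnion (x := s) (Finset.mem_filter.2 ⟨hs, h3⟩) hys⟩
      rw [hc] at this
      exact this
    · refine (MeasureTheory.measure_biUnion_null_iff (Finset.countable_toSet _)).2 fun s hs => ?_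
      obtain ⟨h1, h2⟩ := Finset.mem_filter.1 hs
      exact volume_openSimplex_eq_zero (T.affineIndependent s h1) h2
  exact ((hV.inter hU).measure_pos MeasureTheory.volume ⟨x, hxV, hx⟩).ne' hnull

lemma Triangulation.biUnion_hull_facets (T : Triangulation P) (hc : IsClosed P)
    (hreg : P ⊆ closure (interior P)) : ⋃ s ∈ T.facets, convexHull ℝ (s : Set Plane) = P := by
  apply Set.Subset.antisymm
  · refine iUnion₂_subset fun s hs => ?_
    rw [← closure_openSimplex]
    exact closure_minimal (T.subset (mem_simplices_of_mem_facets hs)) hc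
  · have hcl := (isCompact_biUnion_hull T.facets).isClosed
    have h1 : interior P ⊆ ⋃ s ∈ T.facets, convexHull ℝ (s : Set Plane) :=
      (T.subset_closure_facets isOpen_interior interior_subset).trans
        (closure_minimal (iUnion₂_mono fun t _ => openSimplex_subset_convexHull t) hcl)
    exact hreg.trans (closure_minimal h1 hcl)

lemma isRat_of_lattice {d : ℕ} (hd : 0 < d) {p : Plane} (hp : p ∈ lattice d) : IsRat p := by
  intro i
  obtain ⟨k, hk⟩ := hp i
  have hd' : (d : ℝ) ≠ 0 := by exact_mod_cast hd.ne'
  refine ⟨k / d, ?_⟩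
  push_cast
  field_simp
  linarith

/-- A minimal tiling consists of the facets of a triangulation. -/
lemma IsTiling.exists_triangulation {d : ℕ} (hd : 0 < d) {T : Finset (Finset Plane)}
    (hT : IsTiling d P T) : ∃ 𝒯 : Triangulation P, 𝒯.facets = T :=
  exists_triangulation_facets_eq (fun t ht => (hT.minimal t ht).1)
    (fun t ht _ hp => isRat_of_lattice hd ((hT.minimal t ht).mem_lattice hp)) hT.disjoint hT.cover

/-- The facets of a minimal triangulation of a polygon form a minimal tiling. -/
lemma Triangulation.isTiling {d : ℕ} (hP : IsPolygon P) (T : Triangulation P) (hT : T.IsMinimal d) :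
    IsTiling d P T.facets :=
  ⟨hT, fun s hs t ht => T.disjoint s (mem_simplices_of_mem_facets hs)
      t (mem_simplices_of_mem_facets ht),
    T.biUnion_hull_facets hP.isCompact.isClosed hP.subset_closure_interior⟩

end

section

/-! ### The affine unimodular group and weights -/

variable {d : ℕ}

lemma act_zero (g : AffineUnimodular) (x : Plane) :
    g.act x 0 = (g.U.val 0 0 : ℝ) * x 0 + (g.U.val 0 1 : ℝ) * x 1 + g.v 0 := by
  simp [AffineUnimodular.act]

lemma act_one (g : AffineUnimodular) (x : Plane) :
    g.act x 1 = (g.U.val 1 0 : ℝ) * x 0 + (g.U.val 1 1 : ℝ) * x 1 + g.v 1 := by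
  simp [AffineUnimodular.act]

/-- The determinant of the linear part of a `G`-map. -/
def AffineUnimodular.detU (g : AffineUnimodular) : ℤ :=
  g.U.val 0 0 * g.U.val 1 1 - g.U.val 0 1 * g.U.val 1 0

lemma AffineUnimodular.detU_eq (g : AffineUnimodular) : g.detU = 1 ∨ g.detU = -1 := by
  have h : IsUnit (g.U.val).det := (Matrix.isUnit_iff_isUnit_det _).1 g.U.isUnit
  rw [Matrix.det_fin_two] at h
  exact Int.isUnit_iff.1 h

/-- A `G`-map given by the entries of its matrix and its translation vector. -/
lemma exists_affineUnimodular (a b c e v0 v1 : ℤ) (h : a * e - b * c = 1 ∨ a * e - b * c = -1) :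
    ∃ g : AffineUnimodular, ∀ x : Plane, g.act x 0 = a * x 0 + b * x 1 + v0 ∧
      g.act x 1 = c * x 0 + e * x 1 + v1 := by
  have hdet : IsUnit (!![a, b; c, e] : Matrix (Fin 2) (Fin 2) ℤ).det := by
    rw [Matrix.det_fin_two_of]; exact Int.isUnit_iff.2 h
  let U : GL (Fin 2) ℤ := ((Matrix.isUnit_iff_isUnit_det _).2 hdet).unit
  refine ⟨⟨U, ![v0, v1]⟩, fun x => ⟨?_, ?_⟩⟩
  · rw [act_zero]; simp [U]
  · rw [act_one]; simp [U]

lemma AffineUnimodular.exists_inverse (g : AffineUnimodular) :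
    ∃ g' : AffineUnimodular, Function.LeftInverse g'.act g.act ∧
        Function.RightInverse g'.act g.act := by
  obtain ⟨a, ha⟩ : ∃ a, a = g.U.val 0 0 := ⟨_, rfl⟩
  obtain ⟨b, hb⟩ : ∃ a, a = g.U.val 0 1 := ⟨_, rfl⟩
  obtain ⟨c, hc⟩ : ∃ a, a = g.U.val 1 0 := ⟨_, rfl⟩
  obtain ⟨e, he⟩ : ∃ a, a = g.U.val 1 1 := ⟨_, rfl⟩
  have hg0 := act_zero g
  have hg1 := act_one g
  have hdet := g.detU_eq
  unfold AffineUnimodular.detU at hdet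
  rw [← ha, ← hb, ← hc, ← he] at hdet
  rw [← ha, ← hb] at hg0
  rw [← hc, ← he] at hg1
  obtain ⟨D, hD⟩ : ∃ D, D = a * e - b * c := ⟨_, rfl⟩
  rw [← hD] at hdet
  have hDD : D * D = 1 := by rcases hdet with h | h <;> rw [h] <;> rfl
  obtain ⟨g', h'⟩ := exists_affineUnimodular (D * e) (-(D * b)) (-(D * c)) (D * a)
    (-(D * e * g.v 0) + D * b * g.v 1) (D * c * g.v 0 - D * a * g.v 1) (by
      have : D * e * (D * a) - -(D * b) * -(D * c) = D := by
        linear_combination D * hDD - (D * D) * hD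
      rwa [this])
  have hDR : (D : ℝ) * (a * e - b * c) = 1 := by
    rw [hD] at hDD; rw [hD]; exact_mod_cast hDD
  refine ⟨g', fun x => plane_ext ?_ ?_, fun x => plane_ext ?_ ?_⟩
  · rw [(h' _).1, hg0, hg1]; push_cast; linear_combination x 0 * hDR
  · rw [(h' _).2, hg0, hg1]; push_cast; linear_combination x 1 * hDR
  · rw [hg0, (h' _).1, (h' _).2]; push_cast
    linear_combination (x 0 - g.v 0) * hDR
  · rw [hg1, (h' _).1, (h' _).2]; push_cast
    linear_combination (x 1 - g.v 1) * hDR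

lemma AffineUnimodular.exists_comp (g h : AffineUnimodular) :
    ∃ k : AffineUnimodular, ∀ x, k.act x = g.act (h.act x) := by
  obtain ⟨k, hk⟩ := exists_affineUnimodular
    (g.U.val 0 0 * h.U.val 0 0 + g.U.val 0 1 * h.U.val 1 0)
    (g.U.val 0 0 * h.U.val 0 1 + g.U.val 0 1 * h.U.val 1 1)
    (g.U.val 1 0 * h.U.val 0 0 + g.U.val 1 1 * h.U.val 1 0)
    (g.U.val 1 0 * h.U.val 0 1 + g.U.val 1 1 * h.U.val 1 1)
    (g.U.val 0 0 * h.v 0 + g.U.val 0 1 * h.v 1 + g.v 0)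
    (g.U.val 1 0 * h.v 0 + g.U.val 1 1 * h.v 1 + g.v 1) (by
      have : ∀ D : ℤ, D = g.detU * h.detU → D = 1 ∨ D = -1 := by
        intro D hD
        rcases g.detU_eq with h1 | h1 <;> rcases h.detU_eq with h2 | h2 <;> rw [h1, h2] at hD <;>
          simp [hD]
      apply this
      unfold AffineUnimodular.detU; ring)
  refine ⟨k, fun x => plane_ext ?_ ?_⟩
  · rw [(hk x).1, act_zero, act_zero, act_one]; push_cast; ring
  · rw [(hk x).2, act_one, act_zero, act_one]; push_cast; ring

lemma exists_act_eq_id : ∃ g : AffineUnimodular, ∀ x, g.act x = x := by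
  obtain ⟨g, hg⟩ := exists_affineUnimodular 1 0 0 1 0 0 (by simp)
  exact ⟨g, fun x => plane_ext (by simp [(hg x).1]) (by simp [(hg x).2])⟩

lemma AffineUnimodular.injective (g : AffineUnimodular) : Function.Injective g.act := by
  obtain ⟨g', h, -⟩ := g.exists_inverse
  exact h.injective

lemma AffineUnimodular.continuous (g : AffineUnimodular) : Continuous g.act := by
  refine continuous_pi fun i => ?_
  fin_cases i
  · exact (by fun_prop : Continuous fun x : Plane => (g.U.val 0 0 : ℝ) * x 0 + (g.U.val 0 1 :
        ℝ) * x 1 + g.v 0).congr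
      fun x => (act_zero g x).symm
  · exact (by fun_prop : Continuous fun x : Plane => (g.U.val 1 0 : ℝ) * x 0 + (g.U.val 1 1 :
        ℝ) * x 1 + g.v 1).congr
      fun x => (act_one g x).symm

lemma AffineUnimodular.isOpenMap (g : AffineUnimodular) : IsOpenMap g.act := by
  obtain ⟨g', h1, h2⟩ := g.exists_inverse
  intro U hU
  rw [Set.image_eq_preimage_of_inverse h1 h2]
  exact hU.preimage g'.continuous

lemma AffineUnimodular.act_sum (g : AffineUnimodular) (s : Finset Plane) (w : Plane → ℝ)
    (h : ∑ p ∈ s, w p = 1) : g.act (∑ p ∈ s, w p • p) = ∑ p ∈ s, w p • g.act p := by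
  have e : ∀ (f : Plane → Plane) i, (∑ p ∈ s, w p • f p) i = ∑ p ∈ s, w p * f p i := by
    intro f i; rw [Finset.sum_apply]; rfl
  have key : ∀ A B C : ℝ, A * (∑ p ∈ s, w p * p 0) + B * (∑ p ∈ s, w p * p 1) + C =
      ∑ p ∈ s, w p * (A * p 0 + B * p 1 + C) := by
    intro A B C
    conv_lhs => rw [← one_mul C, ← h, Finset.sum_mul, Finset.mul_sum, Finset.mul_sum,
      ← Finset.sum_add_distrib, ← Finset.sum_add_distrib]
    exact Finset.sum_congr rfl fun p _ => by ring
  have e0 := e id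
  simp only [id] at e0
  refine plane_ext ?_ ?_
  · rw [act_zero, e0, e0, e g.act, key]
    simp only [act_zero]
  · rw [act_one, e0, e0, e g.act, key]
    simp only [act_one]

lemma AffineUnimodular.image_openSimplex (g : AffineUnimodular) (s : Finset Plane) :
    g.act '' openSimplex s = openSimplex (s.image g.act) := by
  obtain ⟨g', h1, h2⟩ := g.exists_inverse
  ext y
  constructor
  · rintro ⟨x, ⟨w, h0, hs, rfl⟩, rfl⟩
    refine ⟨fun q => w (g'.act q), ?_, ?_, ?_⟩
    · intro q hq
      obtain ⟨p, hp, rfl⟩ := Finset.mem_image.1 hq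
      simpa only [h1 p] using h0 p hp
    · rw [Finset.sum_image (fun a _ b _ hab => g.injective hab), ← hs]
      exact Finset.sum_congr rfl fun p _ => by simp only [h1 p]
    · rw [Finset.sum_image (fun a _ b _ hab => g.injective hab), g.act_sum s w hs]
      exact Finset.sum_congr rfl fun p _ => by simp only [h1 p]
  · rintro ⟨w, h0, hs, rfl⟩
    rw [Finset.sum_image (fun a _ b _ hab => g.injective hab)] at hs
    refine ⟨∑ p ∈ s, w (g.act p) • p, ⟨fun p => w (g.act p), fun p hp =>
        h0 _ (Finset.mem_image_of_mem _ hp), hs, rfl⟩, ?_⟩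
    rw [g.act_sum s (fun p => w (g.act p)) hs, Finset.sum_image (fun a _ b _ hab =>
        g.injective hab)]

lemma orient_act (g : AffineUnimodular) (p q r : Plane) :
    orient (g.act p) (g.act q) (g.act r) = g.detU * orient p q r := by
  simp only [orient, act_zero, act_one, AffineUnimodular.detU]; push_cast; ring

lemma image_triple (f : Plane → Plane) (p q r : Plane) :
    ({p, q, r} : Finset Plane).image f = {f p, f q, f r} := by
  simp [Finset.image_insert]

lemma detU_ne_zero (g : AffineUnimodular) : (g.detU : ℝ) ≠ 0 := by
  rcases g.detU_eq with h | h <;> rw [h] <;> norm_num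

lemma IsTriangle.image {s : Finset Plane} (h : IsTriangle s) (g : AffineUnimodular) :
    IsTriangle (s.image g.act) := by
  obtain ⟨p, q, r, rfl, ho⟩ := h.exists_ccw
  rw [image_triple, isTriangle_triple_iff, orient_act]
  exact mul_ne_zero (detU_ne_zero g) ho.ne'

lemma act_mem_lattice (g : AffineUnimodular) {p : Plane} (hp : p ∈ lattice d) :
    g.act p ∈ lattice d := by
  obtain ⟨a, ha⟩ := hp 0
  obtain ⟨b, hb⟩ := hp 1
  intro i
  fin_cases i
  · refine ⟨g.U.val 0 0 * a + g.U.val 0 1 * b + d * g.v 0, ?_⟩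
    change (d : ℝ) * g.act p 0 = _
    rw [act_zero]; push_cast; rw [← ha, ← hb]; ring
  · refine ⟨g.U.val 1 0 * a + g.U.val 1 1 * b + d * g.v 1, ?_⟩
    change (d : ℝ) * g.act p 1 = _
    rw [act_one]; push_cast; rw [← ha, ← hb]; ring

lemma act_isRat (g : AffineUnimodular) {p : Plane} (hp : IsRat p) : IsRat (g.act p) := by
  obtain ⟨a, ha⟩ := hp 0
  obtain ⟨b, hb⟩ := hp 1
  intro i
  fin_cases i
  · refine ⟨g.U.val 0 0 * a + g.U.val 0 1 * b + g.v 0, ?_⟩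
    change g.act p 0 = _
    rw [act_zero]; push_cast; rw [← ha, ← hb]
  · refine ⟨g.U.val 1 0 * a + g.U.val 1 1 * b + g.v 1, ?_⟩
    change g.act p 1 = _
    rw [act_one]; push_cast; rw [← ha, ← hb]

lemma IsMinimalTriangle.image (hd : 0 < d) {s : Finset Plane} (h : IsMinimalTriangle d s)
    (g : AffineUnimodular) : IsMinimalTriangle d (s.image g.act) := by
  obtain ⟨p, q, r, rfl, hp, hq, hr, ho⟩ := h.exists_ccw hd
  rw [image_triple]
  rcases g.detU_eq with hg | hg
  · exact minimal_of_orient hd (act_mem_lattice g hp) (act_mem_lattice g hq) (act_mem_lattice g hr)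
      (by rw [orient_act, hg]; simpa using ho)
  · rw [Finset.insert_comm]
    exact minimal_of_orient hd (act_mem_lattice g hq) (act_mem_lattice g hp) (act_mem_lattice g hr)
      (by rw [orient_act, hg, orient_swap']; simpa using ho)

lemma edgeWeight_eq {p q : Plane} {p0 p1 q0 q1 : ℤ} (h0 : (d : ℝ) * p 0 = p0)
    (h1 : (d : ℝ) * p 1 = p1) (h2 : (d : ℝ) * q 0 = q0) (h3 : (d : ℝ) * q 1 = q1) :
    edgeWeight d p q = ((p0 * q1 - p1 * q0 : ℤ) : ZMod d) := by
  simp only [edgeWeight, h0, h1, h2, h3, Int.floor_intCast]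

lemma edgeWeight_swap (p q : Plane) : edgeWeight d q p = -edgeWeight d p q := by
  simp only [edgeWeight]; push_cast; ring

lemma edgeWeight_act (g : AffineUnimodular) {p q : Plane} (hp : p ∈ lattice d)
    (hq : q ∈ lattice d) : edgeWeight d (g.act p) (g.act q) = g.detU * edgeWeight d p q := by
  obtain ⟨p0, h0⟩ := hp 0
  obtain ⟨p1, h1⟩ := hp 1
  obtain ⟨q0, h2⟩ := hq 0
  obtain ⟨q1, h3⟩ := hq 1
  have e : ∀ {x : Plane} {a b : ℤ}, (d : ℝ) * x 0 = a → (d : ℝ) * x 1 = b →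
      (d : ℝ) * g.act x 0 = (g.U.val 0 0 * a + g.U.val 0 1 * b + d * g.v 0 : ℤ) ∧
      (d : ℝ) * g.act x 1 = (g.U.val 1 0 * a + g.U.val 1 1 * b + d * g.v 1 : ℤ) := by
    intro x a b ha hb
    rw [act_zero, act_one]; push_cast; rw [← ha, ← hb]
    constructor <;> ring
  rw [edgeWeight_eq h0 h1 h2 h3, edgeWeight_eq (e h0 h1).1 (e h0 h1).2 (e h2 h3).1 (e h2 h3).2,
    AffineUnimodular.detU]
  push_cast
  rw [ZMod.natCast_self]
  ring

lemma weight_triple {a b c : Plane} (h : 0 < orient a b c) :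
    weight d {a, b, c} = {edgeWeight d a b, edgeWeight d b c, edgeWeight d c a} := by
  classical
  obtain ⟨hab, hac, hbc⟩ := ne_of_orient h.ne'
  have hE : ccwEdges {a, b, c} = {(a, b), (b, c), (c, a)} := by
    have h1 : orient b a c = -orient a b c := orient_swap' _ _ _
    have h2 : orient b c a = orient a b c := orient_rotate _ _ _
    have h3 : orient c b a = -orient a b c := by rw [orient_swap', h2]
    have h4 : orient c a b = orient a b c := by rw [← orient_rotate c a b]
    have h5 : orient a c b = -orient a b c := orient_swap _ _ _
    ext ⟨x, y⟩
    simp only [ccwEdges, Finset.mem_filter, Finset.mem_offDiag, Finset.mem_insert,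
        Finset.mem_singleton,
      Prod.mk.injEq]
    constructor
    · rintro ⟨⟨hx, hy, hne⟩, r, hr, hpos⟩
      rcases hx with rfl | rfl | rfl <;> rcases hy with rfl | rfl | rfl <;>
        rcases hr with rfl | rfl | rfl <;> simp_all <;> linarith
    · rintro (⟨rfl, rfl⟩ | ⟨rfl, rfl⟩ | ⟨rfl, rfl⟩)
      · exact ⟨⟨by simp, by simp, hab⟩, c, by simp, h⟩
      · exact ⟨⟨by simp, by simp, hbc⟩, a, by simp, h2 ▸ h⟩
      · exact ⟨⟨by simp, by simp, hac.symm⟩, b, by simp, h4 ▸ h⟩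
  have n1 : (a, b) ∉ ({(b, c), (c, a)} : Finset (Plane × Plane)) := by simp [hab, hac]
  have n2 : (b, c) ∉ ({(c, a)} : Finset (Plane × Plane)) := by simp [hbc]
  rw [weight, hE, Finset.insert_val_of_notMem n1, Finset.insert_val_of_notMem n2]
  rfl

/-- The weight is invariant under `G`-maps: a reflection changes the sign of the weights of the
edges and also their orientation. -/
lemma weight_image (hd : 0 < d) {s : Finset Plane} (h : IsMinimalTriangle d s)
    (g : AffineUnimodular) : weight d (s.image g.act) = weight d s := by
  obtain ⟨p, q, r, rfl, hp, hq, hr, ho⟩ := h.exists_ccw hd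
  have hpos := pos_of_orient ho
  rw [image_triple, weight_triple hpos]
  rcases g.detU_eq with hg | hg
  · rw [weight_triple (by rw [orient_act, hg]; simpa using hpos), edgeWeight_act g hp hq,
      edgeWeight_act g hq hr, edgeWeight_act g hr hp, hg]
    simp
  · rw [Finset.insert_comm, weight_triple (by rw [orient_act, hg, orient_swap']; simpa using hpos),
      edgeWeight_act g hq hp, edgeWeight_act g hp hr, edgeWeight_act g hr hq, hg,
      edgeWeight_swap p q, edgeWeight_swap r p, edgeWeight_swap q r]
    simp only [Int.cast_neg, Int.cast_one, neg_mul, one_mul, neg_neg]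
    rw [Multiset.insert_eq_cons, Multiset.insert_eq_cons, Multiset.insert_eq_cons,
      Multiset.insert_eq_cons, ← Multiset.cons_zero, ← Multiset.cons_zero,
      Multiset.cons_swap (edgeWeight d r p)]

/-- Two minimal triangles whose edges have the same weights up to orientation are related by a
`G`-map: the linear map that matches the edge vectors is unimodular, and the weights determine the
remaining translation modulo the integers. -/
lemma exists_act_eq (hd : 0 < d) {a b c a' b' c' : Plane} {ε : ℤ} (hε : ε = 1 ∨ ε = -1)
    (ha : a ∈ lattice d) (hb : b ∈ lattice d) (hc : c ∈ lattice d)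
    (ha' : a' ∈ lattice d) (hb' : b' ∈ lattice d) (hc' : c' ∈ lattice d)
    (h : (d : ℝ) ^ 2 * orient a b c = 1) (h' : (d : ℝ) ^ 2 * orient a' b' c' = ε)
    (hab : edgeWeight d a b = ε * edgeWeight d a' b')
    (hac : edgeWeight d a c = ε * edgeWeight d a' c') :
    ∃ g : AffineUnimodular, g.act a = a' ∧ g.act b = b' ∧ g.act c = c' := by
  have hd' : (d : ℝ) ≠ 0 := by exact_mod_cast hd.ne'
  obtain ⟨a0, k1⟩ := ha 0
  obtain ⟨a1, k2⟩ := ha 1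
  obtain ⟨b0, k3⟩ := hb 0
  obtain ⟨b1, k4⟩ := hb 1
  obtain ⟨c0, k5⟩ := hc 0
  obtain ⟨c1, k6⟩ := hc 1
  obtain ⟨A0, l1⟩ := ha' 0
  obtain ⟨A1, l2⟩ := ha' 1
  obtain ⟨B0, l3⟩ := hb' 0
  obtain ⟨B1, l4⟩ := hb' 1
  obtain ⟨C0, l5⟩ := hc' 0
  obtain ⟨C1, l6⟩ := hc' 1
  rw [edgeWeight_eq k1 k2 k3 k4, edgeWeight_eq l1 l2 l3 l4, ← Int.cast_mul,
    ZMod.intCast_eq_intCast_iff_dvd_sub] at hab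
  rw [edgeWeight_eq k1 k2 k5 k6, edgeWeight_eq l1 l2 l5 l6, ← Int.cast_mul,
    ZMod.intCast_eq_intCast_iff_dvd_sub] at hac
  obtain ⟨m, hm⟩ := hab
  obtain ⟨n, hn⟩ := hac
  have o1 : (b0 - a0) * (c1 - a1) - (b1 - a1) * (c0 - a0) = 1 := by
    have : ((b0 : ℝ) - a0) * (c1 - a1) - (b1 - a1) * (c0 - a0) = 1 := by
      rw [← h, ← k1, ← k2, ← k3, ← k4, ← k5, ← k6, orient]; ring
    exact_mod_cast this
  have o2 : (B0 - A0) * (C1 - A1) - (B1 - A1) * (C0 - A0) = ε := by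
    have : ((B0 : ℝ) - A0) * (C1 - A1) - (B1 - A1) * (C0 - A0) = ε := by
      rw [← h', ← l1, ← l2, ← l3, ← l4, ← l5, ← l6, orient]; ring
    exact_mod_cast this
  have hεε : ε * ε = 1 := by rcases hε with h | h <;> rw [h] <;> rfl
  -- the matrix that maps `b - a`, `c - a` to `b' - a'`, `c' - a'`
  obtain ⟨p, hp⟩ : ∃ p, p = (B0 - A0) * (c1 - a1) - (C0 - A0) * (b1 - a1) := ⟨_, rfl⟩
  obtain ⟨q, hq⟩ : ∃ q, q = (C0 - A0) * (b0 - a0) - (B0 - A0) * (c0 - a0) := ⟨_, rfl⟩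
  obtain ⟨r, hr⟩ : ∃ r, r = (B1 - A1) * (c1 - a1) - (C1 - A1) * (b1 - a1) := ⟨_, rfl⟩
  obtain ⟨s, hs⟩ : ∃ s, s = (C1 - A1) * (b0 - a0) - (B1 - A1) * (c0 - a0) := ⟨_, rfl⟩
  have hdet : p * s - q * r = ε := by
    have : p * s - q * r = ((B0 - A0) * (C1 - A1) - (B1 - A1) * (C0 - A0)) *
        ((b0 - a0) * (c1 - a1) - (b1 - a1) * (c0 - a0)) := by
      rw [hp, hq, hr, hs]; ring
    rw [this, o1, o2, mul_one]
  obtain ⟨g, hg⟩ := exists_affineUnimodular p q r s ((B0 - A0) * n - (C0 - A0) * m)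
    ((B1 - A1) * n - (C1 - A1) * m) (by rw [hdet]; exact hε)
  -- the image of `a`
  have t0 : p * a0 + q * a1 + d * ((B0 - A0) * n - (C0 - A0) * m) = A0 := by
    rw [hp, hq]
    linear_combination A0 * hεε + (-(B0 - A0)) * hn + (C0 - A0) * hm + (ε * A0) * o2
  have t1 : r * a0 + s * a1 + d * ((B1 - A1) * n - (C1 - A1) * m) = A1 := by
    rw [hr, hs]
    linear_combination A1 * hεε + (-(B1 - A1)) * hn + (C1 - A1) * hm + (ε * A1) * o2
  have u0 : p * (b0 - a0) + q * (b1 - a1) = B0 - A0 := by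
    rw [hp, hq]; linear_combination (B0 - A0) * o1
  have u1 : r * (b0 - a0) + s * (b1 - a1) = B1 - A1 := by
    rw [hr, hs]; linear_combination (B1 - A1) * o1
  have v0 : p * (c0 - a0) + q * (c1 - a1) = C0 - A0 := by
    rw [hp, hq]; linear_combination (C0 - A0) * o1
  have v1 : r * (c0 - a0) + s * (c1 - a1) = C1 - A1 := by
    rw [hr, hs]; linear_combination (C1 - A1) * o1
  have fin : ∀ (x y : Plane) (x0 x1 y0 y1 : ℤ), (d : ℝ) * x 0 = x0 → (d : ℝ) * x 1 = x1 →
      (d : ℝ) * y 0 = y0 → (d : ℝ) * y 1 = y1 →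
      p * x0 + q * x1 + d * ((B0 - A0) * n - (C0 - A0) * m) = y0 →
      r * x0 + s * x1 + d * ((B1 - A1) * n - (C1 - A1) * m) = y1 → g.act x = y := by
    intro x y x0 x1 y0 y1 e1 e2 e3 e4 e5 e6
    have e5' : (p : ℝ) * x0 + q * x1 + d * ((B0 - A0) * n - (C0 - A0) * m) = y0 :=
        by exact_mod_cast e5
    have e6' : (r : ℝ) * x0 + s * x1 + d * ((B1 - A1) * n - (C1 - A1) * m) = y1 :=
        by exact_mod_cast e6
    rw [← e1, ← e2, ← e3] at e5'
    rw [← e1, ← e2, ← e4] at e6'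
    refine plane_ext (mul_left_cancel₀ hd' ?_) (mul_left_cancel₀ hd' ?_)
    · rw [← e5', (hg x).1]; push_cast; ring
    · rw [← e6', (hg x).2]; push_cast; ring
  exact ⟨g, fin _ _ _ _ _ _ k1 k2 l1 l2 t0 t1,
    fin _ _ _ _ _ _ k3 k4 l3 l4 (by linear_combination t0 + u0) (by linear_combination t1 + u1),
    fin _ _ _ _ _ _ k5 k6 l5 l6 (by linear_combination t0 + v0) (by linear_combination t1 + v1)⟩

lemma multiset_triple_cases {α : Type*} {x y z x' y' z' : α}
    (h : ({x, y, z} : Multiset α) = {x', y', z'}) :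
    (x = x' ∧ y = y' ∧ z = z') ∨ (x = x' ∧ y = z' ∧ z = y') ∨ (x = y' ∧ y = x' ∧ z = z') ∨
      (x = y' ∧ y = z' ∧ z = x') ∨ (x = z' ∧ y = x' ∧ z = y') ∨ (x = z' ∧ y = y' ∧ z = x') := by
  have pair : ∀ {y z y' z' : α}, ({y, z} : Multiset α) = {y', z'} →
      (y = y' ∧ z = z') ∨ (y = z' ∧ z = y') := by
    intro y z y' z' h
    have hy : y ∈ ({y', z'} : Multiset α) := h ▸ by simp
    rw [Multiset.insert_eq_cons, Multiset.mem_cons, Multiset.mem_singleton] at hy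
    rcases hy with rfl | rfl
    · left
      rw [Multiset.insert_eq_cons, Multiset.insert_eq_cons, Multiset.cons_inj_right,
        Multiset.singleton_inj] at h
      exact ⟨rfl, h⟩
    · right
      rw [Multiset.pair_comm y' y, Multiset.insert_eq_cons, Multiset.insert_eq_cons,
        Multiset.cons_inj_right, Multiset.singleton_inj] at h
      exact ⟨rfl, h⟩
  have hx : x ∈ ({x', y', z'} : Multiset α) := h ▸ by simp
  simp only [Multiset.insert_eq_cons, Multiset.mem_cons, Multiset.mem_singleton] at hx h
  rcases hx with rfl | rfl | rfl
  · rw [Multiset.cons_inj_right] at h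
    have := pair h
    tauto
  · rw [Multiset.cons_swap x', Multiset.cons_inj_right] at h
    have := pair h
    tauto
  · have e : x' ::ₘ y' ::ₘ ({x} : Multiset α) = x ::ₘ x' ::ₘ {y'} := by
      rw [← Multiset.cons_zero, ← Multiset.cons_zero, Multiset.cons_swap y', Multiset.cons_swap x']
    rw [e, Multiset.cons_inj_right] at h
    have := pair h
    tauto

/-- Minimal triangles of the same weight are related by a `G`-map. -/
theorem exists_image_eq_of_weight_eq (hd : 0 < d) {s t : Finset Plane} (hs : IsMinimalTriangle d s)
    (ht : IsMinimalTriangle d t) (h : weight d s = weight d t) :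
    ∃ g : AffineUnimodular, s.image g.act = t := by
  obtain ⟨a, b, c, rfl, ha, hb, hc, ho⟩ := hs.exists_ccw hd
  obtain ⟨a', b', c', rfl, ha', hb', hc', ho'⟩ := ht.exists_ccw hd
  rw [weight_triple (pos_of_orient ho), weight_triple (pos_of_orient ho')] at h
  have h1 : (d : ℝ) ^ 2 * orient a' b' c' = (1 : ℤ) := by simpa using ho'
  have h2 : (d : ℝ) ^ 2 * orient b' c' a' = (1 : ℤ) := by rw [orient_rotate a' b' c']; exact h1
  have h3 : (d : ℝ) ^ 2 * orient c' a' b' = (1 : ℤ) := by rw [← orient_rotate c' a' b']; exact h1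
  have neg : ∀ {x y z : Plane}, (d : ℝ) ^ 2 * orient x y z = (1 : ℤ) →
      (d : ℝ) ^ 2 * orient y x z = (-1 : ℤ) := by
    intro x y z hxyz
    rw [orient_swap', mul_neg, hxyz]; simp
  have key : ∀ {x y z : Plane} {ε : ℤ}, (ε = 1 ∨ ε = -1) → x ∈ lattice d → y ∈ lattice d →
      z ∈ lattice d → (d : ℝ) ^ 2 * orient x y z = ε → edgeWeight d a b = ε * edgeWeight d x y →
      edgeWeight d c a = -(ε * edgeWeight d x z) → ({x, y, z} : Finset Plane) = {a', b', c'} →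
      ∃ g : AffineUnimodular, ({a, b, c} : Finset Plane).image g.act = {a', b', c'} := by
    intro x y z ε hε hx hy hz hxyz e1 e2 e3
    obtain ⟨g, g1, g2, g3⟩ := exists_act_eq hd hε ha hb hc hx hy hz ho hxyz e1
      (by rw [edgeWeight_swap c a, e2, neg_neg])
    exact ⟨g, by rw [image_triple, g1, g2, g3, e3]⟩
  rcases multiset_triple_cases h with ⟨e1, -, e3⟩ | ⟨e1, -, e3⟩ | ⟨e1, -, e3⟩ | ⟨e1, -, e3⟩ |
    ⟨e1, -, e3⟩ | ⟨e1, -, e3⟩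
  · exact key (Or.inl rfl) ha' hb' hc' h1 (by rw [e1]; simp)
      (by rw [e3, edgeWeight_swap a' c']; simp) rfl
  · exact key (Or.inr rfl) hb' ha' hc' (neg h1) (by rw [e1, edgeWeight_swap a' b']; simp)
      (by rw [e3]; simp) (Finset.insert_comm _ _ _)
  · exact key (Or.inr rfl) hc' hb' ha' (neg h2) (by rw [e1, edgeWeight_swap b' c']; simp)
      (by rw [e3]; simp) (by ext; simp; tauto)
  · exact key (Or.inl rfl) hb' hc' ha' h2 (by rw [e1]; simp)
      (by rw [e3, edgeWeight_swap a' b']; simp) (by ext; simp; tauto)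
  · exact key (Or.inl rfl) hc' ha' hb' h3 (by rw [e1]; simp)
      (by rw [e3, edgeWeight_swap b' c']; simp) (by ext; simp; tauto)
  · exact key (Or.inr rfl) ha' hc' hb' (neg h3) (by rw [e1, edgeWeight_swap c' a']; simp)
      (by rw [e3]; simp) (by ext; simp; tauto)

end

section

/-! ### Equidecomposable families of open sets -/

/-- A rational affine functional composed with a `G`-map is a rational affine functional. -/
lemma IsSemilinear.preimage {S : Set Plane} (hS : IsSemilinear S) (g : AffineUnimodular) :
    IsSemilinear (g.act ⁻¹' S) := by
  classical
  obtain ⟨L, hL⟩ := hS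
  let f : ℚ × ℚ × ℚ → ℚ × ℚ × ℚ := fun l =>
    (l.1 * g.U.val 0 0 + l.2.1 * g.U.val 1 0, l.1 * g.U.val 0 1 + l.2.1 * g.U.val 1 1,
      l.1 * g.v 0 + l.2.1 * g.v 1 + l.2.2)
  have hf : ∀ l x, evalAff (f l) x = evalAff l (g.act x) := by
    intro l x
    simp only [evalAff, f, act_zero, act_one]
    push_cast
    ring
  refine ⟨L.image f, fun x y hxy => hL _ _ fun l hl => ?_⟩
  rw [← hf, ← hf]
  exact hxy _ (Finset.mem_image_of_mem f hl)

/-- Two families of subsets of the plane are equidecomposable if, up to nowhere dense sets, the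
disjoint union of the first is cut into finitely many open semilinear pieces `U k ⊆ A (a k)`, which
are moved by `G`-maps to disjoint pieces of the disjoint union of the second, with
`g k '' U k ⊆ B (b k)`. -/
def Equidecomposable {ι κ : Type} (A : ι → Set Plane) (B : κ → Set Plane) : Prop :=
  ∃ (K : Type) (_ : Fintype K) (U : K → Set Plane) (a : K → ι) (b : K → κ)
    (g : K → AffineUnimodular),
    (∀ k, IsOpen (U k)) ∧ (∀ k, IsSemilinear (U k)) ∧
    (∀ k, ∀ x ∈ U k, x ∈ A (a k) ∧ (g k).act x ∈ B (b k)) ∧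
    (∀ k l x, a k = a l → x ∈ U k → x ∈ U l → k = l) ∧
    (∀ k l x y, b k = b l → x ∈ U k → y ∈ U l → (g k).act x = (g l).act y → k = l) ∧
    (∀ i O, IsOpen O → (O ∩ A i).Nonempty → ∃ k, a k = i ∧ ∃ x ∈ U k, x ∈ O) ∧
    (∀ j O, IsOpen O → (O ∩ B j).Nonempty → ∃ k, b k = j ∧ ∃ x ∈ U k, (g k).act x ∈ O)

/-- Intersect the pieces of the first equidecomposition with the pullbacks of those of the second. -/
lemma Equidecomposable.trans {ι κ μ : Type} {A : ι → Set Plane} {B : κ → Set Plane}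
    {C : μ → Set Plane} (hAB : Equidecomposable A B) (hBC : Equidecomposable B C) :
    Equidecomposable A C := by
  classical
  obtain ⟨K, _, U, a, b, g, hU, hUs, hUm, hUa, hUb, hUA, hUB⟩ := hAB
  obtain ⟨L, _, V, a', b', h, hV, hVs, hVm, hVa, hVb, hVA, hVB⟩ := hBC
  choose c hc using fun p : K × L => (h p.2).exists_comp (g p.1)
  refine ⟨{p : K × L // b p.1 = a' p.2}, inferInstance,
    fun p => U p.1.1 ∩ (g p.1.1).act ⁻¹' V p.1.2, fun p => a p.1.1, fun p => b' p.1.2,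
    fun p => c p.1, ?_, ?_, ?_, ?_, ?_, ?_, ?_⟩
  · exact fun p => (hU _).inter ((hV _).preimage (g _).continuous)
  · exact fun p => (hUs _).inter ((hVs _).preimage _)
  · rintro ⟨⟨k, l⟩, hkl⟩ x ⟨hx, hx'⟩
    exact ⟨(hUm k x hx).1, by rw [hc]; exact (hVm l _ hx').2⟩
  · rintro ⟨⟨k, l⟩, hkl⟩ ⟨⟨k', l'⟩, hkl'⟩ x hk ⟨h1, h2⟩ ⟨h3, h4⟩
    obtain rfl : k = k' := hUa k k' x hk h1 h3
    obtain rfl : l = l' := hVa l l' _ (hkl.symm.trans hkl') h2 h4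
    rfl
  · rintro ⟨⟨k, l⟩, hkl⟩ ⟨⟨k', l'⟩, hkl'⟩ x y hl ⟨h1, h2⟩ ⟨h3, h4⟩ he
    rw [hc, hc] at he
    obtain rfl : l = l' := hVb l l' _ _ hl h2 h4 he
    obtain rfl : k = k' := hUb k k' x y (hkl.trans hkl'.symm) h1 h3 ((h l).injective he)
    rfl
  · intro i O hO hne
    obtain ⟨k, rfl, x, hx, hxO⟩ := hUA i O hO hne
    obtain ⟨l, hl, y, hy, ⟨z, ⟨hz, hzO⟩, rfl⟩⟩ := hVA (b k) ((g k).act '' (U k ∩ O))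
      ((g k).isOpenMap _ ((hU k).inter hO)) ⟨_, ⟨x, ⟨hx, hxO⟩, rfl⟩, (hUm k x hx).2⟩
    exact ⟨⟨(k, l), hl.symm⟩, rfl, z, ⟨hz, hy⟩, hzO⟩
  · intro j O hO hne
    obtain ⟨l, rfl, y, hy, hyO⟩ := hVB j O hO hne
    obtain ⟨k, hk, x, hx, hx', hxO⟩ := hUB (a' l) (V l ∩ (h l).act ⁻¹' O)
      ((hV l).inter (hO.preimage (h l).continuous)) ⟨y, ⟨hy, hyO⟩, (hVm l y hy).1⟩
    exact ⟨⟨(k, l), hk⟩, rfl, x, ⟨hx, hx'⟩, by rw [hc]; exact hxO⟩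

lemma equidecomposable_of_equiv {ι κ : Type} [Fintype ι] {A : ι → Set Plane} {B : κ → Set Plane}
    (hA : ∀ i, IsOpen (A i)) (hAs : ∀ i, IsSemilinear (A i)) (e : ι ≃ κ)
    (g : ι → AffineUnimodular) (hg : ∀ i, (g i).act '' A i = B (e i)) : Equidecomposable A B := by
  refine ⟨ι, inferInstance, A, id, e, g, hA, hAs, ?_, ?_, ?_, ?_, ?_⟩
  · exact fun i x hx => ⟨hx, hg i ▸ mem_image_of_mem _ hx⟩
  · exact fun k l x h _ _ => h
  · exact fun k l x y h _ _ _ => e.injective h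
  · rintro i O - ⟨x, hx, hx'⟩
    exact ⟨i, rfl, x, hx', hx⟩
  · rintro j O - ⟨x, hx, hx'⟩
    obtain ⟨i, rfl⟩ := e.surjective j
    rw [← hg] at hx'
    obtain ⟨y, hy, rfl⟩ := hx'
    exact ⟨i, rfl, y, hy, hx⟩

/-- If the index set is divided into groups, by `f`, and in every group the two families have
disjoint members and dense unions in each other, then their common refinement shows that they are
equidecomposable. -/
lemma equidecomposable_of_groups {ι σ : Type} [Fintype ι] {A B : ι → Set Plane} (f : ι → σ)
    (hA : ∀ i, IsOpen (A i)) (hAs : ∀ i, IsSemilinear (A i))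
    (hB : ∀ i, IsOpen (B i)) (hBs : ∀ i, IsSemilinear (B i))
    (hAd : ∀ i j, i ≠ j → f i = f j → Disjoint (A i) (A j))
    (hBd : ∀ i j, i ≠ j → f i = f j → Disjoint (B i) (B j))
    (hAB : ∀ i, A i ⊆ closure (⋃ j, ⋃ (_ : f j = f i), B j))
    (hBA : ∀ i, B i ⊆ closure (⋃ j, ⋃ (_ : f j = f i), A j)) : Equidecomposable A B := by
  classical
  obtain ⟨g, hg⟩ := exists_act_eq_id
  have meet : ∀ {C D : ι → Set Plane}, (∀ i, IsOpen (C i)) →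
      (∀ i, C i ⊆ closure (⋃ j, ⋃ (_ : f j = f i), D j)) → ∀ i O, IsOpen O → (O ∩ C i).Nonempty →
      ∃ j, f j = f i ∧ ∃ x ∈ C i, x ∈ D j ∧ x ∈ O := by
    intro C D hC h i O hO ⟨x, hxO, hxC⟩
    obtain ⟨y, ⟨hyO, hyC⟩, hyD⟩ := mem_closure_iff.1 (h i hxC) (O ∩ C i) (hO.inter (hC i)) ⟨hxO,
        hxC⟩
    simp only [mem_iUnion] at hyD
    obtain ⟨j, hj, hyj⟩ := hyD
    exact ⟨j, hj, y, hyC, hyj, hyO⟩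
  refine ⟨{p : ι × ι // f p.1 = f p.2}, Fintype.ofFinite _, fun p => A p.1.1 ∩ B p.1.2, fun p =>
      p.1.1,
    fun p => p.1.2, fun _ => g, fun p => (hA _).inter (hB _), fun p => (hAs _).inter (hBs _),
    ?_, ?_, ?_, ?_, ?_⟩
  · exact fun p x hx => ⟨hx.1, by rw [hg]; exact hx.2⟩
  · rintro ⟨⟨i, j⟩, h⟩ ⟨⟨i', j'⟩, h'⟩ x hi ⟨hx1, hx2⟩ ⟨hx3, hx4⟩
    obtain rfl : i = i' := hi
    obtain rfl : j = j' := by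
      by_contra hne
      exact Set.disjoint_left.1 (hBd j j' hne (h.symm.trans h')) hx2 hx4
    rfl
  · rintro ⟨⟨i, j⟩, h⟩ ⟨⟨i', j'⟩, h'⟩ x y hj ⟨hx1, hx2⟩ ⟨hx3, hx4⟩ hxy
    rw [hg, hg] at hxy
    obtain rfl := hxy
    obtain rfl : j = j' := hj
    obtain rfl : i = i' := by
      by_contra hne
      exact Set.disjoint_left.1 (hAd i i' hne (h.trans h'.symm)) hx1 hx3
    rfl
  · intro i O hO hne
    obtain ⟨j, hj, x, h1, h2, h3⟩ := meet hA hAB i O hO hne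
    exact ⟨⟨(i, j), hj.symm⟩, rfl, x, ⟨h1, h2⟩, h3⟩
  · intro j O hO hne
    obtain ⟨i, hi, x, h1, h2, h3⟩ := meet hB hBA j O hO hne
    exact ⟨⟨(i, j), hi⟩, rfl, x, ⟨h2, h1⟩, by rw [hg]; exact h3⟩

/-! ### Pseudo-flips give equidecompositions -/

variable {d : ℕ}

lemma IsMinimalTriangle.isSemilinear (hd : 0 < d) {s : Finset Plane} (hs : IsMinimalTriangle d s) :
    IsSemilinear (openSimplex s) :=
  (isSemilinear_triangle hs.1 fun _ hp => isRat_of_lattice hd (hs.mem_lattice hp)).1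

/-- Families of minimal triangles with the same multiset of weights are equidecomposable. -/
lemma equidecomposable_of_weights_eq (hd : 0 < d) {ι κ : Type} [Fintype ι] [Fintype κ]
    {A : ι → Finset Plane} {B : κ → Finset Plane} (hA : ∀ i, IsMinimalTriangle d (A i))
    (hB : ∀ i, IsMinimalTriangle d (B i))
    (h : Finset.univ.val.map (fun i => weight d (A i)) = Finset.univ.val.map (fun i =>
        weight d (B i))) :
    Equidecomposable (fun i => openSimplex (A i)) (fun i => openSimplex (B i)) := by
  classical
  have hequiv : ∀ w, Nonempty ({i // weight d (A i) = w} ≃ {i // weight d (B i) = w}) := by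
    intro w
    have := congrArg (Multiset.count w) h
    rw [Multiset.count_map, Multiset.count_map] at this
    rw [← Fintype.card_eq, Fintype.card_subtype, Fintype.card_subtype]
    simp only [Finset.card, Finset.filter_val]
    simpa only [eq_comm] using this
  let e : ι ≃ κ := (Equiv.sigmaFiberEquiv fun i => weight d (A i)).symm.trans
    ((Equiv.sigmaCongrRight fun w => (hequiv w).some).trans
      (Equiv.sigmaFiberEquiv fun i => weight d (B i)))
  have he : ∀ i, weight d (A i) = weight d (B (e i)) := fun i =>
    ((hequiv (weight d (A i))).some ⟨i, rfl⟩).2.symm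
  choose g hg using fun i => exists_image_eq_of_weight_eq hd (hA i) (hB (e i)) (he i)
  exact equidecomposable_of_equiv (fun i => (hA i).1.isOpen) (fun i => (hA i).isSemilinear hd) e g
    fun i => by rw [AffineUnimodular.image_openSimplex, hg]

/-- Exchanging two members of a family for two others that cover the same region. -/
lemma equidecomposable_of_exchange (hd : 0 < d) {ι : Type} [Fintype ι] {A B : ι → Finset Plane}
    (hA : ∀ k, IsMinimalTriangle d (A k)) (hB : ∀ k, IsMinimalTriangle d (B k)) {i j : ι}
    (hAB : ∀ k, k ≠ i → k ≠ j → A k = B k)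
    (hAd : Disjoint (openSimplex (A i)) (openSimplex (A j)))
    (hBd : Disjoint (openSimplex (B i)) (openSimplex (B j)))
    (hull : convexHull ℝ (A i : Set Plane) ∪ convexHull ℝ (A j : Set Plane) =
      convexHull ℝ (B i : Set Plane) ∪ convexHull ℝ (B j : Set Plane)) :
    Equidecomposable (fun k => openSimplex (A k)) (fun k => openSimplex (B k)) := by
  classical
  let f : ι → ι := fun k => if k = j then i else k
  have hfi : f i = i := by simp [f]
  have hfj : f j = i := by simp [f]
  have hf : ∀ k l, k ≠ l → f k = f l → (k = i ∧ l = j) ∨ (k = j ∧ l = i) := by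
    intro k l hkl h
    simp only [f] at h
    split_ifs at h with h1 h2 h2
    · exact absurd (h1.trans h2.symm) hkl
    · exact Or.inr ⟨h1, h.symm⟩
    · exact Or.inl ⟨h, h2⟩
    · exact absurd h hkl
  have dis : ∀ {C : ι → Finset Plane}, Disjoint (openSimplex (C i)) (openSimplex (C j)) →
      ∀ k l, k ≠ l → f k = f l → Disjoint (openSimplex (C k)) (openSimplex (C l)) := by
    intro C hC k l hkl h
    rcases hf k l hkl h with ⟨rfl, rfl⟩ | ⟨rfl, rfl⟩
    exacts [hC, hC.symm]
  have cov : ∀ {C D : ι → Finset Plane}, (∀ k, k ≠ i → k ≠ j → C k = D k) →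
      convexHull ℝ (C i : Set Plane) ∪ convexHull ℝ (C j : Set Plane) =
        convexHull ℝ (D i : Set Plane) ∪ convexHull ℝ (D j : Set Plane) →
      ∀ k, openSimplex (C k) ⊆ closure (⋃ l, ⋃ (_ : f l = f k), openSimplex (D l)) := by
    intro C D hCD hh k
    have sub : ∀ l, f l = f k →
        convexHull ℝ (D l : Set Plane) ⊆ closure (⋃ l, ⋃ (_ : f l = f k), openSimplex (D l)) := by
      intro l hl
      rw [← closure_openSimplex]
      exact closure_mono (subset_iUnion₂ (s := fun l (_ : f l = f k) => openSimplex (D l)) l hl)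
    by_cases hk : k = i ∨ k = j
    · have hfk : f k = i := by rcases hk with rfl | rfl <;> assumption
      have h1 : openSimplex (C k) ⊆ convexHull ℝ (D i : Set Plane) ∪ convexHull ℝ (D j :
          Set Plane) := by
        rw [← hh]
        rcases hk with rfl | rfl
        · exact (openSimplex_subset_convexHull _).trans subset_union_left
        · exact (openSimplex_subset_convexHull _).trans subset_union_right
      exact h1.trans (union_subset (sub i (hfi.trans hfk.symm)) (sub j (hfj.trans hfk.symm)))
    · push Not at hk
      rw [hCD k hk.1 hk.2]
      exact (openSimplex_subset_convexHull _).trans (sub k rfl)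
  exact equidecomposable_of_groups f (fun k => (hA k).1.isOpen) (fun k => (hA k).isSemilinear hd)
    (fun k => (hB k).1.isOpen) (fun k => (hB k).isSemilinear hd) (dis hAd) (dis hBd) (cov hAB hull)
    (cov (fun k h1 h2 => (hAB k h1 h2).symm) hull.symm)

lemma exists_pair_of_map_eq {ι β : Type*} [Fintype ι] [DecidableEq ι] {w : ι → β} {x y : β}
    {ρ : Multiset β} (h : Finset.univ.val.map w = {x, y} + ρ) :
    ∃ i j, i ≠ j ∧ w i = x ∧ w j = y ∧
      ∀ w' : ι → β, (∀ k, k ≠ i → k ≠ j → w' k = w k) →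
        Finset.univ.val.map w' = {w' i, w' j} + ρ := by
  have split : ∀ (s : Finset ι) (i : ι), i ∈ s → ∀ w' : ι → β,
      s.val.map w' = w' i ::ₘ (s.erase i).val.map w' := by
    intro s i hi w'
    conv_lhs => rw [← Finset.insert_erase hi, Finset.insert_val_of_notMem (Finset.notMem_erase i s)]
    exact Multiset.map_cons _ _ _
  rw [Multiset.insert_eq_cons, Multiset.cons_add, Multiset.singleton_add] at h
  obtain ⟨i, hi, rfl⟩ : ∃ i ∈ (Finset.univ : Finset ι).val, w i = x :=
    Multiset.mem_map.1 (h ▸ Multiset.mem_cons_self _ _)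
  rw [split _ i hi, Multiset.cons_inj_right] at h
  obtain ⟨j, hj, rfl⟩ : ∃ j ∈ ((Finset.univ : Finset ι).erase i).val, w j = y :=
    Multiset.mem_map.1 (h ▸ Multiset.mem_cons_self _ _)
  rw [split _ j hj, Multiset.cons_inj_right] at h
  refine ⟨i, j, (Finset.ne_of_mem_erase hj).symm, rfl, rfl, fun w' hw' => ?_⟩
  rw [split _ i hi, split _ j hj, ← h, Multiset.insert_eq_cons, Multiset.cons_add,
    Multiset.singleton_add]
  congr 2
  exact Multiset.map_congr rfl fun k hk =>
    hw' k (Finset.ne_of_mem_erase (Finset.mem_of_mem_erase hk)) (Finset.ne_of_mem_erase hk)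

/-- Pseudo-flips are realised by equidecompositions: a pseudo-flip of weights is, for a suitable
choice of the triangles that have these weights, the exchange of a diagonal. -/
theorem equidecomposable_of_pseudoFlips (hd : 0 < d) {κ : Type} [Fintype κ] {A : κ → Finset Plane}
    (hA : ∀ i, IsMinimalTriangle d (A i)) {τ : Multiset (Multiset (ZMod d))}
    (h : Relation.ReflTransGen (PseudoFlip d) (Finset.univ.val.map fun i => weight d (A i)) τ)
    {ι : Type} [Fintype ι] {B : ι → Finset Plane} (hB : ∀ i, IsMinimalTriangle d (B i))
    (hτ : Finset.univ.val.map (fun i => weight d (B i)) = τ) :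
    Equidecomposable (fun i => openSimplex (A i)) (fun i => openSimplex (B i)) := by
  classical
  induction h generalizing B with
  | refl => exact equidecomposable_of_weights_eq hd hA hB hτ.symm
  | @tail σ τ _ hstep ih =>
    obtain ⟨ρ, ω₁, ω₂, ω₁', ω₂', ⟨a, b, c, e, m1, m2, hpar, rfl, rfl, rfl, rfl⟩, rfl, rfl⟩ := hstep
    obtain ⟨p1, p2, m3, m4, -, -⟩ := parallelogram_flip hd hpar m1 m2
    have e1 : ({b, a, e} : Finset Plane) = {a, b, e} := Finset.insert_comm _ _ _
    have e2 : ({a, e, c} : Finset Plane) = {a, c, e} := by rw [Finset.pair_comm]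
    have e3 : ({b, a, c} : Finset Plane) = {a, b, c} := Finset.insert_comm _ _ _
    have e4 : ({b, e, c} : Finset Plane) = {b, c, e} := by rw [Finset.pair_comm]
    have p3 : Disjoint (openSimplex {a, b, c}) (openSimplex {b, c, e}) := by
      have := (parallelogram_flip hd hpar.symm (e1 ▸ m3) (e2 ▸ m4)).2.1
      rwa [e3, e4] at this
    obtain ⟨i, j, hij, hi, hj, hrep⟩ := exists_pair_of_map_eq hτ
    let C : Finset Plane → Finset Plane → ι → Finset Plane := fun s t k =>
      if k = i then s else if k = j then t else B k
    have Ci : ∀ s t, C s t i = s := fun s t => by simp [C]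
    have Cj : ∀ s t, C s t j = t := fun s t => by simp [C, hij.symm]
    have Ck : ∀ s t k, k ≠ i → k ≠ j → C s t k = B k := fun s t k h1 h2 => by simp [C, h1, h2]
    have Cm : ∀ {s t}, IsMinimalTriangle d s → IsMinimalTriangle d t →
        ∀ k, IsMinimalTriangle d (C s t k) := by
      intro s t hs ht k
      simp only [C]
      split_ifs
      exacts [hs, ht, hB k]
    refine (ih (B := C {a, b, c} {b, c, e}) (Cm m1 m2) ?_).trans
      ((equidecomposable_of_exchange hd (i := i) (j := j) (Cm m1 m2) (Cm m3 m4) ?_ ?_ ?_ ?_).trans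
      (equidecomposable_of_weights_eq hd (Cm m3 m4) hB ?_))
    · rw [hrep _ fun k h1 h2 => by rw [Ck _ _ k h1 h2], Ci, Cj]
    · exact fun k h1 h2 => by rw [Ck _ _ k h1 h2, Ck _ _ k h1 h2]
    · rw [Ci, Cj]; exact p3
    · rw [Ci, Cj]; exact p2
    · rw [Ci, Cj, Ci, Cj]; exact p1.symm
    · rw [hrep _ fun k h1 h2 => by rw [Ck _ _ k h1 h2], Ci, Cj, hτ]

/-! ### Equidecompositions give facet maps -/

/-- Disjoint rational triangles that are dense in the tiles of a tiling of `P` are the facets of a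
triangulation of `P`. -/
lemma IsTiling.exists_triangulation_of_dense {P : Set Plane} {T : Finset (Finset Plane)}
    (hT : IsTiling d P T) {J : Type} [Fintype J] [DecidableEq (Finset Plane)] {F : J → Finset Plane}
    (htri : ∀ j, IsTriangle (F j)) (hrat : ∀ j, ∀ p ∈ F j, IsRat p)
    (hsub : ∀ j, ∃ t ∈ T, openSimplex (F j) ⊆ openSimplex t)
    (hdis : ∀ i j, i ≠ j → Disjoint (openSimplex (F i)) (openSimplex (F j)))
    (hdense : ∀ t ∈ T, ∀ O, IsOpen O → (O ∩ openSimplex t).Nonempty →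
      ∃ j, (O ∩ openSimplex (F j)).Nonempty) :
    ∃ 𝒯 : Triangulation P, 𝒯.facets = Finset.univ.image F := by
  refine exists_triangulation_facets_eq (by simpa using htri) (by simpa using hrat) ?_ ?_
  · intro s hs t ht hst
    obtain ⟨i, -, rfl⟩ := Finset.mem_image.1 hs
    obtain ⟨j, -, rfl⟩ := Finset.mem_image.1 ht
    exact hdis i j fun h => hst (h ▸ rfl)
  · apply Set.Subset.antisymm
    · refine iUnion₂_subset fun s hs => ?_
      obtain ⟨j, -, rfl⟩ := Finset.mem_image.1 hs
      obtain ⟨t, ht, htj⟩ := hsub j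
      rw [← closure_openSimplex]
      refine (closure_mono htj).trans ?_
      rw [closure_openSimplex]
      exact hT.hull_subset ht
    · rw [← hT.cover]
      refine iUnion₂_subset fun t ht => ?_
      have hcl := (isCompact_biUnion_hull (Finset.univ.image F)).isClosed
      rw [← closure_openSimplex]
      refine closure_minimal (fun x hx => ?_) hcl
      by_contra hc
      obtain ⟨j, y, hy, hyj⟩ := hdense t ht _ hcl.isOpen_compl ⟨x, hc, hx⟩
      exact hy (mem_iUnion₂.2 ⟨F j, Finset.mem_image_of_mem _ (Finset.mem_univ j),
        openSimplex_subset_convexHull _ hyj⟩)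

/-- The facets of triangulations of the pieces, and their images, are the facets of the two
triangulations. -/
theorem exists_facetMap_of_equidecomposable {P Q : Set Plane} {T T' : Finset (Finset Plane)}
    (hT : IsTiling d P T) (hT' : IsTiling d Q T')
    (h : Equidecomposable (fun t : T => openSimplex t.1) (fun t : T' => openSimplex t.1)) :
    ∃ (T₁ : Triangulation P) (T₂ : Triangulation Q), Nonempty (FacetMap T₁ T₂) := by
  classical
  obtain ⟨K, _, U, a, b, g, hU, hUs, hUm, hUa, hUb, hUA, hUB⟩ := h
  have hbdd : ∀ k, Bornology.IsBounded (U k) := fun k =>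
    (isCompact_hull (a k).1).isBounded.subset fun x hx =>
      openSimplex_subset_convexHull _ (hUm k x hx).1
  let τ := fun k => (exists_triangulation_of_isSemilinear (hUs k) (hbdd k)).some
  let J := Σ k, (τ k).facets
  let F : J → Finset Plane := fun j => j.2.1
  let F' : J → Finset Plane := fun j => (F j).image (g j.1).act
  have hFU : ∀ j : J, openSimplex (F j) ⊆ U j.1 := fun j =>
    (τ j.1).subset (mem_simplices_of_mem_facets j.2.2)
  have htri : ∀ j, IsTriangle (F j) := fun j => isTriangle_of_mem_facets j.2.2
  have hrat : ∀ j, ∀ p ∈ F j, IsRat p := fun j p hp =>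
    (τ j.1).rational _ (mem_simplices_of_mem_facets j.2.2) p hp
  have hF' : ∀ j, openSimplex (F' j) = (g j.1).act '' openSimplex (F j) := fun j =>
    ((g j.1).image_openSimplex _).symm
  have hne : ∀ j, (openSimplex (F j)).Nonempty := fun j =>
    openSimplex_nonempty (Finset.card_pos.1 (by rw [(htri j).1]; norm_num))
  -- pieces over the same set of the decomposition
  have hsame : ∀ (k) (f f' : (τ k).facets), f ≠ f' →
      Disjoint (openSimplex f.1) (openSimplex f'.1) := fun k f f' hff =>
    (τ k).disjoint _ (mem_simplices_of_mem_facets f.2) _ (mem_simplices_of_mem_facets f'.2)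
      fun h => hff (Subtype.ext h)
  have hmeet : ∀ k O, IsOpen O → (∃ x ∈ U k, x ∈ O) →
      ∃ f : (τ k).facets, ∃ y ∈ openSimplex f.1, y ∈ O := by
    rintro k O hO ⟨x, hx, hxO⟩
    obtain ⟨y, hyO, hy⟩ :=
      mem_closure_iff.1 ((τ k).subset_closure_facets (hU k) subset_rfl hx) O hO hxO
    obtain ⟨f, hf, hyf⟩ := mem_iUnion₂.1 hy
    exact ⟨⟨f, hf⟩, y, hyf, hyO⟩
  have hdis : ∀ i j, i ≠ j → Disjoint (openSimplex (F i)) (openSimplex (F j)) := by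
    rintro ⟨k, f⟩ ⟨k', f'⟩ hij
    rw [Set.disjoint_left]
    intro x hx hx'
    have h1 := hFU _ hx
    have h2 := hFU _ hx'
    have hak : a k = a k' := by
      by_contra hne
      exact Set.disjoint_left.1 (hT.disjoint _ (a k).2 _ (a k').2 fun h => hne (Subtype.ext h))
        (hUm k x h1).1 (hUm k' x h2).1
    obtain rfl : k = k' := hUa k k' x hak h1 h2
    exact Set.disjoint_left.1 (hsame k f f' fun h => hij (h ▸ rfl)) hx hx'
  have hdis' : ∀ i j, i ≠ j → Disjoint (openSimplex (F' i)) (openSimplex (F' j)) := by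
    rintro ⟨k, f⟩ ⟨k', f'⟩ hij
    rw [Set.disjoint_left, hF', hF']
    rintro _ ⟨x, hx, rfl⟩ ⟨y, hy, hxy⟩
    have h1 := hFU _ hx
    have h2 := hFU _ hy
    change (g k').act y = (g k).act x at hxy
    have hbk : b k = b k' := by
      by_contra hne
      exact Set.disjoint_left.1 (hT'.disjoint _ (b k).2 _ (b k').2 fun h => hne (Subtype.ext h))
        (hUm k x h1).2 (hxy ▸ (hUm k' y h2).2)
    obtain rfl : k = k' := hUb k k' x y hbk h1 h2 hxy.symm
    obtain rfl := (g k).injective hxy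
    exact Set.disjoint_left.1 (hsame k f f' fun h => hij (h ▸ rfl)) hx hy
  have hinj : Function.Injective F := by
    intro i j hij
    by_contra hne'
    have := hdis i j hne'
    rw [hij] at this
    obtain ⟨x, hx⟩ := hne j
    exact Set.disjoint_left.1 this hx hx
  have hinj' : Function.Injective F' := by
    intro i j hij
    by_contra hne'
    have := hdis' i j hne'
    rw [hij, hF'] at this
    obtain ⟨x, hx⟩ := (hne j).image (g j.1).act
    exact Set.disjoint_left.1 this hx hx
  obtain ⟨T₁, hT₁⟩ := hT.exists_triangulation_of_dense htri hrat
    (fun j => ⟨a j.1, (a j.1).2, fun x hx => (hUm j.1 x (hFU j hx)).1⟩) hdis (by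
      intro t ht O hO hOt
      obtain ⟨k, -, hk⟩ := hUA ⟨t, ht⟩ O hO hOt
      obtain ⟨f, y, hy, hyO⟩ := hmeet k O hO hk
      exact ⟨⟨k, f⟩, y, hyO, hy⟩)
  obtain ⟨T₂, hT₂⟩ := hT'.exists_triangulation_of_dense (F := F') (fun j => (htri j).image _)
    (by
      intro j p hp
      obtain ⟨q, hq, rfl⟩ := Finset.mem_image.1 hp
      exact act_isRat _ (hrat j q hq))
    (fun j => ⟨b j.1, (b j.1).2, by
      rw [hF']
      rintro _ ⟨x, hx, rfl⟩
      exact (hUm j.1 x (hFU j hx)).2⟩) hdis' (by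
      intro t ht O hO hOt
      obtain ⟨k, -, hk⟩ := hUB ⟨t, ht⟩ O hO hOt
      obtain ⟨f, y, hy, hyO⟩ := hmeet k _ (hO.preimage (g k).continuous) hk
      exact ⟨⟨k, f⟩, _, hyO, by rw [hF']; exact mem_image_of_mem _ hy⟩)
  have hb : ∀ {T₀ : Finset (Finset Plane)} {f : J → Finset Plane}, Function.Injective f →
      T₀ = Finset.univ.image f → ∃ e : J ≃ T₀, ∀ j, (e j : Finset Plane) = f j := by
    rintro T₀ f hf rfl
    refine ⟨Equiv.ofBijective (fun j => ⟨f j, Finset.mem_image_of_mem f (Finset.mem_univ j)⟩)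
      ⟨fun i j hij => hf (congrArg Subtype.val hij), ?_⟩, fun _ => rfl⟩
    rintro ⟨s, hs⟩
    obtain ⟨j, -, rfl⟩ := Finset.mem_image.1 hs
    exact ⟨j, rfl⟩
  obtain ⟨e, he⟩ := hb hinj hT₁
  obtain ⟨e', he'⟩ := hb hinj' hT₂
  refine ⟨T₁, T₂, ⟨e.symm.trans e', fun f => g (e.symm f).1, fun f => ?_⟩⟩
  obtain ⟨j, rfl⟩ := e.surjective f
  rw [Equiv.trans_apply, Equiv.symm_apply_apply, he, he', hF']

end

section

/-! ### Tilings of the facets of a triangulation -/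

variable {d : ℕ} {P Q : Set Plane}

lemma interior_hull {t : Finset Plane} (ht : IsTriangle t) :
    interior (convexHull ℝ (t : Set Plane)) = openSimplex t := by
  have hne : (interior (openSimplex t)).Nonempty := by
    rw [ht.isOpen.interior_eq]
    exact openSimplex_nonempty (Finset.card_pos.1 (by rw [ht.1]; norm_num))
  rw [← closure_openSimplex,
    (convex_openSimplex t).interior_closure_eq_interior_of_nonempty_interior hne,
    ht.isOpen.interior_eq]

/-- Near an interior point of an edge the boundary of a triangle is a straight line. -/
lemma vertices_hull_subset {t : Finset Plane} (ht : IsTriangle t) :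
    vertices (convexHull ℝ (t : Set Plane)) ⊆ t := by
  rintro x ⟨hx, hline⟩
  have hx' : x ∈ convexHull ℝ (t : Set Plane) ∧ x ∉ openSimplex t := by
    rw [← interior_hull ht]
    exact ⟨(isClosed_hull t).frontier_subset hx, hx.2⟩
  have key : ∀ p q r : Plane, t = {p, q, r} → 0 < orient p q r → x ∈ openSegment ℝ p q → False := by
    rintro p q r rfl ho hxe
    have hpq := (ne_of_orient ho.ne').1
    refine hline ⟨q - p, sub_ne_zero.2 hpq.symm, ?_⟩
    obtain ⟨a, -, -, hax⟩ := mem_openSegment_iff.1 hxe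
    have hl : ∀ z, orient p q z = 0 ↔ ∃ s : ℝ, z = x + s • (q - p) := by
      intro z
      constructor
      · intro hz
        obtain ⟨b, rfl⟩ := exists_eq_of_orient_eq_zero hpq hz
        exact ⟨b - a, by rw [← hax]; module⟩
      · rintro ⟨s, rfl⟩
        have : x + s • (q - p) = (1 - (a + s)) • p + (a + s) • q := by rw [← hax]; module
        rw [this, orient_combo_pair]; simp
    filter_upwards [eventually_mem_openSimplex ho hxe, eventually_mem_hull ho hxe] with z h1 h2
    rw [← hl, (isClosed_hull _).frontier_eq, interior_hull ht]
    constructor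
    · rintro ⟨h3, h4⟩
      have h5 := ((mem_convexHull_iff_orient ho z).1 h3).2.2
      by_contra hne
      exact h4 (h1 (lt_of_le_of_ne h5 (Ne.symm hne)))
    · intro h3
      exact ⟨h2 h3.ge, fun h4 => ((mem_openSimplex_iff ho z).1 h4).2.2.ne' h3⟩
  rcases hull_cases ht hx'.1 with h | ⟨p, hp, q, hq, hpq, h⟩ | h
  · exact h
  · exfalso
    obtain ⟨r, hr, ho⟩ := ht.exists_third hp hq hpq
    rcases lt_or_gt_of_ne ho with ho | ho
    · exact key q p r (hr.trans (Finset.insert_comm _ _ _)) (by rw [orient_swap']; linarith)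
        (openSegment_symm ℝ p q ▸ h)
    · exact key p q r hr ho h
  · exact absurd h hx'.2

lemma IsTriangle.isPolygon_hull {t : Finset Plane} (ht : IsTriangle t) :
    IsPolygon (convexHull ℝ (t : Set Plane)) :=
  ⟨{t}, Finset.singleton_nonempty t, by simpa using ht, by simp⟩

lemma lattice_mono {m n : ℕ} (h : m ∣ n) : lattice m ⊆ lattice n := by
  obtain ⟨k, rfl⟩ := h
  intro x hx i
  obtain ⟨a, ha⟩ := hx i
  exact ⟨k * a, by push_cast; rw [← ha]; ring⟩

lemma exists_lattice_of_isRat (S : Finset Plane) (hS : ∀ p ∈ S, IsRat p) :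
    ∃ n : ℕ, 0 < n ∧ ∀ p ∈ S, p ∈ lattice n := by
  classical
  induction S using Finset.induction_on with
  | empty => exact ⟨1, one_pos, by simp⟩
  | insert p S hp ih =>
    obtain ⟨n, hn, h⟩ := ih fun q hq => hS q (Finset.mem_insert_of_mem hq)
    choose a ha using hS p (Finset.mem_insert_self p S)
    refine ⟨n * ((a 0).den * (a 1).den),
      Nat.mul_pos hn (Nat.mul_pos (a 0).den_pos (a 1).den_pos), fun q hq => ?_⟩
    rcases Finset.mem_insert.1 hq with rfl | hq
    · have key : ∀ r : ℚ, (r.den : ℝ) * r = r.num := fun r => by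
        exact_mod_cast Rat.den_mul_eq_num r
      refine lattice_mono (Dvd.intro_left n rfl) (Fin.forall_fin_two.2 ⟨?_, ?_⟩)
      · refine ⟨(a 1).den * (a 0).num, ?_⟩
        rw [ha 0]; push_cast; rw [← key (a 0)]; ring
      · refine ⟨(a 0).den * (a 1).num, ?_⟩
        rw [ha 1]; push_cast; rw [← key (a 1)]; ring
    · exact lattice_mono (Dvd.intro _ rfl) (h q hq)

lemma AffineUnimodular.image_closure (g : AffineUnimodular) (S : Set Plane) :
    g.act '' closure S = closure (g.act '' S) := by
  obtain ⟨g', h1, h2⟩ := g.exists_inverse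
  exact (⟨⟨g.act, g'.act, h1, h2⟩, g.continuous, g'.continuous⟩ : Plane ≃ₜ Plane).image_closure S

lemma AffineUnimodular.image_hull (g : AffineUnimodular) (s : Finset Plane) :
    g.act '' convexHull ℝ (s : Set Plane) =
      convexHull ℝ ((s.image g.act : Finset Plane) : Set Plane) := by
  rw [← closure_openSimplex, ← closure_openSimplex, g.image_closure, g.image_openSimplex]

lemma IsTiling.image (hd : 0 < d) {T : Finset (Finset Plane)} (hT : IsTiling d P T)
    (g : AffineUnimodular) : IsTiling d (g.act '' P) (T.image (Finset.image g.act)) := by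
  refine ⟨?_, ?_, ?_⟩
  · intro s hs
    obtain ⟨t, ht, rfl⟩ := Finset.mem_image.1 hs
    exact (hT.minimal t ht).image hd g
  · intro s hs t ht hst
    obtain ⟨s, hs', rfl⟩ := Finset.mem_image.1 hs
    obtain ⟨t, ht', rfl⟩ := Finset.mem_image.1 ht
    rw [← g.image_openSimplex, ← g.image_openSimplex, Set.disjoint_image_iff g.injective]
    exact hT.disjoint s hs' t ht' fun h => hst (h ▸ rfl)
  · rw [Finset.set_biUnion_finset_image, ← hT.cover, image_iUnion₂]
    simp only [g.image_hull]

lemma IsTiling.tilingWeights_image (hd : 0 < d) {T : Finset (Finset Plane)} (hT : IsTiling d P T)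
    (g : AffineUnimodular) :
    tilingWeights d (T.image (Finset.image g.act)) = tilingWeights d T := by
  rw [tilingWeights, Finset.image_val_of_injOn (Finset.image_injective g.injective).injOn,
    Multiset.map_map]
  exact Multiset.map_congr rfl fun t ht => weight_image hd (hT.minimal t ht) g

/-- Tilings of the members of a family of triangles with disjoint interiors form a tiling of the
union. -/
lemma isTiling_biUnion {I : Type*} [Fintype I] {R : I → Finset Plane}
    (hR : ∀ i, IsTriangle (R i))
    (hdis : ∀ i j, i ≠ j → Disjoint (openSimplex (R i)) (openSimplex (R j)))
    (hcov : ⋃ i, convexHull ℝ (R i : Set Plane) = P) {T : I → Finset (Finset Plane)}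
    (hT : ∀ i, IsTiling d (convexHull ℝ (R i : Set Plane)) (T i)) :
    IsTiling d P (Finset.univ.biUnion T) ∧
      tilingWeights d (Finset.univ.biUnion T) =
        Finset.univ.val.bind fun i => tilingWeights d (T i) := by
  have hsub : ∀ i, ∀ s ∈ T i, openSimplex s ⊆ openSimplex (R i) := by
    intro i s hs
    rw [← interior_hull (hR i)]
    exact interior_maximal ((openSimplex_subset_convexHull s).trans ((hT i).hull_subset hs))
      ((hT i).minimal s hs).1.isOpen
  have hdj : ∀ i j, i ≠ j → ∀ s ∈ T i, ∀ t ∈ T j, Disjoint (openSimplex s) (openSimplex t) :=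
    fun i j hij s hs t ht => (hdis i j hij).mono (hsub i s hs) (hsub j t ht)
  refine ⟨⟨?_, ?_, ?_⟩, ?_⟩
  · intro s hs
    obtain ⟨i, -, hs⟩ := Finset.mem_biUnion.1 hs
    exact (hT i).minimal s hs
  · intro s hs t ht hst
    obtain ⟨i, -, hs⟩ := Finset.mem_biUnion.1 hs
    obtain ⟨j, -, ht⟩ := Finset.mem_biUnion.1 ht
    by_cases hij : i = j
    · subst hij
      exact (hT i).disjoint s hs t ht hst
    · exact hdj i j hij s hs t ht
  · rw [← hcov, Finset.set_biUnion_biUnion]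
    simp only [Finset.mem_univ, iUnion_true, (hT _).cover]
  · have hpd : ((Finset.univ : Finset I) : Set I).PairwiseDisjoint T := by
      intro i _ j _ hij
      refine Finset.disjoint_left.2 fun s hs hs' => ?_
      obtain ⟨x, hx⟩ := openSimplex_nonempty (s := s)
        (Finset.card_pos.1 (by rw [((hT i).minimal s hs).1.1]; norm_num))
      exact Set.disjoint_left.1 (hdj i j hij s hs s hs') hx hx
    rw [← Finset.disjiUnion_eq_biUnion _ _ hpd, tilingWeights, Finset.disjiUnion_val,
      Multiset.map_bind]
    rfl

/-- If `P` and `Q` have tilings with the same weights, everything that is obtained from a minimal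
triangulation of `P` is obtained from one of `Q`, as the minimal triangulations of `P` are connected
by flips. -/
lemma pseudoTriangulations_subset (hd : 0 < d) (hP : IsPolygon P) {T T' : Finset (Finset Plane)}
    (hT : IsTiling d P T) (hT' : IsTiling d Q T') (h : tilingWeights d T = tilingWeights d T') :
    pseudoTriangulations d P ⊆ pseudoTriangulations d Q := by
  rintro τ ⟨T₀, hmin, hτ⟩
  obtain ⟨𝒯, rfl⟩ := hT'.exists_triangulation hd
  refine ⟨𝒯, hT'.minimal, ?_⟩
  have := pseudoFlips_of_flips hd hT (hT.flip_connected hd (T₀.isTiling hP hmin))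
  rw [h] at this
  exact this.trans hτ

/-- A common tiling of the facets gives tilings of both polygons with the same weights. -/
theorem exists_pseudoTriangulations_eq (hd : 0 < d) (hP : IsPolygon P) (hQ : IsPolygon Q)
    {T₁ : Triangulation P} {T₂ : Triangulation Q} (f : FacetMap T₁ T₂) :
    ∃ d' : ℕ, 0 < d' ∧ d ∣ d' ∧ pseudoTriangulations d' P = pseudoTriangulations d' Q := by
  obtain ⟨n, hn, hlat⟩ := exists_lattice_of_isRat (T₁.facets.biUnion id) (by
    intro p hp
    obtain ⟨F, hF, hp⟩ := Finset.mem_biUnion.1 hp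
    exact T₁.rational F (mem_simplices_of_mem_facets hF) p hp)
  have hd' : 0 < d * n := Nat.mul_pos hd hn
  refine ⟨d * n, hd', Dvd.intro _ rfl, ?_⟩
  have tri : ∀ {S : Set Plane} (T : Triangulation S) (F : T.facets), IsTriangle F.1 :=
    fun T F => isTriangle_of_mem_facets F.2
  have dis : ∀ {S : Set Plane} (T : Triangulation S) (F F' : T.facets), F ≠ F' →
      Disjoint (openSimplex F.1) (openSimplex F'.1) := fun T F F' h =>
    T.disjoint _ (mem_simplices_of_mem_facets F.2) _ (mem_simplices_of_mem_facets F'.2)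
      fun h' => h (Subtype.ext h')
  have cov : ∀ {S : Set Plane}, IsPolygon S → ∀ T : Triangulation S,
      ⋃ F : T.facets, convexHull ℝ (F.1 : Set Plane) = S := by
    intro S hS T
    rw [iUnion_subtype]
    exact T.biUnion_hull_facets hS.isCompact.isClosed hS.subset_closure_interior
  choose R hR using fun F : T₁.facets => (tri T₁ F).isPolygon_hull.exists_tiling hd'
    fun p hp => lattice_mono (Dvd.intro_left d rfl)
      (hlat p (Finset.mem_biUnion.2 ⟨F.1, F.2, vertices_hull_subset (tri T₁ F) hp⟩))
  have hull : ∀ F : T₁.facets, (f.gmap F).act '' convexHull ℝ (F.1 : Set Plane) =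
      convexHull ℝ ((f.toEquiv F).1 : Set Plane) := by
    intro F
    rw [← closure_openSimplex, ← closure_openSimplex, AffineUnimodular.image_closure, f.image_eq]
  obtain ⟨hT, hw⟩ := isTiling_biUnion (tri T₁) (dis T₁) (cov hP T₁) hR
  obtain ⟨hT', hw'⟩ := isTiling_biUnion (R := fun F => (f.toEquiv F).1)
    (T := fun F => (R F).image (Finset.image (f.gmap F).act)) (fun F => tri T₂ _)
    (fun F F' h => dis T₂ _ _ fun h' => h (f.toEquiv.injective h'))
    ((f.toEquiv.surjective.iUnion_comp fun F => convexHull ℝ (F.1 : Set Plane)).trans (cov hQ T₂))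
    (fun F => hull F ▸ (hR F).image hd' (f.gmap F))
  have hww : tilingWeights (d * n) (Finset.univ.biUnion R) = tilingWeights (d * n)
      (Finset.univ.biUnion fun F => (R F).image (Finset.image (f.gmap F).act)) := by
    rw [hw, hw']
    simp only [(hR _).tilingWeights_image hd']
  exact Set.Subset.antisymm (pseudoTriangulations_subset hd' hP hT hT' hww)
    (pseudoTriangulations_subset hd' hQ hT' hT hww.symm)

/-- The weights of a minimal triangulation of `Q` are reached by pseudo-flips from those of a minimal
triangulation of `P`. -/
theorem exists_facetMap (hd : 0 < d) (hP : IsPolygon P) (hQ : IsPolygon Q)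
    (hv : ∀ p ∈ vertices Q, p ∈ lattice d)
    (h : pseudoTriangulations d P = pseudoTriangulations d Q) :
    ∃ (T₁ : Triangulation P) (T₂ : Triangulation Q), Nonempty (FacetMap T₁ T₂) := by
  obtain ⟨T, hT⟩ := hQ.exists_tiling hd hv
  obtain ⟨𝒯, rfl⟩ := hT.exists_triangulation hd
  have hmem : 𝒯.weights d ∈ pseudoTriangulations d P := h ▸ ⟨𝒯, hT.minimal, .refl⟩
  obtain ⟨T₀, hmin, hflips⟩ := hmem
  have hwt : ∀ F : Finset (Finset Plane),
      Finset.univ.val.map (fun t : F => weight d t.1) = F.val.map (weight d) := by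
    intro F
    rw [Finset.univ_eq_attach, Finset.attach_val]
    exact Multiset.attach_map_val' F.val (weight d)
  refine exists_facetMap_of_equidecomposable (T₀.isTiling hP hmin) hT
    (equidecomposable_of_pseudoFlips hd (A := fun t : T₀.facets => t.1)
      (B := fun t : 𝒯.facets => t.1) (fun t => hmin t.1 t.2) ?_ (fun t => hT.minimal t.1 t.2)
      (hwt _))
  rw [hwt]
  exact hflips

end

end FacetMaps

end

theorem mainTheorem3 (d : ℕ) (P Q : Set FacetMaps.Plane)
    (hP : FacetMaps.IsPolygon P) (hQ : FacetMaps.IsPolygon Q)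
    (hPd : FacetMaps.HasDenominator P d) (hQd : FacetMaps.HasDenominator Q d) :
    (∃ d' : ℕ, 0 < d' ∧ d ∣ d' ∧
        FacetMaps.pseudoTriangulations d' P = FacetMaps.pseudoTriangulations d' Q) ↔
      ∃ (T₁ : FacetMaps.Triangulation P) (T₂ : FacetMaps.Triangulation Q),
        Nonempty (FacetMaps.FacetMap T₁ T₂) := by
  constructor
  · rintro ⟨d', hd', hdvd, h⟩
    exact FacetMaps.exists_facetMap hd' hP hQ
      (fun p hp => FacetMaps.lattice_mono hdvd (hQd.1.2 p hp)) h
  · rintro ⟨T₁, T₂, ⟨f⟩⟩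
    exact FacetMaps.exists_pseudoTriangulations_eq hPd.1.1 hP hQ f
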